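/- Let $\mathtt{Act}$ be a fixed finite non-empty set of actions, $k=|\mathtt{Act}|$. Processes are the terms $p::=\mathtt 0\mid a.p\mid p+p$ ($a\in\mathtt{Act}$) with the transitions $a.p\xrightarrow{a}p$, and $p_1+p_2\xrightarrow{a}p'$ iff $p_1\xrightarrow{a}p'$ or $p_2\xrightarrow{a}p'$; $\mathrm{depth}(p)$ is the length of a longest trace of $p$. The trace simulation preorder $\lesssim_{TS}$ is the largest relation on processes such that $p\lesssim_{TS}q$ iff $\mathrm{traces}(p)=\mathrm{traces}(q)$ and for every $p\xrightarrow{a}p'$ there is $q\xrightarrow{a}q'$ with $p'\lesssim_{TS}q'$. The logic $\mathcal L_{TS}$ consists of the formulae $\varphi::=\mathbf{tt}\mid\mathbf{ff}\mid\varphi\wedge\varphi\mid\varphi\vee\varphi\mid\langle a\rangle\varphi\mid\psi$, where $\psi::=\mathbf{ff}\mid[a]\psi$, with the usual Hennessy--Milner semantics. Write $|\varphi|$ for the number of symbols of $\varphi$ and $\mathrm{md}(\varphi)$ for its modal depth. A formula $\varphi\in\mathcal L_{TS}$ is prime if for all $\varphi_1,\varphi_2\in\mathcal L_{TS}$, $\varphi\models\varphi_1\vee\varphi_2$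 implies $\varphi\models\varphi_1$ or $\varphi\models\varphi_2$. Let $\operatorname{tow}(k,0)=1$ and $\operatorname{tow}(k,d+1)=k\cdot 2^{\operatorname{tow}(k,d)}$. (1) There is an algorithm (a multi-tape Turing machine that reads formulae as words over a fixed finite alphabet) that decides, given $\varphi\in\mathcal L_{TS}$ with $\mathrm{md}(\varphi)=d$, whether $\varphi$ is prime, in time $\mathcal O(\operatorname{tow}(k,d)^3\cdot|\varphi|)$, where the constant in $\mathcal O$ depends only on $\mathtt{Act}$. (2) Consequently, primality of formulae in $\mathcal L_{TS}$ is fixed-parameter tractable with the modal depth as the parameter: there are a computable function $f$ and a constant $\alpha$ such that it is decidable in time $f(\mathrm{md}(\varphi))\cdot|\varphi|^{\alpha}$. (3) For every $\varphi\in\mathcal L_{TS}$ with $\mathrm{md}(\varphi)=d$: $\varphi$ is satisfiable and prime if and only if there is a process $p$ with $\mathrm{depth}(p)\le d$ and $p\models\varphi$ such that $p\lesssim_{TS}q$ for every process $q$ with $\mathrm{depth}(q)\le d+1$ and $q\models\varphi$. -/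

import Mathlib

namespace HM

/-! ### Finite loop-free processes (CCS terms) and their transitions -/

/-- The terms `p ::= 0 | a.p | p + p`, which are the states of the ambient transition system. -/
inductive Proc (Act : Type) : Type
  | nil : Proc Act
  | pre : Act → Proc Act → Proc Act
  | plus : Proc Act → Proc Act → Proc Act

namespace Proc

variable {Act : Type}

/-- `Trans p a p'` : the process `p` has an `a`-transition to `p'`. -/
def Trans : Proc Act → Act → Proc Act → Prop
  | nil, _, _ => False
  | pre b p, a, p' => a = b ∧ p' = p
  | plus p q, a, p' => Trans p a p' ∨ Trans q a p'

/-- `Steps p t q` : there is a sequence of transitions labelled with `t` from `p` to `q`. -/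
def Steps : Proc Act → List Act → Proc Act → Prop
  | p, [], q => p = q
  | p, a :: t, q => ∃ r, Trans p a r ∧ Steps r t q

/-- The set of traces of a process. -/
def traces (p : Proc Act) : Set (List Act) := {t | ∃ q, Steps p t q}

/-- The depth of a process, that is, the length of a longest trace (see `isGreatest_depth`). -/
def depth : Proc Act → ℕ
  | nil => 0
  | pre _ p => depth p + 1
  | plus p q => max (depth p) (depth q)

theorem depth_trans {p : Proc Act} {a : Act} {r : Proc Act} (h : Trans p a r) :
    depth r + 1 ≤ depth p := by
  induction p with
  | nil => exact h.elim
  | pre b p _ => obtain ⟨_, rfl⟩ := h; exact le_rfl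
  | plus p q ihp ihq =>
    rcases h with h | h
    · exact (ihp h).trans (le_max_left _ _)
    · exact (ihq h).trans (le_max_right _ _)

theorem isGreatest_depth (p : Proc Act) : IsGreatest (List.length '' traces p) (depth p) := by
  constructor
  · have key : ∀ p : Proc Act, (∃ t ∈ traces p, t.length = depth p) := by
      intro p
      induction p with
      | nil => exact ⟨[], ⟨_, rfl⟩, rfl⟩
      | pre b p ih =>
        obtain ⟨t, ⟨q, hq⟩, ht⟩ := ih
        exact ⟨b :: t, ⟨q, p, ⟨rfl, rfl⟩, hq⟩, by simp [depth, ht]⟩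
      | plus p q ihp ihq =>
        have aux : ∀ s : Proc Act, (∀ a r, Trans s a r → Trans (plus p q) a r) →
            ∀ t ∈ traces s, t ∈ traces (plus p q) := by
          rintro s hs (_ | ⟨a, t⟩) ⟨u, hu⟩
          · exact ⟨_, rfl⟩
          · obtain ⟨r, hr, hu⟩ := hu
            exact ⟨u, r, hs _ _ hr, hu⟩
        rcases le_total (depth p) (depth q) with h | h
        · obtain ⟨t, ht, hl⟩ := ihq
          exact ⟨t, aux q (fun _ _ => Or.inr) t ht, by simp [depth, hl, h]⟩
        · obtain ⟨t, ht, hl⟩ := ihp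
          exact ⟨t, aux p (fun _ _ => Or.inl) t ht, by simp [depth, hl, h]⟩
    exact key p
  · rintro _ ⟨t, ⟨q, hq⟩, rfl⟩
    induction t generalizing p with
    | nil => exact Nat.zero_le _
    | cons a t ih =>
      obtain ⟨r, hr, hq⟩ := hq
      exact (Nat.succ_le_succ (ih r hq)).trans (depth_trans hr)

/-- The defining condition of the trace simulation preorder, with `R` for the preorder. -/
def TSCond (R : Proc Act → Proc Act → Prop) (p q : Proc Act) : Prop :=
  (∀ a p', Trans p a p' → ∃ q', Trans q a q' ∧ R p' q') ∧ traces p = traces q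

/-- The trace simulation preorder: the largest relation with `p ≲ q ↔ TSCond (· ≲ ·) p q`,
obtained as the union of all relations `R` with `R p q → TSCond R p q`. -/
def TSLe (p q : Proc Act) : Prop :=
  ∃ R : Proc Act → Proc Act → Prop, (∀ p q, R p q → TSCond R p q) ∧ R p q

theorem tsLe_iff (p q : Proc Act) : TSLe p q ↔ TSCond TSLe p q := by
  have h1 : ∀ p q : Proc Act, TSLe p q → TSCond TSLe p q := by
    rintro p q ⟨R, hR, h⟩
    refine ⟨fun a p' hp => ?_, (hR p q h).2⟩
    obtain ⟨q', hq, hr⟩ := (hR p q h).1 a p' hp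
    exact ⟨q', hq, R, hR, hr⟩
  refine ⟨h1 p q, fun h => ⟨TSCond TSLe, fun p q h => ⟨fun a p' hp => ?_, h.2⟩, h⟩⟩
  obtain ⟨q', hq, hr⟩ := h.1 a p' hp
  exact ⟨q', hq, h1 _ _ hr⟩

end Proc

/-! ### Hennessy-Milner logic and the logic of trace simulation -/

/-- The formulae of Hennessy-Milner logic. -/
inductive Formula (Act : Type) : Type
  | tt : Formula Act
  | ff : Formula Act
  | and : Formula Act → Formula Act → Formula Act
  | or : Formula Act → Formula Act → Formula Act
  | dia : Act → Formula Act → Formula Act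
  | box : Act → Formula Act → Formula Act
  | neg : Formula Act → Formula Act

/-- The symbols in which formulae are written (in prefix notation). -/
inductive Symbol (Act : Type) : Type
  | tt : Symbol Act
  | ff : Symbol Act
  | and : Symbol Act
  | or : Symbol Act
  | dia : Act → Symbol Act
  | box : Act → Symbol Act
  | neg : Symbol Act

namespace Formula

variable {Act : Type}

/-- The satisfaction relation `p ⊨ φ`. -/
def Sat : Proc Act → Formula Act → Prop
  | _, tt => True
  | _, ff => False
  | p, and φ ψ => Sat p φ ∧ Sat p ψ
  | p, or φ ψ => Sat p φ ∨ Sat p ψ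
  | p, dia a φ => ∃ q, p.Trans a q ∧ Sat q φ
  | p, box a φ => ∀ q, p.Trans a q → Sat q φ
  | p, neg φ => ¬ Sat p φ

/-- The modal depth of a formula. -/
def md : Formula Act → ℕ
  | tt => 0
  | ff => 0
  | and φ ψ => max (md φ) (md ψ)
  | or φ ψ => max (md φ) (md ψ)
  | dia _ φ => md φ + 1
  | box _ φ => md φ + 1
  | neg φ => md φ

/-- The size `|φ|` of a formula: the number of its symbols. -/
def size : Formula Act → ℕ
  | tt => 1
  | ff => 1
  | and φ ψ => size φ + size ψ + 1
  | or φ ψ => size φ + size ψ + 1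
  | dia _ φ => size φ + 1
  | box _ φ => size φ + 1
  | neg φ => size φ + 1

/-- The formula as a word, in prefix notation. -/
def encode : Formula Act → List (Symbol Act)
  | tt => [Symbol.tt]
  | ff => [Symbol.ff]
  | and φ ψ => Symbol.and :: (encode φ ++ encode ψ)
  | or φ ψ => Symbol.or :: (encode φ ++ encode ψ)
  | dia a φ => Symbol.dia a :: encode φ
  | box a φ => Symbol.box a :: encode φ
  | neg φ => Symbol.neg :: encode φ

theorem length_encode (φ : Formula Act) : (encode φ).length = size φ := by
  induction φ <;> simp_all [encode, size]

/-- `φ` entails `ψ`. -/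
def Entails (φ ψ : Formula Act) : Prop := ∀ p : Proc Act, Sat p φ → Sat p ψ

/-- `φ` is satisfied by some process. -/
def Satisfiable (φ : Formula Act) : Prop := ∃ p : Proc Act, Sat p φ

/-- `φ` is prime in the logic `L`. -/
def PrimeIn (L : Set (Formula Act)) (φ : Formula Act) : Prop :=
  ∀ φ₁ ∈ L, ∀ φ₂ ∈ L, Entails φ (or φ₁ φ₂) → Entails φ φ₁ ∨ Entails φ φ₂

/-- The grammar `ψ ::= ff | [a]ψ`. -/
inductive IsBoxFF : Formula Act → Prop
  | ff : IsBoxFF ff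
  | box (a : Act) {ψ : Formula Act} : IsBoxFF ψ → IsBoxFF (box a ψ)

/-- The grammar `φ ::= tt | ff | φ ∧ φ | φ ∨ φ | ⟨a⟩φ | ψ`, where `ψ ::= ff | [a]ψ`. -/
inductive IsTS : Formula Act → Prop
  | tt : IsTS tt
  | ff : IsTS ff
  | and {φ ψ : Formula Act} : IsTS φ → IsTS ψ → IsTS (and φ ψ)
  | or {φ ψ : Formula Act} : IsTS φ → IsTS ψ → IsTS (or φ ψ)
  | dia (a : Act) {φ : Formula Act} : IsTS φ → IsTS (dia a φ)
  | boxFF {ψ : Formula Act} : IsBoxFF ψ → IsTS ψ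

/-- The logic of the trace simulation preorder. -/
def LTS (Act : Type) : Set (Formula Act) := {φ | IsTS φ}

end Formula

/-! ### Running time -/

/-- The tower function. -/
def tow (k : ℕ) : ℕ → ℕ
  | 0 => 1
  | d + 1 => k * 2 ^ tow k d

/-- Some multi-stack (equivalently, multi-tape) Turing machine with input alphabet `Γ` and output
alphabet `Bool` halts on the code of each instance `x` after at most `T x` steps, with output
`true` if `P x` and with output `false` otherwise. -/
def DecidableInTime {ι Γ : Type} (enc : ι → List Γ) (P : ι → Prop) (T : ι → ℕ) : Prop :=
  open Classical in
  ∃ M : Turing.TM2ComputableAux Γ Bool, ∀ x : ι,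
    Nonempty (Turing.TM2OutputsInTime M.tm ((enc x).map M.inputAlphabet.symm)
      (some ([decide (P x)].map M.outputAlphabet.symm)) (T x))

/-- The problem `P` on instances `x` with code `enc x` and parameter `κ x` is fixed-parameter
tractable: it is decidable in time `f (κ x) * |enc x| ^ α`, where `f` is computable and `α` is
a constant. -/
def IsFPT {ι Γ : Type} (enc : ι → List Γ) (P : ι → Prop) (κ : ι → ℕ) : Prop :=
  ∃ f : ℕ → ℕ, Computable f ∧ ∃ α : ℕ,
    DecidableInTime enc P (fun x => f (κ x) * (enc x).length ^ α)

end HM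

/-! The semantic core is that a satisfiable formula of the logic is prime exactly when its models
have a least element for the preorder. If `p` is a least model, then `φ` entails whatever `p`
satisfies, because satisfaction is monotone, so a disjunction entailed by `φ` is settled at `p`.
Conversely, truncation replaces each model by one of finitely many representatives, and each
representative has a characteristic formula. Hence `φ` entails a finite disjunction of
characteristic formulae, and primality selects one of them: its process is the least model
(`exists_least_of_prime`). This process has depth below every `D ≥ md φ`: formulae of depth at most
`D` see neither a truncation after `D` steps nor an extension behind step `D`, whereas a least model
fixes the trace set of all models. The third claim follows from this; unsatisfiable formulae are
prime vacuously.

For the algorithm, leastness is tested in a finite transition system (`Base.prime_iff`). Up to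
equivalence it contains the processes of depth less than `md φ`, which are the candidates for the
least model. Deeper models need not all be present. Each lies below the largest process with the
same traces, which is then a model too, so comparison with these largest processes already forces
all models to have the traces of the candidate, and thus a small depth. There are only doubly
exponentially many trace sets, so for large depths they are negligible against the tower. A fixed
finite base family absorbs the small depths. Above it, states are numbers that code finite sets of
pairs of an action and a smaller state in binary. If `n` is the number of states, every fixed power
of `n` is bounded by a constant times `tow k (md φ)` (`Base.exists_pow_s_le`).

The running time is proved for programs over finitely many stacks, each step of which is one step of
a compiled Turing machine (`Prog.Exec.stepsIn`). The data are `n × n` truth matrices, and the two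
operations `nand` and `meet` (composition with a converse) express everything that is needed, in
time of order `n ^ 3` each. Transitions are obtained by halving state numbers, trace inclusion by
testing against processes with a single complete trace, and the preorder by a greatest fixed point
iteration. Loops of `n` rounds make the preparation cost of order `n ^ 4`, independently of the
formula. Then the formula, read backwards, is evaluated with a stack of matrices at cost of order `n
^ 3` per symbol. Altogether the time is linear in `tow k (md φ) * |φ|`, which is better than the
cube that is claimed. -/

namespace HM

/-! ### Characteristic formulae and least models -/

namespace Proc

variable {Act : Type}

/-! ### Traces and the trace simulation preorder -/

theorem nil_mem_traces (p : Proc Act) : [] ∈ traces p := ⟨p, rfl⟩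

theorem cons_mem_traces {p : Proc Act} {a : Act} {t : List Act} :
    a :: t ∈ traces p ↔ ∃ r, Trans p a r ∧ t ∈ traces r := by
  constructor
  · rintro ⟨q, r, hr, hq⟩
    exact ⟨r, hr, q, hq⟩
  · rintro ⟨r, hr, q, hq⟩
    exact ⟨q, r, hr, hq⟩

theorem length_le_depth {p : Proc Act} {t : List Act} (h : t ∈ traces p) : t.length ≤ depth p :=
  (isGreatest_depth p).2 ⟨t, h, rfl⟩

theorem exists_length_eq_depth (p : Proc Act) : ∃ t ∈ traces p, t.length = depth p :=
  (isGreatest_depth p).1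

theorem take_mem_traces {p : Proc Act} {t : List Act} (h : t ∈ traces p) (i : ℕ) :
    t.take i ∈ traces p := by
  induction t generalizing p i with
  | nil => simpa using h
  | cons a t ih =>
    cases i with
    | zero => exact nil_mem_traces p
    | succ i =>
      obtain ⟨r, hr, ht⟩ := cons_mem_traces.1 h
      exact cons_mem_traces.2 ⟨r, hr, ih ht i⟩

/-- A process has traces of every length up to its depth. -/
theorem exists_trace_of_le_depth {p : Proc Act} {i : ℕ} (h : i ≤ depth p) :
    ∃ t ∈ traces p, t.length = i := by
  obtain ⟨t, ht, hl⟩ := exists_length_eq_depth p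
  exact ⟨t.take i, take_mem_traces ht i, by simp [hl, h]⟩

theorem depth_le_of_forall {p : Proc Act} {i : ℕ}
    (h : ∀ a r, Trans p a r → depth r + 1 ≤ i) : depth p ≤ i := by
  obtain ⟨t, ht, hl⟩ := exists_length_eq_depth p
  rw [← hl]
  cases t with
  | nil => exact Nat.zero_le _
  | cons a t =>
    obtain ⟨r, hr, ht⟩ := cons_mem_traces.1 ht
    exact (Nat.succ_le_succ (length_le_depth ht)).trans (h a r hr)

theorem TSLe.sim {p q : Proc Act} (h : TSLe p q) {a : Act} {p' : Proc Act} (hp : Trans p a p') :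
    ∃ q', Trans q a q' ∧ TSLe p' q' :=
  ((tsLe_iff p q).1 h).1 a p' hp

theorem TSLe.traces_eq {p q : Proc Act} (h : TSLe p q) : traces p = traces q :=
  ((tsLe_iff p q).1 h).2

theorem TSLe.refl (p : Proc Act) : TSLe p p :=
  ⟨Eq, by rintro p _ rfl; exact ⟨fun a p' h => ⟨p', h, rfl⟩, rfl⟩, rfl⟩

theorem TSLe.trans {p q r : Proc Act} (h₁ : TSLe p q) (h₂ : TSLe q r) : TSLe p r := by
  refine ⟨fun p r => ∃ q, TSLe p q ∧ TSLe q r, ?_, q, h₁, h₂⟩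
  rintro p r ⟨q, h₁, h₂⟩
  refine ⟨fun a p' hp => ?_, h₁.traces_eq.trans h₂.traces_eq⟩
  obtain ⟨q', hq, h₁⟩ := h₁.sim hp
  obtain ⟨r', hr, h₂⟩ := h₂.sim hq
  exact ⟨r', hr, q', h₁, h₂⟩

/-- Trace simulation equivalence. -/
def Eqv (p q : Proc Act) : Prop := TSLe p q ∧ TSLe q p

theorem Eqv.refl (p : Proc Act) : Eqv p p := ⟨.refl p, .refl p⟩

theorem traces_subset_of_forall {p q : Proc Act}
    (h : ∀ a p', Trans p a p' → ∃ q', Trans q a q' ∧ traces p' ⊆ traces q') :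
    traces p ⊆ traces q := by
  rintro (_ | ⟨a, t⟩) ht
  · exact nil_mem_traces q
  · obtain ⟨p', hp, ht⟩ := cons_mem_traces.1 ht
    obtain ⟨q', hq, hs⟩ := h a p' hp
    exact cons_mem_traces.2 ⟨q', hq, hs ht⟩

/-- Matching the transitions already gives one inclusion of the trace sets, so only the reverse
inclusion has to be supplied. -/
theorem tsLe_of_forall {p q : Proc Act}
    (h : ∀ a p', Trans p a p' → ∃ q', Trans q a q' ∧ TSLe p' q') (ht : traces q ⊆ traces p) :
    TSLe p q :=
  (tsLe_iff p q).2 ⟨h, (traces_subset_of_forall fun a p' hp =>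
    let ⟨q', hq, hs⟩ := h a p' hp; ⟨q', hq, hs.traces_eq.subset⟩).antisymm ht⟩

/-- Matching in both directions makes the trace sets equal, which is the side condition of both
simulations. This is the tool for replacing successors by equivalent representatives. -/
theorem eqv_of_forall {p q : Proc Act}
    (h₁ : ∀ a p', Trans p a p' → ∃ q', Trans q a q' ∧ Eqv p' q')
    (h₂ : ∀ a q', Trans q a q' → ∃ p', Trans p a p' ∧ Eqv p' q') : Eqv p q := by
  have t₁ : traces p ⊆ traces q := traces_subset_of_forall fun a p' hp =>
    let ⟨q', hq, hs⟩ := h₁ a p' hp; ⟨q', hq, hs.1.traces_eq.subset⟩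
  have t₂ : traces q ⊆ traces p := traces_subset_of_forall fun a p' hp =>
    let ⟨q', hq, hs⟩ := h₂ a p' hp; ⟨q', hq, hs.2.traces_eq.subset⟩
  exact ⟨tsLe_of_forall (fun a p' hp => let ⟨q', hq, hs⟩ := h₁ a p' hp; ⟨q', hq, hs.1⟩) t₂,
    tsLe_of_forall (fun a p' hp => let ⟨q', hq, hs⟩ := h₂ a p' hp; ⟨q', hq, hs.2⟩) t₁⟩

/-! ### Finite sums, truncations and extensions -/

/-- The sum of the processes `a.p` for the pairs `(a, p)` in a list. -/
def sumList : List (Act × Proc Act) → Proc Act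
  | [] => nil
  | q :: l => plus (pre q.1 q.2) (sumList l)

theorem trans_sumList {l : List (Act × Proc Act)} {a : Act} {p : Proc Act} :
    Trans (sumList l) a p ↔ (a, p) ∈ l := by
  induction l with
  | nil => simp [sumList, Trans]
  | cons q l ih =>
    obtain ⟨b, q⟩ := q
    simp [sumList, Trans, ih]

/-- The sum of the processes `a.p` for the pairs `(a, p)` in a finite set. -/
noncomputable def sumSet (s : Set (Act × Proc Act)) : Proc Act :=
  open Classical in if h : s.Finite then sumList h.toFinset.toList else nil

theorem trans_sumSet {s : Set (Act × Proc Act)} (h : s.Finite) {a : Act} {p : Proc Act} :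
    Trans (sumSet s) a p ↔ (a, p) ∈ s := by
  simp [sumSet, h, trans_sumList]

/-- The pairs `(a, q)` with `p -a-> q`. -/
def succs : Proc Act → List (Act × Proc Act)
  | nil => []
  | pre a p => [(a, p)]
  | plus p q => succs p ++ succs q

theorem mem_succs {p : Proc Act} {a : Act} {q : Proc Act} : (a, q) ∈ succs p ↔ Trans p a q := by
  induction p with
  | nil => simp [succs, Trans]
  | pre b p _ => simp [succs, Trans]
  | plus p q ihp ihq => simp [succs, Trans, ihp, ihq]

/-- The process `p` cut off after `i` steps. -/
def trunc : ℕ → Proc Act → Proc Act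
  | 0, _ => nil
  | _ + 1, nil => nil
  | i + 1, pre a p => pre a (trunc i p)
  | i + 1, plus p q => plus (trunc (i + 1) p) (trunc (i + 1) q)

theorem trans_trunc {i : ℕ} {p : Proc Act} {a : Act} {r : Proc Act} :
    Trans (trunc (i + 1) p) a r ↔ ∃ p', Trans p a p' ∧ r = trunc i p' := by
  induction p with
  | nil => simp [trunc, Trans]
  | pre b p _ => simp [trunc, Trans]
  | plus p q ihp ihq =>
    simp only [trunc, Trans, ihp, ihq]
    constructor
    · rintro (⟨p', h, e⟩ | ⟨p', h, e⟩)
      exacts [⟨p', .inl h, e⟩, ⟨p', .inr h, e⟩]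
    · rintro ⟨p', h | h, e⟩
      exacts [.inl ⟨p', h, e⟩, .inr ⟨p', h, e⟩]

theorem depth_trunc_le (i : ℕ) (p : Proc Act) : depth (trunc i p) ≤ i := by
  induction i generalizing p with
  | zero => simp [trunc, depth]
  | succ i ih =>
    refine depth_le_of_forall fun a r h => ?_
    obtain ⟨p', _, rfl⟩ := trans_trunc.1 h
    exact Nat.succ_le_succ (ih p')

theorem mem_traces_trunc {i : ℕ} {p : Proc Act} {t : List Act} :
    t ∈ traces (trunc i p) ↔ t ∈ traces p ∧ t.length ≤ i := by
  induction t generalizing i p with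
  | nil => simp [nil_mem_traces]
  | cons a t ih =>
    cases i with
    | zero => simp [trunc, cons_mem_traces, Trans]
    | succ i =>
      simp only [cons_mem_traces, trans_trunc, List.length_cons, Nat.succ_le_succ_iff]
      constructor
      · rintro ⟨_, ⟨p', hp, rfl⟩, ht⟩
        exact ⟨⟨p', hp, (ih.1 ht).1⟩, (ih.1 ht).2⟩
      · rintro ⟨⟨p', hp, ht⟩, hl⟩
        exact ⟨_, ⟨p', hp, rfl⟩, ih.2 ⟨ht, hl⟩⟩

/-- The process `p` with an `a`-transition as its only continuation after `i` steps. -/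
def ext (a : Act) : ℕ → Proc Act → Proc Act
  | 0, _ => pre a nil
  | _ + 1, nil => nil
  | i + 1, pre b p => pre b (ext a i p)
  | i + 1, plus p q => plus (ext a (i + 1) p) (ext a (i + 1) q)

theorem trans_ext {a : Act} {i : ℕ} {p : Proc Act} {b : Act} {r : Proc Act} :
    Trans (ext a (i + 1) p) b r ↔ ∃ p', Trans p b p' ∧ r = ext a i p' := by
  induction p with
  | nil => simp [ext, Trans]
  | pre b p _ => simp [ext, Trans]
  | plus p q ihp ihq =>
    simp only [ext, Trans, ihp, ihq]
    constructor
    · rintro (⟨p', h, e⟩ | ⟨p', h, e⟩)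
      exacts [⟨p', .inl h, e⟩, ⟨p', .inr h, e⟩]
    · rintro ⟨p', h | h, e⟩
      exacts [.inl ⟨p', h, e⟩, .inr ⟨p', h, e⟩]

/-- The extension acts only after `i` steps. With `sat_trunc`, a formula of modal depth at most `i`
cannot distinguish a process from its extension. -/
theorem trunc_ext (a : Act) (i : ℕ) (p : Proc Act) : trunc i (ext a i p) = trunc i p := by
  induction p generalizing i with
  | nil => cases i <;> rfl
  | pre b p ih => cases i <;> simp [trunc, ext, ih]
  | plus p q ihp ihq => cases i <;> simp [trunc, ext, ihp, ihq]

theorem append_mem_traces_ext {a : Act} {t : List Act} {p : Proc Act} (h : t ∈ traces p) :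
    t ++ [a] ∈ traces (ext a t.length p) := by
  induction t generalizing p with
  | nil => exact cons_mem_traces.2 ⟨nil, by simp [ext, Trans], nil_mem_traces _⟩
  | cons b t ih =>
    obtain ⟨r, hr, ht⟩ := cons_mem_traces.1 h
    exact cons_mem_traces.2 ⟨_, trans_ext.2 ⟨r, hr, rfl⟩, ih ht⟩

/-- Finitely many representatives of the processes of depth at most `i`. -/
def reps (Act : Type) : ℕ → Set (Proc Act)
  | 0 => {nil}
  | i + 1 => sumSet '' {s | s ⊆ Set.univ ×ˢ reps Act i}

theorem reps_finite [Finite Act] (i : ℕ) : (reps Act i).Finite := by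
  induction i with
  | zero => exact Set.finite_singleton _
  | succ i ih => exact ((Set.finite_univ.prod ih).finite_subsets).image _

/-- Each successor is replaced by a representative of lower depth; the set of pairs obtained in this
way determines the representative of `p`. -/
theorem exists_rep [Finite Act] {i : ℕ} {p : Proc Act} (h : depth p ≤ i) :
    ∃ q ∈ reps Act i, Eqv p q := by
  induction i generalizing p with
  | zero =>
    refine ⟨nil, rfl, eqv_of_forall (fun a p' hp => ?_) (fun a q' hq => hq.elim)⟩
    have := depth_trans hp
    omega
  | succ i ih =>
    have hs : {q : Act × Proc Act | q.2 ∈ reps Act i ∧ ∃ p', Trans p q.1 p' ∧ Eqv p' q.2} ⊆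
        Set.univ ×ˢ reps Act i := fun q hq => ⟨trivial, hq.1⟩
    have hf := (Set.finite_univ.prod (reps_finite (Act := Act) i)).subset hs
    refine ⟨_, ⟨_, hs, rfl⟩, eqv_of_forall (fun a p' hp => ?_) (fun a q' hq => ?_)⟩
    · obtain ⟨q, hq, he⟩ := ih (Nat.le_of_succ_le_succ ((depth_trans hp).trans h))
      exact ⟨q, (trans_sumSet hf).2 ⟨hq, p', hp, he⟩, he⟩
    · exact ((trans_sumSet hf).1 hq).2

end Proc

namespace Formula

open Proc

variable {Act : Type}

/-! ### Formulae and the preorder -/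

theorem sat_trunc {φ : Formula Act} {i : ℕ} (h : md φ ≤ i) (p : Proc Act) :
    Sat (trunc i p) φ ↔ Sat p φ := by
  induction φ generalizing i p with
  | tt => rfl
  | ff => rfl
  | and φ ψ ihφ ihψ =>
    simp only [md, max_le_iff] at h
    simp [Sat, ihφ h.1, ihψ h.2]
  | or φ ψ ihφ ihψ =>
    simp only [md, max_le_iff] at h
    simp [Sat, ihφ h.1, ihψ h.2]
  | dia a φ ih =>
    obtain ⟨i, rfl⟩ := Nat.exists_eq_succ_of_ne_zero (Nat.pos_iff_ne_zero.1 (Nat.lt_of_lt_of_le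
      (Nat.succ_pos _) h))
    have h := Nat.le_of_succ_le_succ h
    constructor
    · rintro ⟨q, hq, hs⟩
      obtain ⟨p', hp, rfl⟩ := trans_trunc.1 hq
      exact ⟨p', hp, (ih h p').1 hs⟩
    · rintro ⟨p', hp, hs⟩
      exact ⟨_, trans_trunc.2 ⟨p', hp, rfl⟩, (ih h p').2 hs⟩
  | box a φ ih =>
    obtain ⟨i, rfl⟩ := Nat.exists_eq_succ_of_ne_zero (Nat.pos_iff_ne_zero.1 (Nat.lt_of_lt_of_le
      (Nat.succ_pos _) h))
    have h := Nat.le_of_succ_le_succ h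
    constructor
    · intro hs p' hp
      exact (ih h p').1 (hs _ (trans_trunc.2 ⟨p', hp, rfl⟩))
    · intro hs q hq
      obtain ⟨p', hp, rfl⟩ := trans_trunc.1 hq
      exact (ih h p').2 (hs p' hp)
  | neg φ ih => simp [Sat, ih (i := i) h]

theorem IsBoxFF.exists_trace {ψ : Formula Act} (h : IsBoxFF ψ) :
    ∃ t : List Act, ∀ p, Sat p ψ ↔ t ∉ traces p := by
  induction h with
  | ff => exact ⟨[], fun p => by simp [Sat, nil_mem_traces]⟩
  | box a _ ih =>
    obtain ⟨t, ht⟩ := ih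
    exact ⟨a :: t, fun p => by simp [Sat, cons_mem_traces, ht]⟩

/-- Diamonds are preserved by simulation. Boxes occur only in the form `[a₁]⋯[aₙ]ff`, which excludes
a single trace, and trace sets are equal along the preorder. -/
theorem IsTS.sat_mono {φ : Formula Act} (h : IsTS φ) {p q : Proc Act} (hpq : TSLe p q)
    (hp : Sat p φ) : Sat q φ := by
  induction h generalizing p q with
  | tt => trivial
  | ff => exact hp
  | and _ _ ihφ ihψ => exact ⟨ihφ hpq hp.1, ihψ hpq hp.2⟩
  | or _ _ ihφ ihψ => exact hp.imp (ihφ hpq) (ihψ hpq)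
  | dia a _ ih =>
    obtain ⟨p', hp, hs⟩ := hp
    obtain ⟨q', hq, h⟩ := hpq.sim hp
    exact ⟨q', hq, ih h hs⟩
  | boxFF h =>
    obtain ⟨t, ht⟩ := h.exists_trace
    rw [ht] at hp ⊢
    rwa [← hpq.traces_eq]

/-- The conjunction of a list of formulae. -/
def bigAnd : List (Formula Act) → Formula Act
  | [] => tt
  | φ :: l => and φ (bigAnd l)

/-- The disjunction of a list of formulae. -/
def bigOr : List (Formula Act) → Formula Act
  | [] => ff
  | φ :: l => or φ (bigOr l)

theorem sat_bigAnd {l : List (Formula Act)} {p : Proc Act} :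
    Sat p (bigAnd l) ↔ ∀ φ ∈ l, Sat p φ := by
  induction l <;> simp_all [bigAnd, Sat]

theorem sat_bigOr {l : List (Formula Act)} {p : Proc Act} :
    Sat p (bigOr l) ↔ ∃ φ ∈ l, Sat p φ := by
  induction l <;> simp_all [bigOr, Sat]

theorem isTS_bigAnd {l : List (Formula Act)} (h : ∀ φ ∈ l, IsTS φ) : IsTS (bigAnd l) := by
  induction l with
  | nil => exact .tt
  | cons φ l ih => exact .and (h _ (by simp)) (ih fun ψ hψ => h ψ (by simp [hψ]))

theorem isTS_bigOr {l : List (Formula Act)} (h : ∀ φ ∈ l, IsTS φ) : IsTS (bigOr l) := by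
  induction l with
  | nil => exact .ff
  | cons φ l ih => exact .or (h _ (by simp)) (ih fun ψ hψ => h ψ (by simp [hψ]))

theorem md_bigAnd {l : List (Formula Act)} {i : ℕ} (h : ∀ φ ∈ l, md φ ≤ i) :
    md (bigAnd l) ≤ i := by
  induction l with
  | nil => exact Nat.zero_le _
  | cons φ l ih => exact max_le (h _ (by simp)) (ih fun ψ hψ => h ψ (by simp [hψ]))

/-- The formula `[a₁]⋯[aₙ]ff`. -/
def boxes : List Act → Formula Act
  | [] => ff
  | a :: t => box a (boxes t)

theorem isBoxFF_boxes (t : List Act) : IsBoxFF (boxes t) := by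
  induction t with
  | nil => exact .ff
  | cons a t ih => exact .box a ih

theorem md_boxes (t : List Act) : md (boxes t) = t.length := by
  induction t <;> simp_all [boxes, md]

theorem sat_boxes {t : List Act} {p : Proc Act} : Sat p (boxes t) ↔ t ∉ traces p := by
  induction t generalizing p with
  | nil => simp [boxes, Sat, nil_mem_traces]
  | cons a t ih => simp [boxes, Sat, cons_mem_traces, ih]

/-- The words of length at most `i` that are not traces of `p`. -/
noncomputable def nonTraces [Finite Act] (i : ℕ) (p : Proc Act) : List (List Act) :=
  (((List.finite_length_le Act i).subset
    (Set.sep_subset _ (fun t => t ∉ traces p))).toFinset).toList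

theorem mem_nonTraces [Finite Act] {i : ℕ} {p : Proc Act} {t : List Act} :
    t ∈ nonTraces i p ↔ t.length ≤ i ∧ t ∉ traces p := by
  simp [nonTraces]

/-- The characteristic formula of `p` up to `i` steps. -/
noncomputable def char [Finite Act] : ℕ → Proc Act → Formula Act
  | 0, _ => tt
  | i + 1, p => and (bigAnd ((succs p).map fun q => dia q.1 (char i q.2)))
      (bigAnd ((nonTraces (i + 1) p).map boxes))

theorem isTS_char [Finite Act] (i : ℕ) (p : Proc Act) : IsTS (char i p) := by
  induction i generalizing p with
  | zero => exact .tt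
  | succ i ih =>
    refine .and (isTS_bigAnd ?_) (isTS_bigAnd ?_) <;> simp only [List.mem_map]
    · rintro _ ⟨q, _, rfl⟩
      exact .dia _ (ih _)
    · rintro _ ⟨t, _, rfl⟩
      exact .boxFF (isBoxFF_boxes t)

theorem md_char [Finite Act] (i : ℕ) (p : Proc Act) : md (char i p) ≤ i := by
  induction i generalizing p with
  | zero => exact le_rfl
  | succ i ih =>
    refine max_le (md_bigAnd ?_) (md_bigAnd ?_) <;> simp only [List.mem_map]
    · rintro _ ⟨q, _, rfl⟩
      exact Nat.succ_le_succ (ih _)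
    · rintro _ ⟨t, ht, rfl⟩
      rw [md_boxes]
      exact (mem_nonTraces.1 ht).1

theorem sat_char_succ [Finite Act] {i : ℕ} {p q : Proc Act} : Sat q (char (i + 1) p) ↔
    (∀ a p', Trans p a p' → ∃ q', Trans q a q' ∧ Sat q' (char i p')) ∧
      ∀ t ∈ traces q, t.length ≤ i + 1 → t ∈ traces p := by
  simp only [char, Sat, sat_bigAnd, List.forall_mem_map, mem_nonTraces, sat_boxes, Prod.forall,
    mem_succs]
  exact and_congr Iff.rfl ⟨fun h t ht hl => by_contra fun hn => h t ⟨hl, hn⟩ ht,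
    fun h t hl ht => hl.2 (h t ht hl.1)⟩

theorem sat_char_self [Finite Act] (i : ℕ) (p : Proc Act) : Sat p (char i p) := by
  induction i generalizing p with
  | zero => trivial
  | succ i ih => exact sat_char_succ.2 ⟨fun a p' h => ⟨p', h, ih p'⟩, fun t h _ => h⟩

/-- The formula controls traces only up to length `i`. A longer trace of `q` would have a prefix of
length `i`, which would be a trace of `p`, against `depth p < i`. The strict inequality is needed
for this. -/
theorem tsLe_of_sat_char [Finite Act] {i : ℕ} {p q : Proc Act} (hd : depth p < i) (h : Sat q (char i p)) :
    TSLe p q := by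
  induction i generalizing p q with
  | zero => omega
  | succ i ih =>
    rw [sat_char_succ] at h
    refine tsLe_of_forall (fun a p' hp => ?_) fun t ht => ?_
    · obtain ⟨q', hq, hs⟩ := h.1 a p' hp
      exact ⟨q', hq, ih (by have := depth_trans hp; omega) hs⟩
    · rcases le_or_gt t.length (i + 1) with hl | hl
      · exact h.2 t ht hl
      · have := length_le_depth (h.2 _ (take_mem_traces ht (i + 1)) (by simp))
        simp at this
        omega

/-- Primality is iterated along the disjunction; satisfiability excludes the empty one. -/
theorem exists_of_entails_bigOr {φ : Formula Act} (hs : Satisfiable φ)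
    (hp : PrimeIn (LTS Act) φ) {l : List (Formula Act)} (hl : ∀ ψ ∈ l, IsTS ψ)
    (h : Entails φ (bigOr l)) : ∃ ψ ∈ l, Entails φ ψ := by
  induction l with
  | nil =>
    obtain ⟨p, hp⟩ := hs
    exact (h p hp).elim
  | cons ψ l ih =>
    have hl' : ∀ χ ∈ l, IsTS χ := fun χ hχ => hl χ (by simp [hχ])
    rcases hp ψ (hl ψ (by simp)) _ (isTS_bigOr hl') h with h | h
    · exact ⟨ψ, by simp, h⟩
    · obtain ⟨χ, hχ, h⟩ := ih hl' h
      exact ⟨χ, by simp [hχ], h⟩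

/-- A satisfiable prime formula has a least model, of depth less than any bound `D ≥ md φ`. -/
theorem exists_least_of_prime [Finite Act] [Nonempty Act] {φ : Formula Act} (hφ : IsTS φ) {D : ℕ}
    (hD : md φ ≤ D) (hs : Satisfiable φ) (hp : PrimeIn (LTS Act) φ) :
    ∃ p : Proc Act, depth p < D ∧ Sat p φ ∧ ∀ q, Sat q φ → TSLe p q := by
  -- Level `D + 1` is one more than the formula can see, so that the characteristic formulae also
  -- control the traces of length `D + 1`.
  have hf := (reps_finite (Act := Act) (D + 1)).subset (Set.sep_subset _ (fun p => Sat p φ))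
  obtain ⟨ψ, hψ, he⟩ := exists_of_entails_bigOr hs hp
    (l := hf.toFinset.toList.map (char (D + 1)))
    (by simp only [List.mem_map]; rintro _ ⟨p, _, rfl⟩; exact isTS_char _ _) (by
      intro q hq
      obtain ⟨p, hp, hpq⟩ := exists_rep (depth_trunc_le (D + 1) q)
      refine sat_bigOr.2 ⟨char (D + 1) p, ?_, ?_⟩
      · simp only [List.mem_map, Finset.mem_toList, Set.Finite.mem_toFinset]
        exact ⟨p, ⟨hp, hφ.sat_mono hpq.1 ((sat_trunc (by omega) q).2 hq)⟩, rfl⟩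
      · exact (sat_trunc (md_char _ _) q).1
          ((isTS_char _ _).sat_mono hpq.2 (sat_char_self _ _)))
  simp only [List.mem_map, Finset.mem_toList, Set.Finite.mem_toFinset] at hψ
  obtain ⟨p, ⟨-, hpφ⟩, rfl⟩ := hψ
  -- The truncation of `p` after `D` steps is still a model, so it satisfies the characteristic
  -- formula of `p`. If `p` had a trace of length `D + 1`, the diamonds would force it on the
  -- truncation.
  have h₁ : depth p ≤ D := by
    by_contra h
    obtain ⟨t, ht, hl⟩ := exists_trace_of_le_depth (not_le.1 h)
    have hT := he _ ((sat_trunc hD p).2 hpφ)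
    have ha : Sat (trunc (D + 1) p) (char (D + 1) p) :=
      (sat_trunc (md_char _ _) p).2 (sat_char_self _ _)
    have key : ∀ (i : ℕ) (r q : Proc Act), Sat q (char i r) → ∀ t ∈ traces r, t.length ≤ i →
        t ∈ traces q := by
      intro i
      induction i with
      | zero =>
        intro r q _ t _ hl
        rw [List.length_eq_zero_iff.1 (Nat.le_zero.1 hl)]
        exact nil_mem_traces q
      | succ i ih =>
        rintro r q h (_ | ⟨a, t⟩) ht hl
        · exact nil_mem_traces q
        · obtain ⟨r', hr, ht⟩ := cons_mem_traces.1 ht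
          obtain ⟨q', hq, hs⟩ := (sat_char_succ.1 h).1 a r' hr
          exact cons_mem_traces.2 ⟨q', hq, ih _ _ hs t ht (Nat.le_of_succ_le_succ hl)⟩
    have := (mem_traces_trunc.1 (key _ _ _ hT t ht hl.le)).2
    omega
  -- If `p` had a trace of length `D`, the extension behind step `D` would be a model with a trace
  -- of length `D + 1`, which the characteristic formula forbids.
  have h₂ : depth p < D := by
    by_contra h
    obtain ⟨t, ht, hl⟩ := exists_trace_of_le_depth (not_lt.1 h)
    let a := Classical.arbitrary Act
    have hs : Sat (ext a D p) φ := by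
      rw [← sat_trunc hD, trunc_ext, sat_trunc hD]
      exact hpφ
    have hm := append_mem_traces_ext (a := a) ht
    rw [hl] at hm
    have := length_le_depth ((sat_char_succ.1 (he _ hs)).2 _ hm (by simp [hl]))
    simp at this
    omega
  exact ⟨p, h₂, hpφ, fun q hq => tsLe_of_sat_char (by omega) (he q hq)⟩

/-- The least model decides which disjunct is entailed, and monotonicity carries it to all models.
-/
theorem prime_of_least {φ : Formula Act} {p : Proc Act} (hp : Sat p φ)
    (h : ∀ q, Sat q φ → TSLe p q) : PrimeIn (LTS Act) φ := by
  intro φ₁ h₁ φ₂ h₂ he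
  rcases he p hp with hs | hs
  · exact .inl fun q hq => IsTS.sat_mono h₁ (h q hq) hs
  · exact .inr fun q hq => IsTS.sat_mono h₂ (h q hq) hs

theorem prime_of_forall_not_sat {φ : Formula Act} (h : ∀ q, ¬ Sat q φ) :
    PrimeIn (LTS Act) φ :=
  fun _ _ _ _ _ => .inl fun q hq => (h q hq).elim

/-- Satisfiable prime formulae are those with a least model among the processes of bounded
depth. -/
theorem satisfiable_and_prime_iff [Finite Act] [Nonempty Act] {φ : Formula Act} (hφ : IsTS φ) :
    (Satisfiable φ ∧ PrimeIn (LTS Act) φ) ↔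
      ∃ p : Proc Act, depth p ≤ md φ ∧ Sat p φ ∧
        ∀ q : Proc Act, depth q ≤ md φ + 1 → Sat q φ → TSLe p q := by
  constructor
  · rintro ⟨hs, hp⟩
    obtain ⟨p, hd, hp, hl⟩ := exists_least_of_prime hφ le_rfl hs hp
    exact ⟨p, hd.le, hp, fun q _ hq => hl q hq⟩
  · rintro ⟨p, hd, hp, hl⟩
    refine ⟨⟨p, hp⟩, prime_of_least hp fun q hq => hl q ?_ hq⟩
    -- A model deeper than `md φ + 1` remains a model when it is cut off there, and it then has a
    -- trace of length `md φ + 1`. By leastness this would be a trace of `p`, whose depth is at most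
    -- `md φ`.
    by_contra hn
    obtain ⟨t, ht, hlen⟩ := exists_trace_of_le_depth (p := q) (i := md φ + 1) (by omega)
    have h := hl _ (depth_trunc_le (md φ + 1) q) ((sat_trunc (by omega) q).2 hq)
    have := length_le_depth (h.traces_eq ▸ mem_traces_trunc.2 ⟨ht, hlen.le⟩ : t ∈ traces p)
    omega

end Formula

end HM

/-! ### Largest processes with given traces, and the base family -/

namespace HM

namespace Proc

variable {Act : Type}

/-! ### Processes with a given set of traces -/

/-- The trace sets of the processes of depth at most `i`. -/
def traceSets (Act : Type) (i : ℕ) : Set (Set (List Act)) := traces '' {p | depth p ≤ i}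

theorem traceSets_subset (i : ℕ) :
    traceSets Act i ⊆ 𝒫 {t : List Act | t.length ≤ i} := by
  rintro _ ⟨p, hp, rfl⟩ t ht
  exact (length_le_depth ht).trans hp

theorem traceSets_finite [Finite Act] (i : ℕ) : (traceSets Act i).Finite :=
  (List.finite_length_le Act i).finite_subsets.subset (traceSets_subset i)

/-- The largest process with a given set of traces of length at most `i`. -/
noncomputable def maxProc : ℕ → Set (List Act) → Proc Act
  | 0, _ => nil
  | i + 1, T => sumSet ((fun q : Act × Set (List Act) => (q.1, maxProc i q.2)) ''
      {q | q.2 ∈ traceSets Act i ∧ q.2 ⊆ {t | q.1 :: t ∈ T}})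

theorem trans_maxProc [Finite Act] {i : ℕ} {T : Set (List Act)} {a : Act} {r : Proc Act} :
    Trans (maxProc (i + 1) T) a r ↔
      ∃ T' ∈ traceSets Act i, T' ⊆ {t | a :: t ∈ T} ∧ maxProc i T' = r := by
  rw [maxProc, trans_sumSet]
  · simp only [Set.mem_image, Set.mem_ofPred_eq, Prod.mk.injEq, Prod.exists]
    constructor
    · rintro ⟨_, T', ⟨h₁, h₂⟩, rfl, h₃⟩
      exact ⟨T', h₁, h₂, h₃⟩
    · rintro ⟨T', h₁, h₂, h₃⟩
      exact ⟨a, T', ⟨h₁, h₂⟩, rfl, h₃⟩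
  · exact ((Set.finite_univ.prod (traceSets_finite (Act := Act) i)).subset
      fun q hq => ⟨trivial, hq.1⟩).image _

theorem depth_maxProc_le [Finite Act] (i : ℕ) (T : Set (List Act)) : depth (maxProc i T) ≤ i := by
  induction i generalizing T with
  | zero => exact le_rfl
  | succ i ih =>
    refine depth_le_of_forall fun a r h => ?_
    obtain ⟨T', _, _, rfl⟩ := trans_maxProc.1 h
    exact Nat.succ_le_succ (ih T')

/-- The successors of `maxProc` never leave `T`. They exhaust it because `T` comes from a process,
each of whose successors contributes its own trace set as an admissible `T'`. -/
theorem traces_maxProc [Finite Act] {i : ℕ} {T : Set (List Act)} (h : T ∈ traceSets Act i) :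
    traces (maxProc i T) = T := by
  induction i generalizing T with
  | zero =>
    obtain ⟨p, hp, rfl⟩ := h
    ext t
    cases t with
    | nil => simp [nil_mem_traces]
    | cons a t =>
      refine iff_of_false (fun ht => ?_) fun ht => ?_
      · obtain ⟨r, hr, _⟩ := cons_mem_traces.1 ht
        exact hr
      · have := (length_le_depth ht).trans hp
        simp at this
  | succ i ih =>
    obtain ⟨p, hp, rfl⟩ := h
    ext t
    cases t with
    | nil => simp [nil_mem_traces]
    | cons a t =>
      simp only [cons_mem_traces, trans_maxProc]
      constructor
      · rintro ⟨_, ⟨T', hT, hs, rfl⟩, ht⟩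
        rw [ih hT] at ht
        exact hs ht
      · rintro ⟨r, hr, ht⟩
        have hm : traces r ∈ traceSets Act i :=
          ⟨r, Nat.le_of_succ_le_succ ((depth_trans hr).trans hp), rfl⟩
        exact ⟨_, ⟨traces r, hm, fun t ht => ⟨r, hr, ht⟩, rfl⟩, by rwa [ih hm]⟩

/-- A successor `p'` is simulated by the largest process with the traces of `p'`. Thus, for
questions about the traces of models, one process per trace set represents all. -/
theorem tsLe_maxProc [Finite Act] {i : ℕ} {p : Proc Act} (h : depth p ≤ i) :
    TSLe p (maxProc i (traces p)) := by
  induction i generalizing p with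
  | zero =>
    refine tsLe_of_forall (fun a p' hp => ?_) (traces_maxProc ⟨p, h, rfl⟩).subset
    have := depth_trans hp
    omega
  | succ i ih =>
    refine tsLe_of_forall (fun a p' hp => ?_) (traces_maxProc ⟨p, h, rfl⟩).subset
    have hd := Nat.le_of_succ_le_succ ((depth_trans hp).trans h)
    exact ⟨_, trans_maxProc.2 ⟨traces p', ⟨p', hd, rfl⟩,
      fun t ht => cons_mem_traces.2 ⟨p', hp, ht⟩, rfl⟩, ih hd⟩

/-- `p` has exactly one maximal path up to repetitions, and this is labelled with `t`. -/
def IsLine : Proc Act → List Act → Prop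
  | p, [] => ∀ a q, ¬ Trans p a q
  | p, a :: t => (∃ q, Trans p a q) ∧ ∀ b q, Trans p b q → b = a ∧ IsLine q t

/-- The process `a₁.⋯.aₙ.0`. -/
def line : List Act → Proc Act
  | [] => nil
  | a :: t => pre a (line t)

theorem isLine_line (t : List Act) : IsLine (line t) t := by
  induction t with
  | nil => exact fun _ _ h => h
  | cons a t ih => exact ⟨⟨_, rfl, rfl⟩, by rintro b q ⟨rfl, rfl⟩; exact ⟨rfl, ih⟩⟩

theorem depth_line (t : List Act) : depth (line t) = t.length := by
  induction t <;> simp_all [line, depth]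

/-! ### Cardinalities -/

theorem ncard_length_le [Fintype Act] (i : ℕ) :
    {t : List Act | t.length ≤ i}.ncard ≤ (Fintype.card Act + 1) ^ i := by
  induction i with
  | zero =>
    simp
  | succ i ih =>
    have hs : {t : List Act | t.length ≤ i + 1} ⊆ {[]} ∪ (fun q : Act × List Act => q.1 :: q.2) ''
        (Set.univ ×ˢ {t | t.length ≤ i}) := by
      rintro (_ | ⟨a, t⟩) ht
      · exact .inl rfl
      · exact .inr ⟨(a, t), ⟨trivial, Nat.le_of_succ_le_succ ht⟩, rfl⟩
    have hf : (Set.univ ×ˢ {t : List Act | t.length ≤ i} : Set (Act × List Act)).Finite :=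
      Set.finite_univ.prod (List.finite_length_le Act i)
    calc _ ≤ _ := Set.ncard_le_ncard hs ((Set.finite_singleton _).union (hf.image _))
      _ ≤ _ := Set.ncard_union_le _ _
      _ ≤ 1 + (Set.univ ×ˢ {t : List Act | t.length ≤ i} : Set (Act × List Act)).ncard :=
        Nat.add_le_add (Set.ncard_singleton _).le (Set.ncard_image_le hf)
      _ ≤ 1 + Fintype.card Act * (Fintype.card Act + 1) ^ i := by
        rw [Set.ncard_prod, Set.ncard_univ, Nat.card_eq_fintype_card]
        gcongr
      _ ≤ _ := by
        rw [pow_succ, mul_add, mul_one, mul_comm, add_comm]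
        gcongr
        exact Nat.one_le_pow _ _ (Nat.succ_pos _)

theorem ncard_traceSets_le [Fintype Act] (i : ℕ) :
    (traceSets Act i).ncard ≤ 2 ^ (Fintype.card Act + 1) ^ i := by
  calc _ ≤ _ := Set.ncard_le_ncard (traceSets_subset i)
        (List.finite_length_le Act i).finite_subsets
    _ = _ := Set.ncard_powerset _ (List.finite_length_le Act i)
    _ ≤ _ := Nat.pow_le_pow_right two_pos (ncard_length_le i)

/-- The number of processes of depth at most `i`, up to equivalence. -/
def numReps (k : ℕ) : ℕ → ℕ
  | 0 => 1
  | i + 1 => 2 ^ (k * numReps k i)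

theorem ncard_reps_le [Fintype Act] (i : ℕ) :
    (reps Act i).ncard ≤ numReps (Fintype.card Act) i := by
  induction i with
  | zero => simp [reps, numReps]
  | succ i ih =>
    have hf := (Set.finite_univ (α := Act)).prod (reps_finite (Act := Act) i)
    calc _ ≤ _ := Set.ncard_image_le hf.finite_subsets
      _ = _ := Set.ncard_powerset _ hf
      _ ≤ _ := by
        rw [Set.ncard_prod, Set.ncard_univ, Nat.card_eq_fintype_card]
        exact Nat.pow_le_pow_right two_pos (Nat.mul_le_mul_left _ ih)

/-! ### Base processes -/

theorem reps_subset_succ (i : ℕ) : reps Act i ⊆ reps Act (i + 1) := by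
  induction i with
  | zero =>
    rintro _ rfl
    exact ⟨∅, Set.empty_subset _, by simp [sumSet, sumList]⟩
  | succ i ih => exact Set.image_mono fun s hs => hs.trans (Set.prod_mono le_rfl ih)

theorem mem_reps_of_trans [Finite Act] {i : ℕ} {p : Proc Act} (h : p ∈ reps Act i) {a : Act}
    {q : Proc Act} (hq : Trans p a q) : q ∈ reps Act i := by
  cases i with
  | zero =>
    rw [Set.mem_singleton_iff.1 h] at hq
    exact hq.elim
  | succ i =>
    obtain ⟨s, hs, rfl⟩ := h
    rw [trans_sumSet ((Set.finite_univ.prod (reps_finite (Act := Act) i)).subset hs)] at hq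
    exact reps_subset_succ i (hs hq).2

theorem depth_le_of_mem_reps [Finite Act] {i : ℕ} {p : Proc Act} (h : p ∈ reps Act i) :
    depth p ≤ i := by
  induction i generalizing p with
  | zero =>
    rw [Set.mem_singleton_iff.1 h]
    exact le_rfl
  | succ i ih =>
    obtain ⟨s, hs, rfl⟩ := h
    refine depth_le_of_forall fun a r hr => ?_
    rw [trans_sumSet ((Set.finite_univ.prod (reps_finite (Act := Act) i)).subset hs)] at hr
    exact Nat.succ_le_succ (ih (hs hr).2)

end Proc

open Proc

/-- A finite family of `b` processes that is closed under transitions and contains all processes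
of depth less than `j`, the largest processes for all sets of traces of length at most `j + 1`, and
the lines of length at most `j + 1`. -/
structure Base (Act : Type) where
  b : ℕ
  j : ℕ
  proc : ℕ → Proc Act
  closed : ∀ x < b, ∀ a q, Trans (proc x) a q → ∃ y < b, proc y = q
  depth_le : ∀ x < b, depth (proc x) ≤ j + 1
  exists_eqv : ∀ p : Proc Act, depth p < j → ∃ x < b, Eqv p (proc x)
  exists_max : ∀ T ∈ traceSets Act (j + 1), ∃ x < b, proc x = maxProc (j + 1) T
  exists_line : ∀ t : List Act, t.length ≤ j + 1 → ∃ x < b, IsLine (proc x) t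
  lt_b : j + 1 < b

/-- The union of the representatives of depth at most `j`, the largest processes of all levels up to
`j + 2` and the lines of length up to `j + 2`, each closed under transitions. The last two families
contribute only the doubly exponential second term of the bound. -/
theorem Base.exists_of_le {Act : Type} [Fintype Act] [Nonempty Act] (j : ℕ) :
    ∃ B : Base Act, B.j = j + 1 ∧ B.b ≤ numReps (Fintype.card Act) j +
      (j + 4) * 2 ^ (Fintype.card Act + 1) ^ (j + 2) := by
  let M : Set (Proc Act) := ⋃ i ∈ Finset.range (j + 3), maxProc i '' traceSets Act i
  let L : Set (Proc Act) := line '' {t | t.length ≤ j + 2}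
  have hMf : M.Finite := Set.Finite.biUnion (Finset.finite_toSet _)
    fun i _ => (traceSets_finite i).image _
  have hLf : L.Finite := (List.finite_length_le Act _).image _
  let S : Set (Proc Act) := reps Act j ∪ (M ∪ L)
  have hS : S.Finite := (reps_finite j).union (hMf.union hLf)
  have hcl : ∀ p ∈ S, ∀ a q, Trans p a q → q ∈ S := by
    rintro p (hp | hp | hp) a q hq
    · exact .inl (mem_reps_of_trans hp hq)
    · refine .inr (.inl ?_)
      simp only [M, Set.mem_iUnion, Finset.mem_range] at hp ⊢
      obtain ⟨i, hi, T, hT, rfl⟩ := hp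
      cases i with
      | zero => exact hq.elim
      | succ i =>
        obtain ⟨T', hT', _, rfl⟩ := trans_maxProc.1 hq
        exact ⟨i, by omega, T', hT', rfl⟩
    · obtain ⟨_ | ⟨b, t⟩, ht, rfl⟩ := hp
      · exact hq.elim
      · obtain ⟨rfl, rfl⟩ := hq
        exact .inr (.inr ⟨t, (Nat.le_succ _).trans ht, rfl⟩)
  have hd : ∀ p ∈ S, depth p ≤ j + 2 := by
    rintro p (hp | hp | hp)
    · exact (depth_le_of_mem_reps hp).trans (by omega)
    · simp only [M, Set.mem_iUnion, Finset.mem_range] at hp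
      obtain ⟨i, hi, T, hT, rfl⟩ := hp
      exact (depth_maxProc_le i T).trans (by omega)
    · obtain ⟨t, ht, rfl⟩ := hp
      rw [depth_line]
      exact ht
  obtain ⟨e⟩ : Nonempty (Fin S.ncard ≃ S) := by
    have := hS.to_subtype
    exact ⟨(Finite.equivFinOfCardEq (by rw [Nat.card_coe_set_eq])).symm⟩
  let pr : ℕ → Proc Act := fun x => if h : x < S.ncard then e ⟨x, h⟩ else nil
  have hpr : ∀ x < S.ncard, pr x ∈ S := fun x hx => by simp [pr, hx]
  have hex : ∀ p ∈ S, ∃ x < S.ncard, pr x = p := fun p hp =>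
    ⟨e.symm ⟨p, hp⟩, (e.symm ⟨p, hp⟩).2, by simp [pr]⟩
  refine ⟨⟨S.ncard, j + 1, pr, ?_, ?_, ?_, ?_, ?_, ?_⟩, rfl, ?_⟩
  · exact fun x hx a q hq => hex q (hcl _ (hpr x hx) a q hq)
  · exact fun x hx => hd _ (hpr x hx)
  · intro p hp
    obtain ⟨q, hq, he⟩ := exists_rep (Nat.le_of_lt_succ hp)
    obtain ⟨x, hx, rfl⟩ := hex q (.inl hq)
    exact ⟨x, hx, he⟩
  · intro T hT
    refine hex _ (.inr (.inl ?_))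
    simp only [M, Set.mem_iUnion, Finset.mem_range]
    exact ⟨j + 2, by omega, T, hT, rfl⟩
  · intro t ht
    obtain ⟨x, hx, h⟩ := hex (line t) (.inr (.inr ⟨t, ht, rfl⟩))
    exact ⟨x, hx, h ▸ isLine_line t⟩
  -- Lines realize every depth from `0` to `j + 2`, so there are at least `j + 3` processes.
  · have hsub : (Finset.range (j + 3) : Set ℕ) ⊆ depth '' S := by
      intro i hi
      have hi : i < j + 3 := Finset.mem_range.1 hi
      refine ⟨line (List.replicate i (Classical.arbitrary Act)), .inr (.inr ⟨_, ?_, rfl⟩), ?_⟩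
      · simp only [Set.mem_ofPred_eq, List.length_replicate]
        omega
      · simp [depth_line]
    have h₁ := Set.ncard_le_ncard hsub (hS.image _)
    have h₂ := Set.ncard_image_le (f := depth) hS
    rw [Set.ncard_coe_finset, Finset.card_range] at h₁
    omega
  · have hM : M.ncard ≤ (j + 3) * 2 ^ (Fintype.card Act + 1) ^ (j + 2) := by
      calc _ ≤ _ := Finset.set_ncard_biUnion_le _ _
        _ ≤ ∑ i ∈ Finset.range (j + 3), 2 ^ (Fintype.card Act + 1) ^ (j + 2) := by
          refine Finset.sum_le_sum fun i hi => ?_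
          have hi : i < j + 3 := Finset.mem_range.1 hi
          refine (Set.ncard_image_le (traceSets_finite i)).trans
            ((ncard_traceSets_le i).trans ?_)
          gcongr
          · exact one_le_two
          · exact Nat.succ_pos _
          · omega
        _ = _ := by simp
    have hL : L.ncard ≤ 2 ^ (Fintype.card Act + 1) ^ (j + 2) :=
      (Set.ncard_image_le (List.finite_length_le Act _)).trans
        ((ncard_length_le _).trans Nat.lt_two_pow_self.le)
    have h := (Set.ncard_union_le (reps Act j) (M ∪ L)).trans
      (Nat.add_le_add (ncard_reps_le j) (Set.ncard_union_le M L))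
    calc S.ncard ≤ _ := h
      _ ≤ _ := by
        have : (j + 4) * 2 ^ (Fintype.card Act + 1) ^ (j + 2) =
          (j + 3) * 2 ^ (Fintype.card Act + 1) ^ (j + 2) + 2 ^ (Fintype.card Act + 1) ^ (j + 2) := by
          ring
        omega

end HM

/-! ### Binary coding of states, and primality on finitely many states -/

namespace HM

open Proc Formula

/-- The position of an action in a fixed enumeration of the actions. -/
noncomputable def actIdx {Act : Type} [Fintype Act] (a : Act) : ℕ := Fintype.equivFin Act a

theorem actIdx_lt {Act : Type} [Fintype Act] (a : Act) : actIdx a < Fintype.card Act :=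
  (Fintype.equivFin Act a).2

theorem actIdx_injective {Act : Type} [Fintype Act] {a b : Act} (h : actIdx a = actIdx b) :
    a = b :=
  (Fintype.equivFin Act).injective (Fin.ext h)

theorem mul_add_actIdx_inj {Act : Type} [Fintype Act] {x y : ℕ} {a b : Act} :
    Fintype.card Act * x + actIdx a = Fintype.card Act * y + actIdx b ↔ x = y ∧ a = b := by
  constructor
  · intro h
    have ha := actIdx_lt a
    have hb := actIdx_lt b
    have hd := congrArg (· / Fintype.card Act) h
    have hm := congrArg (· % Fintype.card Act) h
    simp only [Nat.mul_add_mod, Nat.mod_eq_of_lt ha, Nat.mod_eq_of_lt hb] at hm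
    simp only [Nat.mul_add_div (show 0 < Fintype.card Act by omega), Nat.div_eq_of_lt ha,
      Nat.div_eq_of_lt hb, add_zero] at hd
    exact ⟨hd, actIdx_injective hm⟩
  · rintro ⟨rfl, rfl⟩
    rfl

namespace Base

variable {Act : Type} [Fintype Act] (B : Base Act)

/-! ### A transition system on an initial segment of the natural numbers -/

/-- The transitions between states: those below `B.b` are the base processes, and the others are
subsets of `Act × ℕ`, coded in binary. -/
def Tr (x : ℕ) (a : Act) (y : ℕ) : Prop :=
  if x < B.b then y < B.b ∧ Trans (B.proc x) a (B.proc y)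
  else (x - B.b).testBit (Fintype.card Act * y + actIdx a) = true

/-- The position of a one in the binary expansion of a number is smaller than the number. This makes
the recursion of `st` terminate. -/
theorem lt_of_tr {x y : ℕ} {a : Act} (hx : B.b ≤ x) (h : B.Tr x a y) : y < x := by
  rw [Tr, if_neg (not_lt.2 hx)] at h
  have h₁ := Nat.ge_two_pow_of_testBit h
  have h₂ := (Fintype.card Act * y + actIdx a).lt_two_pow_self
  have h₃ : y ≤ Fintype.card Act * y :=
    Nat.le_mul_of_pos_left _ (Nat.zero_lt_of_lt (actIdx_lt a))
  omega

open Classical in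
/-- The process denoted by a state. -/
noncomputable def st (x : ℕ) : Proc Act :=
  if x < B.b then B.proc x else
    sumSet (Set.range fun q : {q : Act × Fin x // B.Tr x q.1 q.2} => (q.1.1, st q.1.2))
termination_by x

theorem trans_st {x : ℕ} {a : Act} {p : Proc Act} :
    Trans (B.st x) a p ↔ ∃ y, B.Tr x a y ∧ B.st y = p := by
  by_cases hx : x < B.b
  · rw [st, if_pos hx]
    constructor
    · intro h
      obtain ⟨y, hy, rfl⟩ := B.closed x hx a p h
      exact ⟨y, by simp [Tr, hx, hy, h], by rw [st, if_pos hy]⟩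
    · rintro ⟨y, hy, rfl⟩
      rw [Tr, if_pos hx] at hy
      rw [st, if_pos hy.1]
      exact hy.2
  · rw [st, if_neg hx, trans_sumSet (Set.finite_range _)]
    simp only [Set.mem_range, Prod.mk.injEq, Subtype.exists, Prod.exists]
    constructor
    · rintro ⟨_, y, h, rfl, rfl⟩
      exact ⟨y, h, rfl⟩
    · rintro ⟨y, h, rfl⟩
      exact ⟨a, ⟨y, B.lt_of_tr (not_lt.1 hx) h⟩, h, rfl, rfl⟩

/-- The number of states of rank at most `r`. -/
def s : ℕ → ℕ
  | 0 => B.b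
  | r + 1 => B.b + 2 ^ (Fintype.card Act * s r)

theorem s_lt_succ [Nonempty Act] (r : ℕ) : B.s r < B.s (r + 1) := by
  have h := (Fintype.card Act * B.s r).lt_two_pow_self
  have h' : B.s r ≤ Fintype.card Act * B.s r := Nat.le_mul_of_pos_left _ Fintype.card_pos
  rw [s]
  omega

theorem lt_s_of_tr [Nonempty Act] {r x y : ℕ} {a : Act} (hx : x < B.s r) (h : B.Tr x a y) :
    y < B.s r := by
  by_cases hb : B.b ≤ x
  · exact (B.lt_of_tr hb h).trans hx
  · rw [Tr, if_pos (not_le.1 hb)] at h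
    refine h.1.trans_le ?_
    cases r with
    | zero => exact le_rfl
    | succ r => exact Nat.le_add_right _ _

/-- A coded state of rank at most `r + 1` has fewer than `card Act * s r` bits, so all its targets
have rank at most `r`. -/
theorem lt_s_pred_of_tr [Nonempty Act] {r x y : ℕ} {a : Act} (hx : x < B.s (r + 1))
    (h : B.Tr x a y) : y < B.s r := by
  by_cases hb : x < B.b
  · rw [Tr, if_pos hb] at h
    refine h.1.trans_le ?_
    cases r with
    | zero => exact le_rfl
    | succ r => exact Nat.le_add_right _ _
  · rw [Tr, if_neg hb] at h
    by_contra hy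
    have h₁ := Nat.ge_two_pow_of_testBit h
    have h₂ : Fintype.card Act * B.s r ≤ Fintype.card Act * y + actIdx a :=
      (Nat.mul_le_mul_left _ (not_lt.1 hy)).trans (Nat.le_add_right _ _)
    have h₃ := Nat.pow_le_pow_right two_pos h₂
    rw [s] at hx
    omega

theorem depth_st_le [Nonempty Act] {r x : ℕ} (hx : x < B.s r) : depth (B.st x) ≤ B.j + 1 + r := by
  induction r generalizing x with
  | zero =>
    have hx : x < B.b := hx
    rw [st, if_pos hx]
    exact B.depth_le x hx
  | succ r ih =>
    refine depth_le_of_forall fun a p h => ?_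
    obtain ⟨y, hy, rfl⟩ := B.trans_st.1 h
    exact Nat.succ_le_succ (ih (B.lt_s_pred_of_tr hx hy))

theorem lt_s (r : ℕ) [Nonempty Act] : B.j + 1 + r < B.s r := by
  induction r with
  | zero => exact B.lt_b
  | succ r ih =>
    have := B.s_lt_succ r
    omega

/-- The number of states exceeds the depth of each of them, so loops of `s r` rounds suffice for all
inductions on depth and on the length of traces. -/
theorem depth_st_lt [Nonempty Act] {r x : ℕ} (hx : x < B.s r) : depth (B.st x) < B.s r :=
  (B.depth_st_le hx).trans_lt (B.lt_s r)

open Classical in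
-- Every set of labelled transitions to states of rank at most `r` is the set of ones of a bit
-- string of length `card Act * s r`.
theorem exists_state (r : ℕ) (Q : Act → ℕ → Prop) :
    ∃ x < B.s (r + 1), ∀ a y, B.Tr x a y ↔ y < B.s r ∧ Q a y := by
  let f : Fin (Fintype.card Act * B.s r) → Bool :=
    fun i => decide (∃ a y, (i : ℕ) = Fintype.card Act * y + actIdx a ∧ Q a y)
  refine ⟨B.b + Nat.ofBits f, ?_, fun a y => ?_⟩
  · rw [s]
    have := Nat.ofBits_lt_two_pow f
    omega
  · rw [Tr, if_neg (by omega), Nat.add_sub_cancel_left]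
    have hlt : Fintype.card Act * y + actIdx a < Fintype.card Act * B.s r ↔ y < B.s r := by
      have ha := actIdx_lt a
      constructor
      · intro h
        exact Nat.lt_of_mul_lt_mul_left (lt_of_le_of_lt (Nat.le_add_right _ _) h)
      · intro h
        calc _ < Fintype.card Act * y + Fintype.card Act := by omega
          _ = Fintype.card Act * (y + 1) := by ring
          _ ≤ _ := Nat.mul_le_mul_left _ h
    by_cases hy : y < B.s r
    · rw [Nat.testBit_ofBits_lt _ _ (hlt.2 hy)]
      simp only [f, decide_eq_true_eq, mul_add_actIdx_inj, hy, true_and]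
      constructor
      · rintro ⟨_, _, ⟨rfl, rfl⟩, h⟩
        exact h
      · exact fun h => ⟨a, y, ⟨rfl, rfl⟩, h⟩
    · rw [Nat.testBit_ofBits_ge _ _ (not_lt.1 fun h => hy (hlt.1 h))]
      simp [hy]

theorem exists_eqv_succ {r : ℕ} {p : Proc Act}
    (h : ∀ a q, Trans p a q → ∃ y < B.s r, Eqv q (B.st y)) :
    ∃ x < B.s (r + 1), Eqv p (B.st x) := by
  obtain ⟨x, hx, hT⟩ := B.exists_state r fun a y => ∃ q, Trans p a q ∧ Eqv q (B.st y)
  refine ⟨x, hx, eqv_of_forall (fun a q hq => ?_) fun a q hq => ?_⟩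
  · obtain ⟨y, hy, he⟩ := h a q hq
    exact ⟨_, B.trans_st.2 ⟨y, (hT a y).2 ⟨hy, q, hq, he⟩, rfl⟩, he⟩
  · obtain ⟨y, hy, rfl⟩ := B.trans_st.1 hq
    exact ((hT a y).1 hy).2

theorem st_of_lt {x : ℕ} (hx : x < B.b) : B.st x = B.proc x := by
  rw [st, if_pos hx]

theorem exists_st_eqv {r : ℕ} {p : Proc Act} (h : depth p < B.j + r) :
    ∃ x < B.s r, Eqv p (B.st x) := by
  induction r generalizing p with
  | zero =>
    obtain ⟨x, hx, he⟩ := B.exists_eqv p h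
    exact ⟨x, hx, by rwa [B.st_of_lt hx]⟩
  | succ r ih =>
    refine B.exists_eqv_succ fun a q hq => ih ?_
    have := depth_trans hq
    omega

/-- The successors of a largest process are largest processes one level below, so the base takes
care of the lowest level and each rank adds one more. -/
theorem exists_st_max {r : ℕ} {T : Set (List Act)} (h : T ∈ traceSets Act (B.j + 1 + r)) :
    ∃ x < B.s r, Eqv (maxProc (B.j + 1 + r) T) (B.st x) := by
  induction r generalizing T with
  | zero =>
    obtain ⟨x, hx, he⟩ := B.exists_max T h
    exact ⟨x, hx, by rw [B.st_of_lt hx, he]; exact .refl _⟩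
  | succ r ih =>
    refine B.exists_eqv_succ fun a q hq => ?_
    obtain ⟨T', hT', _, rfl⟩ := trans_maxProc.1 hq
    exact ih hT'

theorem exists_st_line {r : ℕ} {t : List Act} (h : t.length ≤ B.j + 1 + r) :
    ∃ x < B.s r, IsLine (B.st x) t := by
  induction r generalizing t with
  | zero =>
    obtain ⟨x, hx, he⟩ := B.exists_line t h
    exact ⟨x, hx, by rwa [B.st_of_lt hx]⟩
  | succ r ih =>
    cases t with
    | nil =>
      obtain ⟨x, hx, hT⟩ := B.exists_state r fun _ _ => False
      refine ⟨x, hx, fun a q hq => ?_⟩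
      obtain ⟨y, hy, rfl⟩ := B.trans_st.1 hq
      exact ((hT a y).1 hy).2
    | cons a t =>
      obtain ⟨z, hz, hl⟩ := ih (Nat.le_of_succ_le_succ h)
      obtain ⟨x, hx, hT⟩ := B.exists_state r fun b y => b = a ∧ y = z
      refine ⟨x, hx, ⟨_, B.trans_st.2 ⟨z, (hT a z).2 ⟨hz, rfl, rfl⟩, rfl⟩⟩, fun b q hq => ?_⟩
      obtain ⟨y, hy, rfl⟩ := B.trans_st.1 hq
      obtain ⟨_, rfl, rfl⟩ := (hT b y).1 hy
      exact ⟨rfl, hl⟩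

/-- Primality is a property of the set of states that satisfy the formula. -/
theorem prime_iff [Nonempty Act] {φ : Formula Act} (hφ : IsTS φ) {r : ℕ} (hd : md φ ≤ B.j + r) :
    PrimeIn (LTS Act) φ ↔ (∀ x < B.s r, ¬ Sat (B.st x) φ) ∨
      ∃ x < B.s r, Sat (B.st x) φ ∧
        ∀ y < B.s r, Sat (B.st y) φ → TSLe (B.st x) (B.st y) := by
  -- The state is that of the largest process with the traces of `q`: it lies above `q` and is
  -- therefore a model.
  have hmax : ∀ q : Proc Act, Sat q φ → depth q ≤ B.j + 1 + r →
      ∃ y < B.s r, Sat (B.st y) φ ∧ traces (B.st y) = traces q := by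
    intro q hq hdq
    obtain ⟨y, hy, he⟩ := B.exists_st_max (r := r) ⟨q, hdq, rfl⟩
    have hle := (tsLe_maxProc hdq).trans he.1
    exact ⟨y, hy, hφ.sat_mono hle hq, hle.traces_eq.symm⟩
  constructor
  · intro hp
    by_cases hs : ∃ x < B.s r, Sat (B.st x) φ
    · obtain ⟨z, -, hz⟩ := hs
      obtain ⟨p, hd, hpφ, hl⟩ := exists_least_of_prime hφ hd ⟨_, hz⟩ hp
      obtain ⟨x, hx, he⟩ := B.exists_st_eqv hd
      exact .inr ⟨x, hx, hφ.sat_mono he.1 hpφ, fun y _ hy => he.2.trans (hl _ hy)⟩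
    · push Not at hs
      exact .inl hs
  · rintro (h | ⟨x, hx, hxφ, hl⟩)
    · refine prime_of_forall_not_sat fun q hq => ?_
      obtain ⟨y, hy, hs, _⟩ := hmax _ ((sat_trunc hd q).2 hq)
        ((depth_trunc_le _ q).trans (by omega))
      exact h y hy hs
    -- A truncation of a model is a model and has the same traces as some state that is a model, so
    -- its traces are those of the least state `x`.
    · have htr : ∀ q : Proc Act, Sat q φ → ∀ i, md φ ≤ i → i ≤ B.j + 1 + r →
          traces (trunc i q) = traces (B.st x) := by
        intro q hq i hi hi'
        obtain ⟨y, hy, hs, ht⟩ := hmax _ ((sat_trunc hi q).2 hq)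
          ((depth_trunc_le _ q).trans hi')
        rw [← ht]
        exact (hl y hy hs).traces_eq.symm
      -- By truncation the traces have length at most `B.j + r`. A trace of exactly this length
      -- could be prolonged in an extension that is still a model, and `htr` at level `B.j + 1 + r`
      -- gives a contradiction. This is why the largest processes are present one level beyond `B.j
      -- + r`.
      have hlt : ∀ t ∈ traces (B.st x), t.length < B.j + r := by
        intro t ht
        rw [← htr _ hxφ (B.j + r) hd (by omega), mem_traces_trunc] at ht
        refine lt_of_le_of_ne ht.2 fun hlen => ?_
        let a := Classical.arbitrary Act
        have hs : Sat (ext a (B.j + r) (B.st x)) φ := by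
          rw [← sat_trunc hd, trunc_ext, sat_trunc hd]
          exact hxφ
        have hm := append_mem_traces_ext (a := a) ht.1
        rw [hlen] at hm
        have h₁ : t ++ [a] ∈ traces (trunc (B.j + 1 + r) (ext a (B.j + r) (B.st x))) :=
          mem_traces_trunc.2 ⟨hm, by simp only [List.length_append, List.length_singleton]; omega⟩
        rw [htr _ hs _ (by omega) le_rfl, ← htr _ hxφ (B.j + r) hd (by omega),
          mem_traces_trunc] at h₁
        have := h₁.2
        simp [hlen] at this
      refine prime_of_least hxφ fun q hq => ?_
      -- Every model is now so shallow that it is itself equivalent to a state, where leastness is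
      -- assumed.
      have hdq : depth q < B.j + r := by
        by_contra hn
        obtain ⟨t, ht, hlen⟩ := exists_trace_of_le_depth (not_lt.1 hn)
        have h₁ : t ∈ traces (trunc (B.j + r) q) := mem_traces_trunc.2 ⟨ht, hlen.le⟩
        rw [htr q hq _ hd (by omega)] at h₁
        have := hlt t h₁
        omega
      obtain ⟨y, hy, he⟩ := B.exists_st_eqv hdq
      exact (hl y hy (hφ.sat_mono he.1 hq)).trans he.2

end Base

end HM

/-! ### Comparison of the number of states with the tower function -/

namespace HM

open Proc

/-! ### The number of states in terms of the tower function -/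

theorem tow_pos {k : ℕ} (hk : 0 < k) (d : ℕ) : 0 < tow k d := by
  cases d with
  | zero => exact one_pos
  | succ d => exact Nat.mul_pos hk (Nat.two_pow_pos _)

theorem two_pow_tow_le {k : ℕ} (hk : 0 < k) (d : ℕ) : 2 ^ tow k d ≤ tow k (d + 1) :=
  Nat.le_mul_of_pos_left _ hk

theorem lt_numReps {k : ℕ} (hk : 0 < k) (i : ℕ) : i < numReps k i := by
  induction i with
  | zero => exact one_pos
  | succ i ih =>
    rw [numReps]
    have h := (k * numReps k i).lt_two_pow_self
    have h' : numReps k i ≤ k * numReps k i := Nat.le_mul_of_pos_left _ hk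
    omega

/-- The first inequality at `i` yields `k * numReps k (i + 1) ^ 2 ≤ tow k (i + 2)`. One of the two
factors `numReps` then absorbs the factor `2` or `i + 1`, so both inequalities continue together. -/
theorem mul_numReps_le_tow {k : ℕ} (hk : 0 < k) (i : ℕ) :
    2 * (k * numReps k i) ≤ tow k (i + 1) ∧ i * (k * numReps k i) ≤ tow k (i + 1) := by
  induction i with
  | zero => simp [numReps, tow, mul_comm]
  | succ i ih =>
    have h : k * (numReps k (i + 1) * numReps k (i + 1)) ≤ tow k (i + 1 + 1) := by
      rw [tow]
      refine Nat.mul_le_mul_left _ ?_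
      rw [numReps, ← pow_add, ← two_mul]
      exact Nat.pow_le_pow_right two_pos ih.1
    have hl := lt_numReps hk (i + 1)
    constructor
    · calc 2 * (k * numReps k (i + 1)) = k * (2 * numReps k (i + 1)) := by ring
        _ ≤ _ := Nat.mul_le_mul_left _ (Nat.mul_le_mul_right _ (by omega))
        _ ≤ _ := h
    · calc (i + 1) * (k * numReps k (i + 1)) = k * ((i + 1) * numReps k (i + 1)) := by ring
        _ ≤ _ := Nat.mul_le_mul_left _ (Nat.mul_le_mul_right _ hl.le)
        _ ≤ _ := h

theorem two_pow_two_pow_le_tow {k : ℕ} (hk : 0 < k) (i : ℕ) :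
    2 ^ 2 ^ (i + 1) ≤ tow k (i + 2) := by
  induction i with
  | zero =>
    have h₁ : 2 ≤ tow k 1 := by simp only [tow]; omega
    exact (Nat.pow_le_pow_right two_pos h₁).trans (two_pow_tow_le hk 1)
  | succ i ih =>
    refine (Nat.pow_le_pow_right two_pos ?_).trans (two_pow_tow_le hk (i + 2))
    refine le_trans ?_ ih
    exact Nat.pow_le_pow_right two_pos Nat.lt_two_pow_self

theorem mul_add_le_two_pow {m i : ℕ} (h : 2 * m + 8 ≤ i) : m * (i + 4) ≤ 2 ^ i := by
  induction i, h using Nat.le_induction with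
  | base =>
    have h₁ := m.lt_two_pow_self
    calc m * (2 * m + 8 + 4) ≤ 2 ^ m * (2 ^ m * 256) := Nat.mul_le_mul (by omega) (by omega)
      _ = _ := by ring
  | succ i hi ih =>
    have h₁ := i.lt_two_pow_self
    calc m * (i + 1 + 4) = m * (i + 4) + m := by ring
      _ ≤ 2 ^ i + 2 ^ i := by omega
      _ = _ := by ring

/-- A single exponential in `i` is beaten by `2 ^ 2 ^ (i + 1)` as soon as `m * (i + 5)` is below `2
^ (i + 1)`, which holds for `i ≥ 2 * m + 8`. -/
theorem pow_le_tow {k m i : ℕ} (hk : 0 < k) (hm : 0 < m) (h : 2 * m + 8 ≤ i) :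
    m ^ (i + 5) ≤ tow k (i + 2) := by
  refine le_trans ?_ (two_pow_two_pow_le_tow hk i)
  calc m ^ (i + 5) ≤ (2 ^ m) ^ (i + 5) := Nat.pow_le_pow_left m.lt_two_pow_self.le _
    _ = 2 ^ (m * (i + 5)) := (pow_mul _ _ _).symm
    _ ≤ _ := by
      refine Nat.pow_le_pow_right two_pos ?_
      have := mul_add_le_two_pow h
      rw [pow_succ]
      nlinarith

namespace Base

variable {Act : Type} [Fintype Act] [Nonempty Act]

/-- The start of the induction on the rank. The factor `2` is the slack that keeps the state count
below the tower at all later ranks. -/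
theorem exists_small : ∃ B : Base Act,
    2 * (Fintype.card Act * B.b) ≤ tow (Fintype.card Act) B.j := by
  set k := Fintype.card Act with hk
  have hk0 : 0 < k := Fintype.card_pos
  -- The least value to which `pow_le_tow` applies with `m = k + 1`. The base is built from level `i
  -- + 2`, so that `B.j = i + 3`; the two terms of its size, multiplied by `k`, are each at most a
  -- quarter of `tow k (i + 3)`.
  obtain ⟨i, hi⟩ : ∃ i, i = 2 * (k + 1) + 8 := ⟨_, rfl⟩
  obtain ⟨B, hj, hb⟩ := Base.exists_of_le (Act := Act) (i + 2)
  refine ⟨B, ?_⟩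
  rw [hj]
  have h₁ := (mul_numReps_le_tow hk0 (i + 2)).2
  have h₂ : 4 * (k * numReps k (i + 2)) ≤ tow k (i + 2 + 1) :=
    (Nat.mul_le_mul_right _ (by omega)).trans h₁
  have h₃ := pow_le_tow hk0 (Nat.succ_pos k) (i := i) (by omega)
  have h₄ : 4 * (i + 2 + 4) ≤ 2 ^ (k + 1) ^ (i + 2 + 2) := by
    have h₅ : 2 ^ (i + 4) ≤ (k + 1) ^ (i + 2 + 2) := Nat.pow_le_pow_left (by omega) _
    have h₆ := (2 ^ (i + 4)).lt_two_pow_self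
    have h₇ := Nat.pow_le_pow_right two_pos h₅
    have h₈ := i.lt_two_pow_self
    have h₉ : 2 ^ (i + 4) = 16 * 2 ^ i := by ring
    omega
  have h₅ : 4 * (k * ((i + 2 + 4) * 2 ^ (k + 1) ^ (i + 2 + 2))) ≤ tow k (i + 2 + 1) := by
    calc _ = k * (4 * (i + 2 + 4) * 2 ^ (k + 1) ^ (i + 2 + 2)) := by ring
      _ ≤ k * (2 ^ (k + 1) ^ (i + 2 + 2) * 2 ^ (k + 1) ^ (i + 2 + 2)) := by gcongr
      _ = k * 2 ^ (2 * (k + 1) ^ (i + 2 + 2)) := by rw [← pow_add, two_mul]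
      _ ≤ k * 2 ^ ((k + 1) ^ (i + 5)) := by
        gcongr
        · exact one_le_two
        · rw [show i + 5 = i + 2 + 2 + 1 by ring, pow_succ, mul_comm]
          exact Nat.mul_le_mul_left _ (by omega)
      _ ≤ _ := Nat.mul_le_mul_left _ (Nat.pow_le_pow_right two_pos h₃)
  have h₆ := Nat.mul_le_mul_left k hb
  rw [Nat.mul_add] at h₆
  rw [← hk] at h₆
  omega

variable (B : Base Act)

theorem two_le_s (r : ℕ) : 2 ≤ B.s r := by
  have := B.lt_s r
  have := B.lt_b
  cases r with
  | zero =>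
    rw [s]
    omega
  | succ r => omega

theorem b_le_s {Act : Type} [Fintype Act] (B : Base Act) (r : ℕ) : B.b ≤ B.s r := by
  cases r with
  | zero => exact le_rfl
  | succ r => exact Nat.le_add_right _ _

theorem s_succ_le (r : ℕ) : B.s (r + 1) ≤ 2 * 2 ^ (Fintype.card Act * B.s r) := by
  have h₁ := (Fintype.card Act * B.s r).lt_two_pow_self
  have h₂ : B.s r ≤ Fintype.card Act * B.s r := Nat.le_mul_of_pos_left _ Fintype.card_pos
  have h₃ := B.b_le_s r
  rw [s]
  omega

/-- If `k * s r` is at most half of the exponent in the next tower value, the other half absorbs the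
constant factor `4` that arises in one step. -/
theorem two_mul_s_le_tow (h : 2 * (Fintype.card Act * B.b) ≤ tow (Fintype.card Act) B.j) (r : ℕ) :
    2 * (Fintype.card Act * B.s r) ≤ tow (Fintype.card Act) (B.j + r) := by
  induction r with
  | zero => exact h
  | succ r ih =>
    rw [← add_assoc, tow]
    have h₁ := B.s_succ_le r
    have h₂ := B.two_le_s r
    have h₃ : 2 ≤ Fintype.card Act * B.s r :=
      h₂.trans (Nat.le_mul_of_pos_left _ Fintype.card_pos)
    calc 2 * (Fintype.card Act * B.s (r + 1))
        = Fintype.card Act * (2 * B.s (r + 1)) := by ring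
      _ ≤ Fintype.card Act * (2 ^ 2 * 2 ^ (Fintype.card Act * B.s r)) :=
        Nat.mul_le_mul_left _ (by omega)
      _ = Fintype.card Act * 2 ^ (2 + Fintype.card Act * B.s r) := by rw [pow_add]
      _ ≤ _ := Nat.mul_le_mul_left _ (Nat.pow_le_pow_right two_pos (by omega))

/-- Polynomials in the number of states are bounded by the tower function. -/
theorem exists_pow_s_le (h : 2 * (Fintype.card Act * B.b) ≤ tow (Fintype.card Act) B.j) (e : ℕ) :
    ∃ C, ∀ d, B.s (d - B.j) ^ e ≤ C * tow (Fintype.card Act) d := by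
  set k := Fintype.card Act with hk
  have hk0 : 0 < k := Fintype.card_pos
  -- Two ranks are used. Halving at rank `r` makes `k * s (r + 1)` smaller than `tow k (B.j + r +
  -- 1)` by a factor of at least `2 ^ (k * s r) / 2`, and this factor exceeds `2 * e` for large `r`.
  -- After one more exponentiation it absorbs the power `e`.
  have hlarge : ∀ r, 4 * e ≤ r → B.s (r + 2) ^ e ≤ tow k (B.j + (r + 2)) := by
    intro r hr
    have h₁ := B.two_mul_s_le_tow h r
    have h₂ : 2 ^ (k * B.s r) * (k * B.s (r + 1)) ≤ 2 * tow k (B.j + r + 1) := by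
      calc _ ≤ 2 ^ (k * B.s r) * (k * (2 * 2 ^ (k * B.s r))) := by
            gcongr
            exact B.s_succ_le r
        _ = 2 * (k * 2 ^ (2 * (k * B.s r))) := by rw [two_mul (k * B.s r), pow_add]; ring
        _ ≤ _ := by
          rw [tow]
          gcongr
          exact one_le_two
    have h₃ : 4 * e ≤ 2 ^ (k * B.s r) := by
      have h₄ := (k * B.s r).lt_two_pow_self
      have h₅ : B.s r ≤ k * B.s r := Nat.le_mul_of_pos_left _ hk0
      have h₆ := B.lt_s r
      omega
    have h₄ : 2 * e * (k * B.s (r + 1)) ≤ tow k (B.j + r + 1) := by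
      have := Nat.mul_le_mul_right (k * B.s (r + 1)) h₃
      nlinarith
    have h₅ : 1 ≤ k * B.s (r + 1) :=
      (by have := B.two_le_s (r + 1); omega : 1 ≤ B.s (r + 1)).trans
        (Nat.le_mul_of_pos_left _ hk0)
    calc B.s (r + 2) ^ e ≤ (2 * 2 ^ (k * B.s (r + 1))) ^ e :=
          Nat.pow_le_pow_left (B.s_succ_le (r + 1)) e
      _ = 2 ^ ((1 + k * B.s (r + 1)) * e) := by rw [pow_mul _ _ e, pow_add, pow_one]
      _ ≤ 2 ^ tow k (B.j + r + 1) := by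
        refine Nat.pow_le_pow_right two_pos (le_trans ?_ h₄)
        nlinarith
      _ ≤ _ := two_pow_tow_le hk0 _
  -- The finitely many ranks below `4 * e + 2` are covered by the constant.
  refine ⟨1 + ∑ i ∈ Finset.range (4 * e + 2), B.s i ^ e, fun d => ?_⟩
  have ht := tow_pos hk0 d
  rcases lt_or_ge (d - B.j) (4 * e + 2) with hd | hd
  · calc B.s (d - B.j) ^ e ≤ ∑ i ∈ Finset.range (4 * e + 2), B.s i ^ e :=
          Finset.single_le_sum (f := fun i => B.s i ^ e) (fun _ _ => Nat.zero_le _)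
            (Finset.mem_range.2 hd)
      _ ≤ _ := Nat.le_mul_of_pos_right _ ht |>.trans (Nat.mul_le_mul_right _ (by omega))
  · have := hlarge (d - B.j - 2) (by omega)
    rw [show d - B.j - 2 + 2 = d - B.j by omega, show B.j + (d - B.j) = d by omega] at this
    calc _ ≤ _ := this
      _ ≤ _ := Nat.le_mul_of_pos_left _ (by omega)

end Base

end HM

/-! ### Stack programs and their compilation to Turing machines -/

namespace HM

/-! ### Programs over stacks -/

/-- Programs that manipulate stacks with names in `κ` and entries in `α`. -/
inductive Prog (κ α : Type) : Type
  | skip : Prog κ α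
  | push : κ → α → Prog κ α
  | mv : κ → List κ → Prog κ α
  | seq : Prog κ α → Prog κ α → Prog κ α
  | ite : κ → (Option α → Bool) → Prog κ α → Prog κ α → Prog κ α
  | loop : κ → (Option α → Bool) → Prog κ α → Prog κ α

namespace Prog

variable {κ α : Type}

/-- Push a symbol onto each stack in a list. -/
def pushAll [DecidableEq κ] (a : α) : List κ → (κ → List α) → κ → List α
  | [], s => s
  | k :: ks, s => pushAll a ks (Function.update s k (a :: s k))

/-- Pop a symbol from `k` and push it onto each stack in a list. -/
def move [DecidableEq κ] (k : κ) (ks : List κ) (s : κ → List α) : κ → List α :=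
  match s k with
  | [] => s
  | a :: l => pushAll a ks (Function.update s k l)

/-- `Exec p s s' t`: the program `p` turns the stacks `s` into the stacks `s'` in `t` steps. -/
inductive Exec [DecidableEq κ] : Prog κ α → (κ → List α) → (κ → List α) → ℕ → Prop
  | skip (s) : Exec skip s s 1
  | push (k a s) : Exec (push k a) s (Function.update s k (a :: s k)) 1
  | mv (k ks s) : Exec (mv k ks) s (move k ks s) 1
  | seq {p q s₁ s₂ s₃ t₁ t₂} : Exec p s₁ s₂ t₁ → Exec q s₂ s₃ t₂ →
      Exec (seq p q) s₁ s₃ (t₁ + t₂)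
  | ite_true {k f p q s s' t} : f (s k).head? = true → Exec p s s' t →
      Exec (ite k f p q) s s' (1 + t)
  | ite_false {k f p q s s' t} : f (s k).head? = false → Exec q s s' t →
      Exec (ite k f p q) s s' (1 + t)
  | loop_true {k f p s₁ s₂ s₃ t₁ t₂} : f (s₁ k).head? = true → Exec p s₁ s₂ t₁ →
      Exec (loop k f p) s₂ s₃ t₂ → Exec (loop k f p) s₁ s₃ (1 + (t₁ + t₂))
  | loop_false {k f p s} : f (s k).head? = false → Exec (loop k f p) s s 1

/-! ### Compilation to Turing machines -/

open Turing

/-- The labels of a program. -/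
@[reducible]
def Lbl : Prog κ α → Type
  | skip => Unit
  | push _ _ => Unit
  | mv _ _ => Unit
  | seq p q => Lbl p ⊕ Lbl q
  | ite _ _ p q => Option (Lbl p ⊕ Lbl q)
  | loop _ _ p => Option (Lbl p)

theorem lbl_finite (p : Prog κ α) : Finite (Lbl p) := by
  induction p with
  | skip => exact inferInstanceAs (Finite Unit)
  | push => exact inferInstanceAs (Finite Unit)
  | mv => exact inferInstanceAs (Finite Unit)
  | seq p q ihp ihq => exact inferInstanceAs (Finite (Lbl p ⊕ Lbl q))
  | ite _ _ p q ihp ihq => exact inferInstanceAs (Finite (Option (Lbl p ⊕ Lbl q)))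
  | loop _ _ p ihp => exact inferInstanceAs (Finite (Option (Lbl p)))

/-- The label at which the execution of a program begins. -/
def entry : (p : Prog κ α) → Lbl p
  | skip => ()
  | push _ _ => ()
  | mv _ _ => ()
  | seq p _ => .inl (entry p)
  | ite _ _ _ _ => none
  | loop _ _ _ => none

/-- The stacks of the machine are those of the program, an input stack and an output stack. -/
@[reducible]
def Sym (κ α β : Type) : κ ⊕ Bool → Type
  | .inl _ => α
  | .inr false => β
  | .inr true => Bool

/-- The contents of the stacks of the machine. -/
def fullStk {β : Type} (s : κ → List α) (i : List β) (o : List Bool) :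
    ∀ k, List (Sym κ α β k)
  | .inl k => s k
  | .inr false => i
  | .inr true => o

variable [DecidableEq κ]

theorem update_fullStk_inl {β : Type} (s : κ → List α) (i : List β) (o : List Bool) (k : κ)
    (l : List α) : Function.update (fullStk s i o) (.inl k) l =
      fullStk (Function.update s k l) i o := by
  funext k'
  rcases k' with k' | _ | _
  · by_cases h : k' = k
    · subst h
      rw [Function.update_self]
      exact (Function.update_self (f := s) k' l).symm
    · rw [Function.update_of_ne (by simpa using h)]
      exact (Function.update_of_ne (f := s) h l).symm
  · rfl
  · rfl

theorem update_fullStk_input {β : Type} (s : κ → List α) (i : List β) (o : List Bool)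
    (l : List β) : Function.update (fullStk s i o) (.inr false) l = fullStk s l o := by
  funext k'
  rcases k' with k' | _ | _ <;> rfl

theorem update_fullStk_output {β : Type} (s : κ → List α) (i : List β) (o : List Bool)
    (l : List Bool) : Function.update (fullStk s i o) (.inr true) l = fullStk s i l := by
  funext k'
  rcases k' with k' | _ | _ <;> rfl

variable {β Λ : Type}

/-- Push the symbol in the internal state onto each stack in a list. -/
def pushStmt [Inhabited α] (next : Λ) : List κ → TM2.Stmt (Sym κ α β) Λ (Option α)
  | [] => .goto fun _ => next
  | k :: ks => .push (.inl k) (fun v => v.getD default) (pushStmt next ks)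

/-- The statements of the machine that executes a program and continues with `next`. -/
def code [Inhabited α] : (p : Prog κ α) → (Lbl p → Λ) → Λ → Lbl p → TM2.Stmt (Sym κ α β) Λ (Option α)
  | skip, _, next, _ => .goto fun _ => next
  | push k a, _, next, _ => .push (.inl k) (fun _ => a) (.goto fun _ => next)
  | mv k ks, _, next, _ => .pop (.inl k) (fun _ o => o)
      (.branch Option.isSome (pushStmt next ks) (.goto fun _ => next))
  | seq p q, emb, _, .inl l => code p (fun l => emb (.inl l)) (emb (.inr (entry q))) l
  | seq _ q, emb, next, .inr l => code q (fun l => emb (.inr l)) next l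
  | ite k f p q, emb, _, none => .peek (.inl k) (fun _ o => o)
      (.branch f (.goto fun _ => emb (some (.inl (entry p))))
        (.goto fun _ => emb (some (.inr (entry q)))))
  | ite _ _ p _, emb, next, some (.inl l) => code p (fun l => emb (some (.inl l))) next l
  | ite _ _ _ q, emb, next, some (.inr l) => code q (fun l => emb (some (.inr l))) next l
  | loop k f p, emb, next, none => .peek (.inl k) (fun _ o => o)
      (.branch f (.goto fun _ => emb (some (entry p))) (.goto fun _ => next))
  | loop _ _ p, emb, _, some l => code p (fun l => emb (some l)) (emb none) l

/-- The machine `M` goes from `c` to `c'` in `t` steps. -/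
def StepsIn (M : Λ → TM2.Stmt (Sym κ α β) Λ (Option α)) (t : ℕ)
    (c c' : TM2.Cfg (Sym κ α β) Λ (Option α)) : Prop :=
  (flip bind (TM2.step M))^[t] (some c) = some c'

theorem StepsIn.trans {M : Λ → TM2.Stmt (Sym κ α β) Λ (Option α)} {t₁ t₂ : ℕ}
    {c₁ c₂ c₃ : TM2.Cfg (Sym κ α β) Λ (Option α)} (h₁ : StepsIn M t₁ c₁ c₂)
    (h₂ : StepsIn M t₂ c₂ c₃) : StepsIn M (t₁ + t₂) c₁ c₃ := by
  rw [StepsIn, add_comm, Function.iterate_add_apply, h₁, h₂]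

theorem stepsIn_one {M : Λ → TM2.Stmt (Sym κ α β) Λ (Option α)} {l : Λ} {v : Option α}
    {s : ∀ k, List (Sym κ α β k)} {st : TM2.Stmt (Sym κ α β) Λ (Option α)} (h : M l = st) :
    StepsIn M 1 ⟨some l, v, s⟩ (TM2.stepAux st v s) := by
  subst h
  rfl

theorem stepAux_pushStmt [Inhabited α] (next : Λ) (ks : List κ) (a : α) (s : κ → List α)
    (i : List β) (o : List Bool) : TM2.stepAux (pushStmt next ks) (some a) (fullStk s i o) =
      ⟨some next, some a, fullStk (pushAll a ks s) i o⟩ := by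
  induction ks generalizing s with
  | nil => rfl
  | cons k ks ih =>
    rw [pushAll, ← ih, ← update_fullStk_inl]
    rfl

theorem stepAux_test (k : κ) (f : Option α → Bool) (l₁ l₂ : Λ) (v : Option α) (s : κ → List α)
    (i : List β) (o : List Bool) :
    TM2.stepAux (.peek (.inl k) (fun _ o => o)
      (.branch f (.goto fun _ => l₁) (.goto fun _ => l₂))) v (fullStk s i o) =
      ⟨some (bif f (s k).head? then l₁ else l₂), (s k).head?, fullStk s i o⟩ := by
  have : TM2.stepAux (.peek (.inl k) (fun _ o => o)
      (.branch f (.goto fun _ => l₁) (.goto fun _ => l₂))) v (fullStk s i o) =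
      bif f (s k).head? then ⟨some l₁, (s k).head?, fullStk s i o⟩
      else ⟨some l₂, (s k).head?, fullStk s i o⟩ := rfl
  rw [this]
  cases f (s k).head? <;> rfl

theorem stepAux_mv [Inhabited α] (k : κ) (ks : List κ) (next : Λ) (v : Option α) (s : κ → List α)
    (i : List β) (o : List Bool) :
    TM2.stepAux (.pop (.inl k) (fun _ o => o)
      (.branch Option.isSome (pushStmt next ks) (.goto fun _ => next))) v (fullStk s i o) =
      ⟨some next, (s k).head?, fullStk (move k ks s) i o⟩ := by
  have : TM2.stepAux (.pop (.inl k) (fun _ o => o)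
      (.branch Option.isSome (pushStmt next ks) (.goto fun _ => next))) v (fullStk s i o) =
      bif ((s k).head?).isSome then TM2.stepAux (pushStmt next ks) (s k).head?
        (Function.update (fullStk s i o) (.inl k) (s k).tail)
      else ⟨some next, (s k).head?, Function.update (fullStk s i o) (.inl k) (s k).tail⟩ := rfl
  rw [this, update_fullStk_inl, move]
  cases hk : s k with
  | nil =>
    have hs : Function.update s k [] = s := by rw [← hk, Function.update_eq_self]
    simp [hs]
  | cons a l => exact stepAux_pushStmt next ks a (Function.update s k l) i o

/-- The times of `Exec` are chosen so that they are exact: each basic statement and each test is one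
machine step, and sequencing is free because a program jumps directly to `next`. The embedding `emb`
and the label `next` are variable so that the induction applies to subprograms. -/
theorem Exec.stepsIn [Inhabited α] {p : Prog κ α} {s s' : κ → List α} {t : ℕ}
    (h : Exec p s s' t) (M : Λ → TM2.Stmt (Sym κ α β) Λ (Option α)) (emb : Lbl p → Λ) (next : Λ)
    (hM : ∀ l, M (emb l) = code p emb next l) (i : List β) (o : List Bool) (v : Option α) :
    ∃ v', StepsIn M t ⟨some (emb (entry p)), v, fullStk s i o⟩
      ⟨some next, v', fullStk s' i o⟩ := by
  induction h generalizing next v with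
  | skip s => exact ⟨v, stepsIn_one (hM ())⟩
  | push k a s =>
    refine ⟨v, ?_⟩
    rw [← update_fullStk_inl]
    exact stepsIn_one (hM ())
  | mv k ks s =>
    have := stepsIn_one (v := v) (s := fullStk s i o) (hM ())
    exact ⟨_, (stepAux_mv k ks next v s i o) ▸ this⟩
  | seq h₁ h₂ ih₁ ih₂ =>
    obtain ⟨v₁, h₁⟩ := ih₁ (fun l => emb (.inl l)) (emb (.inr (entry _)))
      (fun l => hM (.inl l)) v
    obtain ⟨v₂, h₂⟩ := ih₂ (fun l => emb (.inr l)) next (fun l => hM (.inr l)) v₁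
    exact ⟨v₂, h₁.trans h₂⟩
  | @ite_true k f p q s s' t hf h ih =>
    obtain ⟨v₁, h₁⟩ := ih (fun l => emb (some (.inl l))) next (fun l => hM (some (.inl l)))
      (s k).head?
    refine ⟨v₁, StepsIn.trans ?_ h₁⟩
    have := stepsIn_one (v := v) (s := fullStk s i o) (hM none)
    have e := stepAux_test (β := β) k f (emb (some (.inl (entry p)))) (emb (some (.inr (entry q))))
      v s i o
    rw [hf] at e
    exact e ▸ this
  | @ite_false k f p q s s' t hf h ih =>
    obtain ⟨v₁, h₁⟩ := ih (fun l => emb (some (.inr l))) next (fun l => hM (some (.inr l)))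
      (s k).head?
    refine ⟨v₁, StepsIn.trans ?_ h₁⟩
    have := stepsIn_one (v := v) (s := fullStk s i o) (hM none)
    have e := stepAux_test (β := β) k f (emb (some (.inl (entry p)))) (emb (some (.inr (entry q))))
      v s i o
    rw [hf] at e
    exact e ▸ this
  | @loop_true k f p s₁ s₂ s₃ t₁ t₂ hf h₁ h₂ ih₁ ih₂ =>
    obtain ⟨v₁, h₁⟩ := ih₁ (fun l => emb (some l)) (emb none) (fun l => hM (some l))
      (s₁ k).head?
    obtain ⟨v₂, h₂⟩ := ih₂ emb next hM v₁
    refine ⟨v₂, StepsIn.trans ?_ (h₁.trans h₂)⟩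
    have := stepsIn_one (v := v) (s := fullStk s₁ i o) (hM none)
    have e := stepAux_test (β := β) k f (emb (some (entry p))) next v s₁ i o
    rw [hf] at e
    exact e ▸ this
  | @loop_false k f p s hf =>
    refine ⟨(s k).head?, ?_⟩
    have := stepsIn_one (v := v) (s := fullStk s i o) (hM none)
    have e := stepAux_test (β := β) k f (emb (some (entry p))) next v s i o
    rw [hf] at e
    exact e ▸ this

/-- The statements of a machine that moves the input to the stack `k₀`, executes `p`, and outputs
a bit that is read from the stack `k₁`. -/
def machineCode [Inhabited α] (p : Prog κ α) (sym : β → α) (ans : Option α → Bool) (k₀ k₁ : κ) :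
    Bool ⊕ Lbl p → TM2.Stmt (Sym κ α β) (Bool ⊕ Lbl p) (Option α)
  | .inl false => .pop (.inr false) (fun _ o => Option.map sym o)
      (.branch Option.isSome (.push (.inl k₀) (fun v => v.getD default) (.goto fun _ => .inl false))
        (.goto fun _ => .inr (entry p)))
  | .inl true => .pop (.inl k₁) (fun _ o => o)
      (.push (.inr true) ans (.load (fun _ => none) .halt))
  | .inr l => code p .inr (.inl true) l

/-- A machine that moves the input to the stack `k₀`, executes `p`, and outputs a bit that is read
from the stack `k₁`. -/
noncomputable def machine [Inhabited α] [Fintype κ] [Finite α] [Finite β] (p : Prog κ α) (sym : β → α)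
    (ans : Option α → Bool) (k₀ k₁ : κ) : TM2ComputableAux β Bool where
  tm :=
    { K := κ ⊕ Bool
      k₀ := .inr false
      k₁ := .inr true
      Γ := Sym κ α β
      Λ := Bool ⊕ Lbl p
      main := .inl false
      ΛFin := @Fintype.ofFinite _ (@Finite.instSum _ _ _ (lbl_finite p))
      σ := Option α
      initialState := none
      σFin := Fintype.ofFinite _
      Γk₀Fin := Fintype.ofFinite β
      m := machineCode p sym ans k₀ k₁ }
  inputAlphabet := Equiv.refl β
  outputAlphabet := Equiv.refl Bool

/-- Popping the input and pushing it onto `k₀` reverses it. The last of the `w.length + 1` steps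
finds the input empty. -/
theorem stepsIn_read [Inhabited α] (p : Prog κ α) (sym : β → α) (ans : Option α → Bool)
    (k₀ k₁ : κ) (w : List β) (s : κ → List α) (v : Option α) :
    StepsIn (machineCode p sym ans k₀ k₁) (w.length + 1) ⟨some (.inl false), v, fullStk s w []⟩
      ⟨some (.inr (entry p)), none,
        fullStk (Function.update s k₀ ((w.map sym).reverse ++ s k₀)) [] []⟩ := by
  induction w generalizing s v with
  | nil =>
    rw [List.map_nil, List.reverse_nil, List.nil_append, Function.update_eq_self]
    have h : StepsIn (machineCode p sym ans k₀ k₁) 1 ⟨some (.inl false), v, fullStk s [] []⟩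
        ⟨some (.inr (entry p)), none, Function.update (fullStk s [] []) (.inr false) []⟩ :=
      stepsIn_one rfl
    rwa [update_fullStk_input] at h
  | cons a w ih =>
    have h : StepsIn (machineCode p sym ans k₀ k₁) 1
        ⟨some (.inl false), v, fullStk s (a :: w) []⟩
        ⟨some (.inl false), some (sym a),
          fullStk (Function.update s k₀ (sym a :: s k₀)) w []⟩ := by
      have h : StepsIn (machineCode p sym ans k₀ k₁) 1
          ⟨some (.inl false), v, fullStk s (a :: w) []⟩
          ⟨some (.inl false), some (sym a), Function.update
            (Function.update (fullStk s (a :: w) []) (.inr false) w) (.inl k₀) (sym a :: s k₀)⟩ :=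
        stepsIn_one rfl
      rwa [update_fullStk_input, update_fullStk_inl] at h
    have h := h.trans (ih _ _)
    rw [add_comm 1] at h
    simpa using h

theorem stepsIn_write [Inhabited α] (p : Prog κ α) (sym : β → α) (ans : Option α → Bool)
    (k₀ k₁ : κ) (s : κ → List α) (v : Option α) :
    StepsIn (machineCode p sym ans k₀ k₁) 1 ⟨some (.inl true), v, fullStk s [] []⟩
      ⟨none, none, fullStk (Function.update s k₁ (s k₁).tail) [] [ans (s k₁).head?]⟩ := by
  have h : StepsIn (machineCode p sym ans k₀ k₁) 1 ⟨some (.inl true), v, fullStk s [] []⟩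
      ⟨none, none, Function.update (Function.update (fullStk s [] []) (.inl k₁) (s k₁).tail)
        (.inr true) [ans (s k₁).head?]⟩ :=
    stepsIn_one rfl
  rwa [update_fullStk_inl, update_fullStk_output] at h

/-- Apart from `p`, the machine spends `w.length + 1` steps on reading and one step on writing the
answer. The only symbol left by `p` is popped when the answer is written, so that the final
configuration has all other stacks empty. -/
theorem Exec.outputsInTime [Inhabited α] [Fintype κ] [Finite α] [Finite β] {p : Prog κ α} (sym : β → α)
    (ans : Option α → Bool) {k₀ k₁ : κ} {w : List β} {c : α} {t : ℕ}
    (h : Exec p (Function.update (fun _ => []) k₀ (w.map sym).reverse)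
      (Function.update (fun _ => []) k₁ [c]) t) :
    Nonempty (TM2OutputsInTime (machine p sym ans k₀ k₁).tm
      (w.map (machine p sym ans k₀ k₁).inputAlphabet.symm)
      (some ([ans (some c)].map (machine p sym ans k₀ k₁).outputAlphabet.symm))
      (w.length + t + 2)) := by
  have h₁ := stepsIn_read p sym ans k₀ k₁ w (fun _ => []) none
  rw [List.append_nil] at h₁
  obtain ⟨v, h₂⟩ := h.stepsIn (machineCode p sym ans k₀ k₁) .inr (.inl true) (fun _ => rfl) [] []
    none
  have h₃ : StepsIn (machineCode p sym ans k₀ k₁) 1 ⟨some (.inl true), v,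
      fullStk (Function.update (fun _ => []) k₁ [c]) ([] : List β) []⟩
      ⟨none, none, fullStk (fun _ => []) [] [ans (some c)]⟩ := by
    have h := stepsIn_write p sym ans k₀ k₁ (Function.update (fun _ => []) k₁ [c]) v
    rw [Function.update_self, List.tail_cons, Function.update_idem, List.head?_cons] at h
    have hs : Function.update (fun _ => [] : κ → List α) k₁ [] = fun _ => [] :=
      Function.update_eq_self k₁ (fun _ => [] : κ → List α)
    rwa [hs] at h
  have h₄ := (h₁.trans h₂).trans h₃
  refine ⟨⟨⟨w.length + 1 + t + 1, ?_⟩, (by omega : w.length + 1 + t + 1 ≤ _)⟩⟩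
  have hi : initList (machine p sym ans k₀ k₁).tm
      (w.map (machine p sym ans k₀ k₁).inputAlphabet.symm) =
      ⟨some (.inl false), none, fullStk (fun _ => []) w []⟩ := by
    simp only [initList, machine]
    congr 1
    funext k
    rcases k with k | _ | _
    · rfl
    · exact List.map_id _
    · rfl
  have ho : haltList (machine p sym ans k₀ k₁).tm
      ([ans (some c)].map (machine p sym ans k₀ k₁).outputAlphabet.symm) =
      ⟨none, none, fullStk (fun _ => []) [] [ans (some c)]⟩ := by
    simp only [haltList, machine]
    congr 1
    funext k
    rcases k with k | _ | _ <;> rfl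
  rw [hi, Option.map_some, ho]
  exact h₄

end Prog

end HM

/-! ### Running times of stack programs, and matrix operations -/

namespace HM

namespace Prog

variable {κ α : Type} [DecidableEq κ]

/-! ### Running times up to upper bounds -/

/-- `Runs p s s' T`: the program `p` turns the stacks `s` into the stacks `s'` in at most `T`
steps. -/
def Runs (p : Prog κ α) (s s' : κ → List α) (T : ℕ) : Prop := ∃ t ≤ T, Exec p s s' t

theorem Runs.mono {p : Prog κ α} {s s' : κ → List α} {T T' : ℕ} (h : Runs p s s' T)
    (hT : T ≤ T') : Runs p s s' T' :=
  let ⟨t, ht, h⟩ := h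
  ⟨t, ht.trans hT, h⟩

theorem Runs.congr {p : Prog κ α} {s s' s'' : κ → List α} {T : ℕ} (h : Runs p s s' T)
    (hs : s' = s'') : Runs p s s'' T :=
  hs ▸ h

theorem runs_skip (s : κ → List α) : Runs skip s s 1 := ⟨1, le_rfl, .skip s⟩

theorem runs_push (k : κ) (a : α) (s : κ → List α) :
    Runs (push k a) s (Function.update s k (a :: s k)) 1 := ⟨1, le_rfl, .push k a s⟩

theorem runs_mv (k : κ) (ks : List κ) (s : κ → List α) : Runs (mv k ks) s (move k ks s) 1 :=
  ⟨1, le_rfl, .mv k ks s⟩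

theorem Runs.seq {p q : Prog κ α} {s₁ s₂ s₃ : κ → List α} {T₁ T₂ : ℕ} (h₁ : Runs p s₁ s₂ T₁)
    (h₂ : Runs q s₂ s₃ T₂) : Runs (seq p q) s₁ s₃ (T₁ + T₂) :=
  let ⟨_, ht₁, h₁⟩ := h₁
  let ⟨_, ht₂, h₂⟩ := h₂
  ⟨_, Nat.add_le_add ht₁ ht₂, .seq h₁ h₂⟩

theorem Runs.ite_true {k : κ} {f : Option α → Bool} {p q : Prog κ α} {s s' : κ → List α} {T : ℕ}
    (hf : f (s k).head? = true) (h : Runs p s s' T) : Runs (ite k f p q) s s' (T + 1) :=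
  let ⟨_, ht, h⟩ := h
  ⟨_, by omega, .ite_true hf h⟩

theorem Runs.ite_false {k : κ} {f : Option α → Bool} {p q : Prog κ α} {s s' : κ → List α} {T : ℕ}
    (hf : f (s k).head? = false) (h : Runs q s s' T) : Runs (ite k f p q) s s' (T + 1) :=
  let ⟨_, ht, h⟩ := h
  ⟨_, by omega, .ite_false hf h⟩

theorem Runs.loop_true {k : κ} {f : Option α → Bool} {p : Prog κ α} {s₁ s₂ s₃ : κ → List α}
    {T₁ T₂ : ℕ} (hf : f (s₁ k).head? = true) (h₁ : Runs p s₁ s₂ T₁)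
    (h₂ : Runs (loop k f p) s₂ s₃ T₂) : Runs (loop k f p) s₁ s₃ (T₁ + 1 + T₂) :=
  let ⟨_, _, h₁⟩ := h₁
  let ⟨_, _, h₂⟩ := h₂
  ⟨_, by omega, .loop_true hf h₁ h₂⟩

theorem runs_loop_false {k : κ} {f : Option α → Bool} (p : Prog κ α) {s : κ → List α}
    (hf : f (s k).head? = false) : Runs (loop k f p) s s 1 :=
  ⟨1, le_rfl, .loop_false hf⟩

/-! ### Moving the contents of stacks -/

theorem pushAll_apply {a : α} {ks : List κ} (h : ks.Nodup) (s : κ → List α) (j : κ) :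
    pushAll a ks s j = if j ∈ ks then a :: s j else s j := by
  induction ks generalizing s with
  | nil => rfl
  | cons k ks ih =>
    rw [List.nodup_cons] at h
    rw [pushAll, ih h.2]
    by_cases hj : j = k
    · subst hj
      simp [h.1]
    · simp [hj]

/-- Move the symbols on top of the stack `k` that satisfy `f` to each of the stacks `ks`. -/
def moveWhile (k : κ) (f : Option α → Bool) (ks : List κ) : Prog κ α := loop k f (mv k ks)

/-- Move all symbols on the stack `k` to each of the stacks `ks`. -/
def moveAll (k : κ) (ks : List κ) : Prog κ α := moveWhile k Option.isSome ks

/-- Each symbol costs a test and a move, and there is one final failing test. The order is reversed,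
so later programs move data an even number of times or build it in reverse. -/
theorem runs_moveWhile {k : κ} {f : Option α → Bool} {ks : List κ} (hk : k ∉ ks) (hn : ks.Nodup)
    {l rest : List α} {s : κ → List α} (hs : s k = l ++ rest)
    (hl : ∀ a ∈ l, f (some a) = true) (hr : f rest.head? = false) :
    Runs (moveWhile k f ks) s
      (fun j => if j = k then rest else if j ∈ ks then l.reverse ++ s j else s j)
      (2 * l.length + 1) := by
  induction l generalizing s with
  | nil =>
    refine (runs_loop_false _ (by rw [hs]; exact hr)).congr ?_
    funext j
    by_cases hj : j = k
    · subst hj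
      simp [hs]
    · simp [hj]
  | cons a l ih =>
    have h : move k ks s k = l ++ rest := by
      simp [move, hs, pushAll_apply hn, hk]
    refine ((Runs.loop_true (by rw [hs]; exact hl a (by simp)) (runs_mv k ks s)
      (ih h fun b hb => hl b (by simp [hb]))).congr ?_).mono (by simp; omega)
    funext j
    by_cases hj : j = k
    · simp [hj]
    · by_cases hj' : j ∈ ks <;> simp [hj, hj', move, hs, pushAll_apply hn]

theorem runs_moveAll {k : κ} {ks : List κ} (hk : k ∉ ks) (hn : ks.Nodup) (s : κ → List α) :
    Runs (moveAll k ks) s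
      (fun j => if j = k then [] else if j ∈ ks then (s k).reverse ++ s j else s j)
      (2 * (s k).length + 1) :=
  runs_moveWhile hk hn (List.append_nil _).symm (fun _ _ => rfl) rfl

/-- Remove all symbols from a stack. -/
def clear (k : κ) : Prog κ α := moveAll k []

theorem runs_clear (k : κ) (s : κ → List α) :
    Runs (clear k) s (Function.update s k []) (2 * (s k).length + 1) := by
  refine (runs_moveAll (k := k) (ks := []) (by simp) List.nodup_nil s).congr ?_
  funext j
  by_cases hj : j = k
  · simp [hj]
  · simp [hj]

/-- Remove all symbols from each of a list of stacks. -/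
def clearAll : List κ → Prog κ α
  | [] => skip
  | k :: ks => seq (clear k) (clearAll ks)

theorem runs_clearAll (ks : List κ) (s : κ → List α) :
    Runs (clearAll ks) s (fun j => if j ∈ ks then [] else s j)
      (1 + (ks.map fun k => 2 * (s k).length + 1).sum) := by
  induction ks generalizing s with
  | nil => exact (runs_skip s).congr (by simp)
  | cons k ks ih =>
    refine (((runs_clear k s).seq (ih _)).congr ?_).mono ?_
    · funext j
      by_cases hj : j ∈ ks
      · simp [hj]
      · by_cases hj' : j = k <;> simp [hj, hj']
    · have : (ks.map fun j => 2 * (Function.update s k [] j).length + 1).sum ≤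
          (ks.map fun j => 2 * (s j).length + 1).sum := by
        refine List.sum_le_sum fun j _ => ?_
        by_cases hj' : j = k <;> simp [hj']
      simp only [List.map_cons, List.sum_cons]
      omega

end Prog

/-! ### The stacks of the decision procedure -/

/-- The symbols on the stacks: bits, the ends of rows and of matrices, and input symbols. -/
inductive Cell (β : Type) : Type
  | bit : Bool → Cell β
  | eor : Cell β
  | eom : Cell β
  | sym : β → Cell β

namespace Cell

variable {β : Type}

instance : Inhabited (Cell β) := ⟨eor⟩

instance [Finite β] : Finite (Cell β) := by
  let f : Cell β → Option (Option (Bool ⊕ β))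
    | bit b => some (some (.inl b))
    | eor => none
    | eom => some none
    | sym x => some (some (.inr x))
  refine Finite.of_injective f ?_
  rintro (b | _ | _ | x) (b' | _ | _ | x') h <;> simp_all [f]

/-- The top of the stack is a bit. -/
def isBit : Option (Cell β) → Bool
  | some (bit _) => true
  | _ => false

/-- The top of the stack is the bit `true`. -/
def isOne : Option (Cell β) → Bool
  | some (bit true) => true
  | _ => false

/-- The top of the stack is the end of a row. -/
def isEor : Option (Cell β) → Bool
  | some eor => true
  | _ => false

/-- The top of the stack is neither the end of a matrix nor the end of the stack. -/
def notEom : Option (Cell β) → Bool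
  | some eom => false
  | none => false
  | _ => true

end Cell

/-- The names of the stacks: matrix registers, a stack of matrices, two stacks for the input, a
stack for a number in unary, and temporary stacks. -/
inductive Name (ι : Type) : Type
  | reg : ι → Name ι
  | vals : Name ι
  | inp : Name ι
  | inp' : Name ι
  | num : Name ι
  | ta : Name ι
  | tb : Name ι
  | tc : Name ι
  | td : Name ι
  | te : Name ι
  | tf : Name ι
  | tw : Name ι
  deriving DecidableEq, Fintype

namespace Name

variable {ι γ : Type}

/-- The stacks `s`, with other contents of the temporary stacks. -/
def withTmp (s : Name ι → List γ) (a b c d e f w : List γ) : Name ι → List γ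
  | ta => a
  | tb => b
  | tc => c
  | td => d
  | te => e
  | tf => f
  | tw => w
  | k => s k

variable (s : Name ι → List γ) (a b c d e f w x : List γ)

@[simp] theorem withTmp_ta : withTmp s a b c d e f w ta = a := rfl
@[simp] theorem withTmp_tb : withTmp s a b c d e f w tb = b := rfl
@[simp] theorem withTmp_tc : withTmp s a b c d e f w tc = c := rfl
@[simp] theorem withTmp_td : withTmp s a b c d e f w td = d := rfl
@[simp] theorem withTmp_te : withTmp s a b c d e f w te = e := rfl
@[simp] theorem withTmp_tf : withTmp s a b c d e f w tf = f := rfl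
@[simp] theorem withTmp_tw : withTmp s a b c d e f w tw = w := rfl
@[simp] theorem withTmp_reg (i : ι) : withTmp s a b c d e f w (reg i) = s (reg i) := rfl
@[simp] theorem withTmp_vals : withTmp s a b c d e f w vals = s vals := rfl
@[simp] theorem withTmp_inp : withTmp s a b c d e f w inp = s inp := rfl
@[simp] theorem withTmp_inp' : withTmp s a b c d e f w inp' = s inp' := rfl
@[simp] theorem withTmp_num : withTmp s a b c d e f w num = s num := rfl

theorem withTmp_self (h : ∀ k ∈ [ta, tb, tc, td, te, tf, tw], s k = []) :
    withTmp s [] [] [] [] [] [] [] = s := by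
  simp only [List.forall_mem_cons] at h
  funext k
  cases k <;> simp [withTmp, h]

variable [DecidableEq ι]

@[simp] theorem update_ta : Function.update (withTmp s a b c d e f w) ta x =
    withTmp s x b c d e f w := by
  funext k
  cases k <;> simp

@[simp] theorem update_tb : Function.update (withTmp s a b c d e f w) tb x =
    withTmp s a x c d e f w := by
  funext k
  cases k <;> simp

@[simp] theorem update_tc : Function.update (withTmp s a b c d e f w) tc x =
    withTmp s a b x d e f w := by
  funext k
  cases k <;> simp

@[simp] theorem update_td : Function.update (withTmp s a b c d e f w) td x =
    withTmp s a b c x e f w := by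
  funext k
  cases k <;> simp

@[simp] theorem update_te : Function.update (withTmp s a b c d e f w) te x =
    withTmp s a b c d x f w := by
  funext k
  cases k <;> simp

@[simp] theorem update_tf : Function.update (withTmp s a b c d e f w) tf x =
    withTmp s a b c d e x w := by
  funext k
  cases k <;> simp

@[simp] theorem update_tw : Function.update (withTmp s a b c d e f w) tw x =
    withTmp s a b c d e f x := by
  funext k
  cases k <;> simp

@[simp] theorem update_reg (i : ι) : Function.update (withTmp s a b c d e f w) (reg i) x =
    withTmp (Function.update s (reg i) x) a b c d e f w := by
  funext k
  cases k <;> simp [Function.update_apply]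

@[simp] theorem update_vals : Function.update (withTmp s a b c d e f w) vals x =
    withTmp (Function.update s vals x) a b c d e f w := by
  funext k
  cases k <;> simp

end Name

end HM

namespace HM

namespace Prog

section

variable {κ α : Type} [DecidableEq κ]

/-- Copy the stack `k` to the top of the stack `x`, using the empty stack `w`. -/
def copy (k w x : κ) : Prog κ α := seq (moveAll k [w]) (moveAll w [k, x])

theorem runs_copy {k w x : κ} (hkw : k ≠ w) (hkx : k ≠ x) (hwx : w ≠ x) {s : κ → List α}
    (hw : s w = []) :
    Runs (copy k w x) s (Function.update s x (s k ++ s x)) (4 * (s k).length + 2) := by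
  refine (((runs_moveAll (ks := [w]) (by simpa using hkw) (by simp) s).seq
    (runs_moveAll (ks := [k, x]) (by simpa using ⟨hkw.symm, hwx⟩) (by simpa using hkx) _)).congr
    ?_).mono (by simp [hkw.symm, hw]; omega)
  funext j
  by_cases h₁ : j = w
  · subst h₁
    simp [hwx, hw]
  · by_cases h₂ : j = k
    · subst h₂
      simp [hkx, hkw, hkw.symm, hw]
    · by_cases h₃ : j = x
      · subst h₃
        simp [h₁, h₂, hkw.symm, hw]
      · simp [h₁, h₂, h₃]

theorem runs_transfer {k x : κ} (h : k ≠ x) (s : κ → List α) :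
    Runs (moveAll k [x]) s (Function.update (Function.update s x ((s k).reverse ++ s x)) k [])
      (2 * (s k).length + 1) := by
  refine (runs_moveAll (ks := [x]) (by simpa using h) (by simp) s).congr ?_
  funext j
  by_cases h₁ : j = k
  · subst h₁
    simp
  · by_cases h₂ : j = x
    · subst h₂
      simp [h₁]
    · simp [h₁, h₂]

end

variable {ι β : Type} [DecidableEq ι]

open Name Cell

/-! ### Operations on matrices -/

/-- The code of a list of rows. -/
def encRows (R : List (List Bool)) : List (Cell β) := R.flatMap fun r => r.map bit ++ [eor]

theorem notEom_of_mem_encRows {R : List (List Bool)} {c : Cell β} (h : c ∈ encRows R) :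
    notEom (some c) = true := by
  simp only [encRows, List.mem_flatMap, List.mem_append, List.mem_map, List.mem_singleton] at h
  obtain ⟨r, _, ⟨b, _, rfl⟩ | rfl⟩ := h <;> rfl

/-- Move the topmost matrix from the stack of matrices to the stack `x`. -/
def popTo (x : Name ι) : Prog (Name ι) (Cell β) :=
  seq (moveWhile vals notEom [tw]) (seq (mv vals []) (moveAll tw [x]))

/-- The detour through `tw` restores the orientation; the separator is dropped in between. -/
theorem runs_popTo {x : Name ι} (h₁ : x ≠ vals) (h₂ : x ≠ tw) {s : Name ι → List (Cell β)}
    (hw : s tw = []) {m rest : List (Cell β)} (hm : ∀ c ∈ m, notEom (some c) = true)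
    (hs : s vals = m ++ eom :: rest) :
    Runs (popTo x) s (Function.update (Function.update s vals rest) x (m ++ s x))
      (4 * m.length + 3) := by
  refine (((runs_moveWhile (ks := [tw]) (by simp) (by simp) hs hm rfl).seq ((runs_mv _ _ _).seq
    (runs_moveAll (ks := [x]) (by simpa using h₂.symm) (by simp) _))).congr ?_).mono ?_
  · funext j
    by_cases hx : j = x
    · subst hx
      simp [move, pushAll, hw, h₁, h₂]
    · by_cases hv : j = vals
      · subst hv
        simp [move, pushAll, hx]
      · by_cases hj : j = tw
        · subst hj
          simp [Function.update_of_ne h₂.symm, hw]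
        · simp [move, pushAll, hx, hv, hj]
  · simp [move, pushAll, hw]
    omega

/-- The entries of the negated conjunction of two matrices. -/
def nandCell (c c' : Cell β) : Cell β :=
  if isOne (some c) then (if isOne (some c') then bit false else bit true)
  else if isEor (some c) then eor else bit true

/-- Combine the codes of two matrices. -/
def nandLoop : Prog (Name ι) (Cell β) :=
  loop ta Option.isSome (seq (ite ta isOne (ite tb isOne (push tw (bit false))
    (push tw (bit true))) (ite ta isEor (push tw eor) (push tw (bit true))))
    (seq (mv ta []) (mv tb [])))

theorem runs_nandLoop {l₁ l₂ : List (Cell β)} (h : l₁.length = l₂.length)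
    (s : Name ι → List (Cell β)) (c d e f w : List (Cell β)) :
    Runs nandLoop (withTmp s l₁ l₂ c d e f w)
      (withTmp s [] [] c d e f ((List.zipWith nandCell l₁ l₂).reverse ++ w))
      (6 * l₁.length + 1) := by
  induction l₁ generalizing l₂ w with
  | nil =>
    obtain rfl := List.length_eq_zero_iff.1 h.symm
    exact runs_loop_false _ rfl
  | cons x l₁ ih =>
    cases l₂ with
    | nil => simp at h
    | cons y l₂ =>
      have hstep : Runs (ite ta isOne (ite tb isOne (push tw (bit false)) (push tw (bit true)))
          (ite ta isEor (push tw eor) (push tw (bit true))))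
          (withTmp s (x :: l₁) (y :: l₂) c d e f w)
          (withTmp s (x :: l₁) (y :: l₂) c d e f (nandCell x y :: w)) 3 := by
        by_cases hx : isOne (some x) = true
        · refine .ite_true (by simpa using hx) ?_
          by_cases hy : isOne (some y) = true
          · exact .ite_true (by simpa using hy) ((runs_push _ _ _).congr (by simp [nandCell, hx, hy]))
          · exact .ite_false (by simpa using hy)
              ((runs_push _ _ _).congr (by simp [nandCell, hx, hy]))
        · refine .ite_false (by simpa using hx) ?_
          by_cases hy : isEor (some x) = true
          · exact .ite_true (by simpa using hy) ((runs_push _ _ _).congr (by simp [nandCell, hx, hy]))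
          · exact .ite_false (by simpa using hy)
              ((runs_push _ _ _).congr (by simp [nandCell, hx, hy]))
      refine (Runs.loop_true (by simp) (hstep.seq ((runs_mv _ _ _).seq (runs_mv _ _ _))) ?_).mono
        (T := _ + (6 * l₁.length + 1)) (by simp; omega)
      have := ih (l₂ := l₂) (by simpa using h) (nandCell x y :: w)
      rw [nandLoop] at this
      simpa [move, pushAll] using this

/-- Replace the two topmost matrices by their negated conjunction. -/
def nandVals : Prog (Name ι) (Cell β) :=
  seq (popTo tb) (seq (popTo ta) (seq nandLoop (seq (push vals eom) (moveAll tw [vals]))))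

theorem runs_nandVals {m₁ m₂ rest : List (Cell β)} (h : m₁.length = m₂.length)
    (h₁ : ∀ c ∈ m₁, notEom (some c) = true) (h₂ : ∀ c ∈ m₂, notEom (some c) = true)
    {s : Name ι → List (Cell β)} (hs : s vals = m₂ ++ eom :: (m₁ ++ eom :: rest)) :
    Runs nandVals (withTmp s [] [] [] [] [] [] [])
      (withTmp (Function.update s vals (List.zipWith nandCell m₁ m₂ ++ eom :: rest))
        [] [] [] [] [] [] []) (16 * m₁.length + 9) := by
  have e₁ := runs_popTo (x := tb) (s := withTmp s [] [] [] [] [] [] []) (by simp) (by simp)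
    (by simp) h₂ (by simpa using hs)
  have e₂ := runs_popTo (x := ta) (s := withTmp (Function.update s vals (m₁ ++ eom :: rest))
    [] m₂ [] [] [] [] []) (rest := rest) (by simp) (by simp) (by simp) h₁ (by simp)
  have e₃ := runs_nandLoop h (Function.update s vals rest) [] [] [] [] []
  have e₄ := runs_push vals eom (withTmp (Function.update s vals rest)
    [] [] [] [] [] [] ((List.zipWith nandCell m₁ m₂).reverse ++ []))
  have e₅ := runs_transfer (k := tw) (x := vals) (by simp)
    (withTmp (Function.update s vals (eom :: rest))
      [] [] [] [] [] [] ((List.zipWith nandCell m₁ m₂).reverse ++ []))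
  simp only [update_vals, update_ta, update_tb, update_tw, withTmp_ta, withTmp_tb, withTmp_vals,
    Function.update_self, Function.update_idem, List.append_nil, withTmp_tw,
    List.reverse_reverse] at e₁ e₂ e₃ e₄ e₅
  refine (e₁.seq (e₂.seq (e₃.seq (e₄.seq e₅)))).mono ?_
  simp
  omega

/-- Compare a row with a row of a matrix. -/
def rowLoop : Prog (Name ι) (Cell β) :=
  loop tb isBit (seq (ite tc isOne (ite tb isOne (push tf (bit true)) skip) skip)
    (seq (mv tc [td]) (mv tb [te])))

/-- Two rows have a common entry `true`. -/
def rowMeet (r q : List Bool) : Bool := (List.zipWith and r q).any id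

/-- A mark is put on `tf` for each common entry `true`. Only whether `tf` is empty matters, so its
contents are left existential, with a bound on their length for the cost of clearing. Both rows are
kept, reversed, for reuse. -/
theorem runs_rowLoop {r q : List Bool} (h : r.length = q.length)
    (s : Name ι → List (Cell β)) (a b d e f w : List (Cell β)) :
    ∃ f', f'.length ≤ r.length + f.length ∧ (f' = [] ↔ f = [] ∧ rowMeet r q = false) ∧
      Runs rowLoop (withTmp s a (q.map bit ++ eor :: b) (r.map bit) d e f w)
        (withTmp s a (eor :: b) [] ((r.map bit).reverse ++ d) ((q.map bit).reverse ++ e) f' w)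
        (6 * r.length + 1) := by
  induction r generalizing q d e f with
  | nil =>
    obtain rfl := List.length_eq_zero_iff.1 h.symm
    exact ⟨f, by simp, by simp [rowMeet], runs_loop_false _ rfl⟩
  | cons x r ih =>
    cases q with
    | nil => simp at h
    | cons y q =>
      obtain ⟨f₁, hl, hf₁, hstep⟩ : ∃ f₁ : List (Cell β), f₁.length ≤ 1 + f.length ∧
          (f₁ = [] ↔ f = [] ∧ (x && y) = false) ∧
          Runs (ite tc isOne (ite tb isOne (push tf (bit true)) skip) skip)
          (withTmp s a ((y :: q).map bit ++ eor :: b) ((x :: r).map bit) d e f w)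
          (withTmp s a ((y :: q).map bit ++ eor :: b) ((x :: r).map bit) d e f₁ w) 3 := by
        cases x
        · exact ⟨f, by simp, by simp, (Runs.ite_false (by rfl) (runs_skip _)).mono (by omega)⟩
        · cases y
          · exact ⟨f, by simp, by simp, .ite_true (by rfl) (.ite_false (by rfl) (runs_skip _))⟩
          · exact ⟨bit true :: f, by simp [add_comm], by simp, .ite_true (by rfl) (.ite_true (by rfl)
              ((runs_push _ _ _).congr (by simp)))⟩
      obtain ⟨f₂, hl₂, hf₂, h₂⟩ := ih (q := q) (by simpa using h) (bit x :: d) (bit y :: e) f₁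
      refine ⟨f₂, by simp; omega, ?_, ?_⟩
      · rw [hf₂, hf₁, and_assoc]
        simp [rowMeet]
      · refine (Runs.loop_true (by rfl) (hstep.seq ((runs_mv _ _ _).seq (runs_mv _ _ _)))
          ?_).mono (T := _ + (6 * r.length + 1)) (by simp; omega)
        rw [rowLoop] at h₂
        simpa [move, pushAll] using h₂

/-- Compare a row with each row of a matrix. -/
def rowsLoop : Prog (Name ι) (Cell β) :=
  loop tb Option.isSome (seq rowLoop (seq (mv tb [te]) (seq
    (ite tf Option.isSome (push tw (bit true)) (push tw (bit false)))
    (seq (clear tf) (moveAll td [tc])))))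

/-- The row in `tc` is restored from `td` after each comparison, while the matrix accumulates in
`te` in reverse. -/
theorem runs_rowsLoop {r : List Bool} {S : List (List Bool)} (h : ∀ q ∈ S, r.length = q.length)
    (s : Name ι → List (Cell β)) (a e w : List (Cell β)) :
    Runs rowsLoop (withTmp s a (encRows S) (r.map bit) [] e [] w)
      (withTmp s a [] (r.map bit) [] ((encRows S).reverse ++ e) []
        (((S.map (rowMeet r)).map bit).reverse ++ w))
      (S.length * (10 * r.length + 7) + 1) := by
  induction S generalizing e w with
  | nil => exact (runs_loop_false _ rfl).mono (by simp)
  | cons q S ih =>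
    have hq := h q (by simp)
    obtain ⟨f', hl, hf', e₁⟩ := runs_rowLoop hq s a (encRows S) [] e [] w
    have e₂ := runs_mv tb [te] (withTmp s a (eor :: encRows S) [] ((r.map bit).reverse ++ [])
      ((q.map bit).reverse ++ e) f' w)
    have e₃ : Runs (ite tf Option.isSome (push tw (bit true)) (push tw (bit false)))
        (withTmp s a (encRows S) [] (r.map bit).reverse (eor :: ((q.map bit).reverse ++ e)) f' w)
        (withTmp s a (encRows S) [] (r.map bit).reverse (eor :: ((q.map bit).reverse ++ e)) f'
          (bit (rowMeet r q) :: w)) 2 := by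
      cases f' with
      | nil =>
        refine .ite_false (by rfl) ((runs_push _ _ _).congr ?_)
        simp [(hf'.1 rfl).2]
      | cons x f' =>
        have : rowMeet r q = true := by
          rw [← Bool.not_eq_false]
          intro hr
          have := hf'.2 ⟨rfl, hr⟩
          simp at this
        refine .ite_true (by rfl) ((runs_push _ _ _).congr ?_)
        simp [this]
    have e₄ := runs_clear tf (withTmp s a (encRows S) [] (r.map bit).reverse
      (eor :: ((q.map bit).reverse ++ e)) f' (bit (rowMeet r q) :: w))
    have e₅ := runs_transfer (k := td) (x := tc) (by simp) (withTmp s a (encRows S) []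
      (r.map bit).reverse (eor :: ((q.map bit).reverse ++ e)) [] (bit (rowMeet r q) :: w))
    have e₆ := ih (fun q hq => h q (by simp [hq])) (eor :: ((q.map bit).reverse ++ e))
      (bit (rowMeet r q) :: w)
    simp only [move, pushAll, update_tb, update_tc, update_td, update_te, update_tf, withTmp_tb, withTmp_tc, withTmp_td, withTmp_te, withTmp_tf, List.append_nil,
      List.reverse_reverse] at e₁ e₂ e₃ e₄ e₅ e₆
    refine ((Runs.loop_true (by simp [encRows]) ?_ e₆).congr ?_).mono
      (T := 10 * r.length + 6 + 1 + _) (by simp; ring_nf; omega)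
    · have hr : (withTmp s a (encRows (q :: S)) (r.map bit) [] e [] w : Name ι → List (Cell β)) =
          withTmp s a (q.map bit ++ eor :: encRows S) (r.map bit) [] e [] w := by
        simp [encRows]
      rw [hr]
      refine (e₁.seq (e₂.seq (e₃.seq (e₄.seq e₅)))).mono ?_
      simp at hl ⊢
      omega
    · simp [encRows]

/-- Compare each row of a matrix with each row of another matrix. -/
def meetLoop : Prog (Name ι) (Cell β) :=
  loop ta Option.isSome (seq (moveWhile ta isBit [td]) (seq (mv ta []) (seq (moveAll td [tc])
    (seq rowsLoop (seq (push tw eor) (seq (moveAll te [tb]) (clear tc)))))))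

theorem runs_meetLoop {n : ℕ} {R S : List (List Bool)} (hR : ∀ r ∈ R, r.length = n)
    (hS : ∀ q ∈ S, q.length = n) (s : Name ι → List (Cell β)) (w : List (Cell β)) :
    Runs meetLoop (withTmp s (encRows R) (encRows S) [] [] [] [] w)
      (withTmp s [] (encRows S) [] [] [] []
        ((encRows (R.map fun r => S.map (rowMeet r))).reverse ++ w))
      (R.length * (6 * n + S.length * (10 * n + 7) + 2 * (encRows (β := β) S).length + 8) + 1) := by
  induction R generalizing w with
  | nil => exact (runs_loop_false _ rfl).mono (by simp)
  | cons r R ih =>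
    have hr := hR r (by simp)
    have e₁ := runs_moveWhile (k := ta) (f := isBit) (ks := [td]) (by simp) (by simp)
      (l := r.map bit) (rest := eor :: encRows R)
      (s := withTmp s (encRows (r :: R)) (encRows S) [] [] [] [] w)
      (by simp [encRows]) (by
        intro c hc
        obtain ⟨b, _, rfl⟩ := List.mem_map.1 hc
        rfl) rfl
    have he₁ : (fun j => if j = ta then eor :: encRows R else if j ∈ [td] then
        (r.map bit).reverse ++ withTmp s (encRows (r :: R)) (encRows S) [] [] [] [] w j
        else withTmp s (encRows (r :: R)) (encRows S) [] [] [] [] w j) =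
        withTmp s (eor :: encRows R) (encRows S) [] (r.map bit).reverse [] [] w := by
      funext j
      cases j <;> simp
    rw [he₁] at e₁
    have e₂ := runs_mv ta [] (withTmp s (eor :: encRows R) (encRows S) [] (r.map bit).reverse
      [] [] w)
    have e₃ := runs_transfer (k := td) (x := tc) (by simp) (withTmp s (encRows R) (encRows S) []
      (r.map bit).reverse [] [] w)
    have e₄ := runs_rowsLoop (r := r) (S := S) (fun q hq => hr.trans (hS q hq).symm) s (encRows R)
      [] w
    have e₅ := runs_push tw eor (withTmp s (encRows R) [] (r.map bit) [] ((encRows S).reverse ++ [])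
      [] (((S.map (rowMeet r)).map bit).reverse ++ w))
    have e₆ := runs_transfer (k := te) (x := tb) (by simp) (withTmp s (encRows R) []
      (r.map bit) [] ((encRows S).reverse ++ []) []
      (eor :: (((S.map (rowMeet r)).map bit).reverse ++ w)))
    have e₇ := runs_clear tc (withTmp s (encRows R) (encRows S)
      (r.map bit) [] [] [] (eor :: (((S.map (rowMeet r)).map bit).reverse ++ w)))
    have e₈ := ih (fun q hq => hR q (by simp [hq]))
      (eor :: (((S.map (rowMeet r)).map bit).reverse ++ w))
    simp only [move, pushAll, update_ta, update_tb, update_tc, update_td, update_te,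
      update_tw, withTmp_ta, withTmp_tb, withTmp_tc, withTmp_td, withTmp_te,
      withTmp_tw, List.append_nil, List.reverse_reverse] at e₁ e₂ e₃ e₄ e₅ e₆ e₇ e₈
    refine ((Runs.loop_true (by simp [encRows])
      (e₁.seq (e₂.seq (e₃.seq (e₄.seq (e₅.seq (e₆.seq e₇)))))) e₈).congr ?_).mono ?_
    · simp [encRows]
    · simp only [List.length_map, List.length_reverse, List.length_cons, hr]
      ring_nf
      omega

/-- Replace the two topmost matrices by the matrix that tells which row of the one meets which
row of the other. -/
def meetVals : Prog (Name ι) (Cell β) :=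
  seq (popTo tb) (seq (popTo ta) (seq meetLoop (seq (clear tb)
    (seq (push vals eom) (moveAll tw [vals])))))

theorem length_encRows {n : ℕ} {R : List (List Bool)} (hR : ∀ r ∈ R, r.length = n) :
    (encRows (β := β) R).length = R.length * (n + 1) := by
  induction R with
  | nil => simp [encRows]
  | cons r R ih =>
    have := ih fun q hq => hR q (by simp [hq])
    simp only [encRows, List.flatMap_cons, List.length_append, List.length_map, List.length_cons,
      List.length_nil, hR r (by simp)] at this ⊢
    rw [this]
    ring

/-- There are `n * n` pairs of rows, and each comparison is linear in `n`. Working with rows of both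
matrices, that is, composing with a converse, avoids any access to columns. -/
theorem runs_meetVals {n : ℕ} {R S : List (List Bool)} (hRl : R.length = n) (hSl : S.length = n)
    (hR : ∀ r ∈ R, r.length = n) (hS : ∀ q ∈ S, q.length = n) {rest : List (Cell β)}
    {s : Name ι → List (Cell β)} (hs : s vals = encRows S ++ eom :: (encRows R ++ eom :: rest)) :
    Runs meetVals (withTmp s [] [] [] [] [] [] [])
      (withTmp (Function.update s vals (encRows (R.map fun r => S.map (rowMeet r)) ++ eom :: rest))
        [] [] [] [] [] [] []) (60 * (n + 1) ^ 3) := by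
  have e₁ := runs_popTo (x := tb) (s := withTmp s [] [] [] [] [] [] []) (by simp) (by simp)
    (by simp) (fun c => notEom_of_mem_encRows) (by simpa using hs)
  have e₂ := runs_popTo (x := ta)
    (s := withTmp (Function.update s vals (encRows R ++ eom :: rest))
    [] (encRows S) [] [] [] [] []) (rest := rest) (by simp) (by simp) (by simp)
    (fun c => notEom_of_mem_encRows (R := R)) (by simp)
  have e₃ := runs_meetLoop hR hS (Function.update s vals rest) []
  have e₀ := runs_clear tb (withTmp (Function.update s vals rest) [] (encRows S) [] [] [] []
    ((encRows (R.map fun r => S.map (rowMeet r))).reverse ++ []))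
  have e₄ := runs_push vals eom (withTmp (Function.update s vals rest)
    [] [] [] [] [] [] ((encRows (R.map fun r => S.map (rowMeet r))).reverse ++ []))
  have e₅ := runs_transfer (k := tw) (x := vals) (by simp)
    (withTmp (Function.update s vals (eom :: rest))
      [] [] [] [] [] [] ((encRows (R.map fun r => S.map (rowMeet r))).reverse ++ []))
  simp only [update_vals, update_ta, update_tb, update_tw, withTmp_ta, withTmp_tb, withTmp_vals,
    Function.update_self, Function.update_idem, List.append_nil, withTmp_tw,
    List.reverse_reverse] at e₁ e₂ e₃ e₀ e₄ e₅
  refine (e₁.seq (e₂.seq (e₃.seq (e₀.seq (e₄.seq e₅))))).mono ?_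
  have hl : ∀ r ∈ R.map (fun r => S.map (rowMeet r)), r.length = n := by
    simp [hSl]
  rw [List.length_reverse, length_encRows hR, length_encRows hS, length_encRows hl,
    List.length_map, hRl, hSl]
  ring_nf
  nlinarith [Nat.zero_le n, Nat.zero_le (n ^ 2), Nat.zero_le (n ^ 3)]

/-- Keep the symbols `true` of the stack `ta` in the stack `tf`. -/
def scanLoop : Prog (Name ι) (Cell β) :=
  loop ta Option.isSome (ite ta isOne (mv ta [tf]) (mv ta []))

theorem runs_scanLoop (l : List (Cell β)) (s : Name ι → List (Cell β))
    (b c d e f w : List (Cell β)) :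
    Runs scanLoop (withTmp s l b c d e f w)
      (withTmp s [] b c d e ((l.filter fun c => isOne (some c)).reverse ++ f) w)
      (3 * l.length + 1) := by
  induction l generalizing f with
  | nil => exact runs_loop_false _ rfl
  | cons x l ih =>
    refine (Runs.loop_true (T₁ := 2) (by simp)
      (s₂ := withTmp s l b c d e ([x].filter (fun c => isOne (some c)) ++ f) w) ?_
      (ih _) |>.congr ?_).mono (by simp; omega)
    · by_cases hx : isOne (some x) = true
      · exact .ite_true (by simpa using hx) ((runs_mv _ _ _).congr (by simp [move, pushAll, hx]))
      · exact .ite_false (by simpa using hx) ((runs_mv _ _ _).congr (by simp [move, pushAll, hx]))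
    · by_cases hx : isOne (some x) = true <;> simp [hx]

end Prog

end HM

/-! ### Relational expressions and commands on matrices -/

namespace HM

open Prog Name Cell

/-! ### Square matrices of truth values -/

/-- Relations on `n` points. -/
abbrev Mat (n : ℕ) : Type := Fin n → Fin n → Prop

namespace Mat

variable {n : ℕ} {β : Type}

open Classical in
/-- The rows of a matrix. -/
noncomputable def rows (M : Mat n) : List (List Bool) :=
  List.ofFn fun x => List.ofFn fun z => decide (M x z)

/-- The code of a matrix. -/
noncomputable def enc (M : Mat n) : List (Cell β) := encRows M.rows

theorem length_rows (M : Mat n) : M.rows.length = n := by simp [rows]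

theorem length_of_mem_rows (M : Mat n) : ∀ r ∈ M.rows, r.length = n := by
  intro r hr
  obtain ⟨x, rfl⟩ := List.mem_ofFn.1 hr
  simp

theorem length_enc (M : Mat n) : (M.enc (β := β)).length = n * (n + 1) := by
  rw [enc, length_encRows M.length_of_mem_rows, length_rows]

theorem notEom_of_mem_enc (M : Mat n) : ∀ c ∈ M.enc (β := β), notEom (some c) = true :=
  fun _ => notEom_of_mem_encRows

theorem zipWith_nandCell_encRows {R S : List (List Bool)} (hl : R.length = S.length) {m : ℕ}
    (hR : ∀ r ∈ R, r.length = m) (hS : ∀ r ∈ S, r.length = m) :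
    List.zipWith nandCell (encRows R : List (Cell β)) (encRows S) =
      encRows (List.zipWith (List.zipWith fun a b => !(a && b)) R S) := by
  induction R generalizing S with
  | nil => rfl
  | cons r R ih =>
    cases S with
    | nil => simp at hl
    | cons q S =>
      have h := ih (by simpa using hl) (fun r hr => hR r (by simp [hr]))
        (fun r hr => hS r (by simp [hr]))
      simp only [encRows, List.flatMap_cons, List.zipWith_cons_cons] at h ⊢
      have h₁ : r.length = q.length := (hR r (by simp)).trans (hS q (by simp)).symm
      rw [List.zipWith_append (by simpa using h₁), h, List.zipWith_append (by simpa using h₁),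
        List.zipWith_map, List.map_zipWith]
      congr 2
      congr 1
      funext a b
      cases a <;> cases b <;> rfl

theorem zipWith_nandCell_enc (M N : Mat n) : List.zipWith nandCell (M.enc (β := β)) N.enc =
    enc fun x z => ¬(M x z ∧ N x z) := by
  rw [enc, enc, zipWith_nandCell_encRows (by simp [length_rows]) M.length_of_mem_rows
    N.length_of_mem_rows, enc]
  congr 1
  refine List.ext_getElem (by simp [rows]) fun i h₁ h₂ => ?_
  refine List.ext_getElem (by simp [rows]) fun j h₃ h₄ => ?_
  rw [Bool.eq_iff_iff]
  simp [rows, imp_iff_not_or]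

theorem map_rowMeet_rows (M N : Mat n) : (M.rows.map fun r => N.rows.map (rowMeet r)) =
    rows fun x y => ∃ z, M x z ∧ N y z := by
  refine List.ext_getElem (by simp [rows]) fun i h₁ h₂ => ?_
  refine List.ext_getElem (by simp [rows]) fun j h₃ h₄ => ?_
  simp only [rows, List.map_ofFn, List.getElem_ofFn, Function.comp_apply, rowMeet]
  rw [Bool.eq_iff_iff]
  simp only [List.any_eq_true, decide_eq_true_eq, id_eq, exists_eq_right]
  constructor
  · intro h
    obtain ⟨i, hi, h⟩ := List.mem_iff_getElem.1 h
    simp only [List.getElem_zipWith, List.getElem_ofFn, Bool.and_eq_true, decide_eq_true_eq] at h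
    exact ⟨_, h⟩
  · rintro ⟨z, h⟩
    refine List.mem_iff_getElem.2 ⟨z, by simp, ?_⟩
    simpa using h

theorem filter_enc_eq_nil (M : Mat n) :
    (M.enc (β := β)).filter (fun c => isOne (some c)) = [] ↔ ∀ x z, ¬M x z := by
  rw [List.filter_eq_nil_iff]
  constructor
  · intro h x z hM
    refine h (bit true) ?_ rfl
    simp only [enc, encRows, rows, List.mem_flatMap]
    refine ⟨_, List.mem_ofFn.2 ⟨x, rfl⟩, ?_⟩
    simp only [List.mem_append, List.mem_map]
    exact .inl ⟨true, List.mem_ofFn.2 ⟨z, by simpa using hM⟩, rfl⟩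
  · intro h c hc
    simp only [enc, encRows, rows, List.mem_flatMap] at hc
    obtain ⟨r, hr, hc⟩ := hc
    obtain ⟨x, rfl⟩ := List.mem_ofFn.1 hr
    simp only [List.mem_append, List.mem_map, List.mem_singleton] at hc
    obtain ⟨b, hb, rfl⟩ | rfl := hc
    · obtain ⟨z, rfl⟩ := List.mem_ofFn.1 hb
      simp [h x z, isOne]
    · simp [isOne]

/-- The relation `y = x + 1`. -/
def suc (n : ℕ) : Mat n := fun x y => (y : ℕ) = x + 1

/-- The matrix whose only entry is `(i, 0)`. -/
def pt (n i : ℕ) : Mat n := fun x y => (x : ℕ) = i ∧ (y : ℕ) = 0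

end Mat

/-! ### Programs over matrices -/

/-- The registers for matrices: constants, a counter, and variables. -/
inductive Reg (κ : Type) : Type
  | one : Reg κ
  | suc : Reg κ
  | cnt : Reg κ
  | usr : κ → Reg κ
  deriving DecidableEq, Fintype

/-- Expressions for matrices. -/
inductive MExp (κ : Type) : Type
  | reg : Reg κ → MExp κ
  | nand : MExp κ → MExp κ → MExp κ
  | meet : MExp κ → MExp κ → MExp κ

variable {κ β : Type} {n : ℕ}

/-- The contents of the registers. -/
def regVal (C : Mat n) (ρ : κ → Mat n) : Reg κ → Mat n
  | .one => fun x y => x = y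
  | .suc => Mat.suc n
  | .cnt => C
  | .usr k => ρ k

/-- The code of a list of matrices. -/
noncomputable def encMats (V : List (Mat n)) : List (Cell β) := V.flatMap fun M => M.enc ++ [eom]

/-- The stacks that represent given matrices. -/
noncomputable def matStacks (C : Mat n) (ρ : κ → Mat n) (V : List (Mat n))
    (x y z : List (Cell β)) : Name (Reg κ) → List (Cell β)
  | .reg k => (regVal C ρ k).enc
  | vals => encMats V
  | inp => x
  | inp' => y
  | num => z
  | _ => []

theorem withTmp_matStacks (C : Mat n) (ρ : κ → Mat n) (V : List (Mat n))
    (x y z : List (Cell β)) : withTmp (matStacks C ρ V x y z) [] [] [] [] [] [] [] =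
    matStacks C ρ V x y z :=
  withTmp_self _ (by simp [matStacks])

variable [DecidableEq κ]

namespace MExp

/-- The value of an expression. -/
def eval (C : Mat n) (ρ : κ → Mat n) : MExp κ → Mat n
  | reg k => regVal C ρ k
  | nand e f => fun x z => ¬(eval C ρ e x z ∧ eval C ρ f x z)
  | meet e f => fun x y => ∃ z, eval C ρ e x z ∧ eval C ρ f y z

/-- The program that computes the value of an expression. -/
def prog : MExp κ → Prog (Name (Reg κ)) (Cell β)
  | reg k => seq (push vals eom) (copy (Name.reg k) tw vals)
  | nand e f => seq (prog e) (seq (prog f) nandVals)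
  | meet e f => seq (prog e) (seq (prog f) meetVals)

/-- The number of operations of an expression. -/
def ops : MExp κ → ℕ
  | reg _ => 1
  | nand e f => ops e + ops f + 1
  | meet e f => ops e + ops f + 1

variable {C : Mat n} {ρ : κ → Mat n} {V : List (Mat n)} {x y z : List (Cell β)}

theorem update_vals_matStacks (M : Mat n) (V' : List (Mat n)) :
    Function.update (matStacks C ρ V x y z) vals (M.enc ++ eom :: encMats V') =
      matStacks C ρ (M :: V') x y z := by
  funext k
  cases k <;> simp [matStacks, encMats]

theorem update_cnt_matStacks (M : Mat n) :
    Function.update (matStacks C ρ V x y z) (Name.reg .cnt) M.enc = matStacks M ρ V x y z := by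
  funext k
  rcases k with (_ | _ | _ | k) | _ | _ | _ | _ <;> simp [matStacks, regVal]

theorem update_usr_matStacks (k : κ) (M : Mat n) :
    Function.update (matStacks C ρ V x y z) (Name.reg (.usr k)) M.enc =
      matStacks C (Function.update ρ k M) V x y z := by
  funext j
  rcases j with (_ | _ | _ | j) | _ | _ | _ | _ <;> simp [matStacks, regVal]
  by_cases h : j = k
  · subst h
    simp
  · simp [h, matStacks, regVal]

theorem runs_prog (e : MExp κ) (V : List (Mat n)) :
    Runs e.prog (matStacks C ρ V x y z) (matStacks C ρ (e.eval C ρ :: V) x y z)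
      (e.ops * (60 * (n + 1) ^ 3)) := by
  have hn : n ≤ n ^ 3 := Nat.le_self_pow (by norm_num) n
  have hn₂ : n * n ≤ n ^ 3 + n := by nlinarith [Nat.zero_le (n * n), sq_nonneg ((n : ℤ) - 1)]
  induction e generalizing V with
  | reg k =>
    refine (((runs_push _ _ _).seq (runs_copy (by simp) (by simp) (by simp)
      (by simp [matStacks]))).congr ?_).mono (by
        simp only [ops, matStacks, ne_eq, reduceCtorEq, not_false_eq_true,
          Function.update_of_ne, Mat.length_enc]
        nlinarith)
    rw [Function.update_idem, ← update_vals_matStacks (V := V)]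
    congr 1
  | nand e f ihe ihf =>
    have h := runs_nandVals (s := matStacks C ρ (f.eval C ρ :: e.eval C ρ :: V) x y z)
      (by simp [Mat.length_enc])
      (e.eval C ρ).notEom_of_mem_enc (f.eval C ρ).notEom_of_mem_enc (rest := encMats V)
      (by simp [matStacks, encMats])
    rw [withTmp_matStacks, Mat.zipWith_nandCell_enc, update_vals_matStacks, withTmp_matStacks] at h
    refine ((ihe V).seq ((ihf _).seq h)).mono ?_
    rw [Mat.length_enc, ops]
    nlinarith
  | meet e f ihe ihf =>
    have h := runs_meetVals (s := matStacks C ρ (f.eval C ρ :: e.eval C ρ :: V) x y z)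
      (e.eval C ρ).length_rows (f.eval C ρ).length_rows
      (e.eval C ρ).length_of_mem_rows (f.eval C ρ).length_of_mem_rows (rest := encMats V)
      (by simp [matStacks, encMats, Mat.enc])
    rw [withTmp_matStacks, Mat.map_rowMeet_rows, ← Mat.enc, update_vals_matStacks,
      withTmp_matStacks] at h
    refine ((ihe V).seq ((ihf _).seq h)).mono ?_
    rw [ops]
    nlinarith

end MExp

end HM

namespace HM

open Prog Name Cell

variable {κ β : Type} {n : ℕ}

namespace MExp

/-- The matrix with entries `true`. -/
def top : MExp κ := nand (reg .one) (reg .suc)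

/-- The complement. -/
def not (e : MExp κ) : MExp κ := nand e e

/-- The intersection. -/
def conj (e f : MExp κ) : MExp κ := not (nand e f)

/-- The union. -/
def disj (e f : MExp κ) : MExp κ := nand (not e) (not f)

/-- The converse. -/
def tr (e : MExp κ) : MExp κ := meet (reg .one) e

/-- The composition. -/
def comp (e f : MExp κ) : MExp κ := meet e (tr f)

/-- The variable `k`. -/
def var (k : κ) : MExp κ := reg (.usr k)

/-- The matrix whose only entry is `(0, 0)`. -/
def zero : MExp κ := conj (reg .one) (not (meet (tr (reg .suc)) top))

/-- The rows of a matrix, shifted downwards. -/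
def shift (e : MExp κ) : MExp κ := comp (tr (reg .suc)) e

variable (C : Mat n) (ρ : κ → Mat n) (e f : MExp κ) (x y : Fin n)

@[simp] theorem eval_reg (k : Reg κ) : (reg k).eval C ρ x y ↔ regVal C ρ k x y := .rfl

@[simp] theorem eval_var (k : κ) : (var k).eval C ρ x y ↔ ρ k x y := .rfl

@[simp] theorem eval_meet : (meet e f).eval C ρ x y ↔ ∃ z, e.eval C ρ x z ∧ f.eval C ρ y z := .rfl

@[simp] theorem eval_top : (top : MExp κ).eval C ρ x y := by
  rintro ⟨rfl, h : (x : ℕ) = x + 1⟩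
  omega

@[simp] theorem eval_not : (not e).eval C ρ x y ↔ ¬e.eval C ρ x y := by
  simp [not, eval]

@[simp] theorem eval_conj : (conj e f).eval C ρ x y ↔ e.eval C ρ x y ∧ f.eval C ρ x y := by
  simp [conj, eval, not]

@[simp] theorem eval_disj : (disj e f).eval C ρ x y ↔ e.eval C ρ x y ∨ f.eval C ρ x y := by
  simp only [disj, eval, not]
  tauto

@[simp] theorem eval_tr : (tr e).eval C ρ x y ↔ e.eval C ρ y x := by
  simp [tr, regVal]

@[simp] theorem eval_comp : (comp e f).eval C ρ x y ↔
    ∃ z, e.eval C ρ x z ∧ f.eval C ρ z y := by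
  simp [comp]

/-- The point `0` is the only one without a predecessor. -/
theorem eval_zero : (zero : MExp κ).eval C ρ = Mat.pt n 0 := by
  funext x y
  simp only [zero, eval_conj, eval_reg, regVal, eval_not, eval_meet, eval_tr, eval_top, and_true,
    not_exists, Mat.suc, Mat.pt, eq_iff_iff]
  constructor
  · rintro ⟨rfl, h⟩
    have : (x : ℕ) = 0 := by
      by_contra hx
      exact h ⟨x - 1, by omega⟩ (by simp; omega)
    exact ⟨this, this⟩
  · rintro ⟨hx, hy⟩
    exact ⟨Fin.ext (by omega), fun z => by omega⟩

theorem eval_shift : (shift e).eval C ρ x y ↔ ∃ z : Fin n, (x : ℕ) = z + 1 ∧ e.eval C ρ z y := by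
  simp [shift, regVal, Mat.suc]

/-- For `i + 1 = n` the result is the empty matrix, which is how the end of a repetition is
recognized. -/
theorem eval_shift_cnt (i : ℕ) (ρ : κ → Mat n) :
    (shift (reg .cnt) : MExp κ).eval (Mat.pt n i) ρ = Mat.pt n (i + 1) := by
  funext x y
  simp only [eval_shift, eval_reg, regVal, Mat.pt, eq_iff_iff]
  constructor
  · rintro ⟨z, h₁, h₂, h₃⟩
    exact ⟨by omega, h₃⟩
  · rintro ⟨h₁, h₂⟩
    exact ⟨⟨i, by omega⟩, h₁, rfl, h₂⟩

end MExp

/-! ### Commands -/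

/-- Sequences of assignments. -/
abbrev Blk (κ : Type) : Type := List (κ × MExp κ)

section

variable [DecidableEq κ]

/-- The effect of a sequence of assignments. -/
def Blk.den (C : Mat n) : Blk κ → (κ → Mat n) → κ → Mat n
  | [], ρ => ρ
  | (k, e) :: l, ρ => Blk.den C l (Function.update ρ k (e.eval C ρ))

/-- Commands: assignments, repetitions, where the counter runs through the points, and sequential
composition. -/
inductive Com (κ : Type) : Type
  | blk : Blk κ → Com κ
  | rep : Blk κ → Com κ
  | seq : Com κ → Com κ → Com κ

/-- The contents of the registers after a number of repetitions. -/
def Blk.iter (l : Blk κ) (ρ : κ → Mat n) : ℕ → κ → Mat n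
  | 0 => ρ
  | i + 1 => l.den (Mat.pt n i) (Blk.iter l ρ i)

/-- The effect of a command. -/
def Com.den : Com κ → Mat n × (κ → Mat n) → Mat n × (κ → Mat n)
  | blk l, σ => (σ.1, l.den σ.1 σ.2)
  | rep l, σ => (Mat.pt n n, l.iter σ.2 n)
  | seq c d, σ => d.den (c.den σ)

/-- Assign the value of an expression to a register. -/
def assign (k : Reg κ) (e : MExp κ) : Prog (Name (Reg κ)) (Cell β) :=
  seq e.prog (seq (clear (reg k)) (popTo (reg k)))

variable {C : Mat n} {ρ : κ → Mat n} {V : List (Mat n)} {x y z : List (Cell β)}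

theorem runs_popReg (k : Reg κ) (M : Mat n) :
    Runs (seq (clear (reg k)) (popTo (reg k))) (matStacks C ρ (M :: V) x y z)
      (Function.update (matStacks C ρ V x y z) (Name.reg k) M.enc) (60 * (n + 1) ^ 3) := by
  refine (((runs_clear _ _).seq (runs_popTo (rest := encMats V) (m := M.enc) (by simp) (by simp)
    (by simp [matStacks]) M.notEom_of_mem_enc (by simp [matStacks, encMats]))).congr ?_).mono ?_
  · funext j
    rcases j with j | _ | _ | _
    · by_cases h : j = k
      · subst h
        simp
      · simp [h, matStacks]
    all_goals simp [matStacks]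
  · simp only [matStacks, Mat.length_enc]
    nlinarith [Nat.zero_le (n ^ 2), Nat.zero_le (n ^ 3)]

theorem runs_assign_usr (k : κ) (e : MExp κ) :
    Runs (assign (.usr k) e) (matStacks C ρ V x y z)
      (matStacks C (Function.update ρ k (e.eval C ρ)) V x y z) ((e.ops + 1) * (60 * (n + 1) ^ 3)) :=
  (((e.runs_prog V).seq (runs_popReg _ _)).congr (MExp.update_usr_matStacks _ _)).mono
    (by rw [add_one_mul])

theorem runs_assign_cnt (e : MExp κ) :
    Runs (assign .cnt e) (matStacks C ρ V x y z)
      (matStacks (e.eval C ρ) ρ V x y z) ((e.ops + 1) * (60 * (n + 1) ^ 3)) :=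
  (((e.runs_prog V).seq (runs_popReg _ _)).congr (MExp.update_cnt_matStacks _)).mono
    (by rw [add_one_mul])

/-- The program of a sequence of assignments. -/
def Blk.prog : Blk κ → Prog (Name (Reg κ)) (Cell β)
  | [] => skip
  | (k, e) :: l => seq (assign (.usr k) e) (Blk.prog l)

/-- The number of operations of a sequence of assignments. -/
def Blk.ops : Blk κ → ℕ
  | [] => 1
  | (_, e) :: l => e.ops + 1 + Blk.ops l

theorem Blk.runs_prog (l : Blk κ) (ρ : κ → Mat n) :
    Runs l.prog (matStacks C ρ V x y z) (matStacks C (l.den C ρ) V x y z)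
      (l.ops * (60 * (n + 1) ^ 3)) := by
  induction l generalizing ρ with
  | nil =>
    refine (runs_skip _).mono ?_
    have := Nat.pow_pos (n := 3) (show 0 < n + 1 by omega)
    simp only [Blk.ops]
    omega
  | cons a l ih => exact ((runs_assign_usr _ _).seq (ih _)).mono (by rw [Blk.ops, ← add_mul])

/-- Push onto the stack `tf` the symbols `true` in the counter. -/
def testCnt : Prog (Name (Reg κ)) (Cell β) := seq (copy (Name.reg .cnt) tw ta) scanLoop

theorem runs_testCnt : Runs testCnt (matStacks C ρ V x y z)
    (withTmp (matStacks C ρ V x y z) [] [] [] [] []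
      ((C.enc.filter fun c => isOne (some c)).reverse) []) (60 * (n + 1) ^ 3) := by
  have h := runs_scanLoop C.enc (matStacks C ρ V x y z) [] [] [] [] [] []
  have h' := runs_copy (k := Name.reg .cnt) (w := tw) (x := ta) (by simp) (by simp) (by simp)
    (s := withTmp (matStacks C ρ V x y z) [] [] [] [] [] [] []) (by simp)
  rw [update_ta] at h'
  simp only [withTmp_reg, withTmp_ta, List.append_nil, withTmp_matStacks] at h'
  rw [List.append_nil] at h
  refine (h'.seq h).mono ?_
  simp only [matStacks, regVal, Mat.length_enc]
  nlinarith [Nat.zero_le (n ^ 2), Nat.zero_le (n ^ 3)]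

/-- Repeat a sequence of assignments while the counter runs through the points. -/
def Blk.repProg (l : Blk κ) : Prog (Name (Reg κ)) (Cell β) :=
  seq (assign .cnt .zero) (seq testCnt (loop tf Option.isSome
    (seq (clear tf) (seq l.prog (seq (assign .cnt (.shift (.reg .cnt))) testCnt)))))

theorem Blk.runs_repProg (l : Blk κ) (ρ : κ → Mat n) :
    Runs l.repProg (matStacks C ρ V x y z) (matStacks (Mat.pt n n) (l.iter ρ n) V x y z)
      ((l.ops + 40) * (60 * (n + 1) ^ 4)) := by
  set u := 60 * (n + 1) ^ 3 with hu
  -- The state at the loop test after `i` rounds: `tf` holds the ones of the counter, of which there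
  -- are none exactly when `i = n`.
  let S (i : ℕ) := withTmp (matStacks (Mat.pt n i) (l.iter ρ i) V x y z) [] [] [] [] []
      (((Mat.pt n i).enc.filter fun c => isOne (some c)).reverse) []
  have hn : n ≤ n ^ 3 := Nat.le_self_pow (by norm_num) n
  have hloop : ∀ m i, i + m = n → Runs (loop tf Option.isSome
      (seq (clear tf) (seq l.prog (seq (assign .cnt (.shift (.reg .cnt))) testCnt)))) (S i) (S n)
      (m * ((l.ops + 10) * u) + 1) := by
    intro m
    induction m with
    | zero =>
      rintro i rfl
      refine (runs_loop_false _ ?_).mono (by omega)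
      have : ((Mat.pt i i).enc (β := β)).filter (fun c => isOne (some c)) = [] :=
        (Mat.filter_enc_eq_nil _).2 fun x z h => absurd h.1 (by omega)
      simp [S, this]
    | succ m ih =>
      intro i hi
      have h₀ : (((Mat.pt n i).enc (β := β)).filter fun c => isOne (some c)).length
          ≤ n * (n + 1) := (List.length_filter_le _ _).trans_eq (Mat.length_enc _)
      have e₁ : Runs (clear tf) (S i) (matStacks (Mat.pt n i) (l.iter ρ i) V x y z)
          (2 * (n * (n + 1)) + 1) := by
        refine ((runs_clear tf (S i)).congr ?_).mono ?_
        · rw [update_tf, withTmp_matStacks]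
        · simp only [S, withTmp_tf, List.length_reverse]
          omega
      have e₃ := runs_assign_cnt (C := Mat.pt n i) (ρ := l.iter ρ (i + 1)) (V := V) (x := x)
        (y := y) (z := z) (.shift (.reg .cnt))
      rw [MExp.eval_shift_cnt] at e₃
      have e₄ : Runs testCnt (matStacks (Mat.pt n (i + 1)) (l.iter ρ (i + 1)) V x y z) (S (i + 1))
        u := runs_testCnt
      refine (Runs.loop_true ?_ (e₁.seq ((l.runs_prog _).seq (e₃.seq e₄)))
        (ih (i + 1) (by omega))).mono ?_
      · have : ((Mat.pt n i).enc (β := β)).filter (fun c => isOne (some c)) ≠ [] := fun h =>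
          (Mat.filter_enc_eq_nil _).1 h ⟨i, by omega⟩ ⟨0, by omega⟩ ⟨rfl, rfl⟩
        have : (((Mat.pt n i).enc (β := β)).filter (fun c => isOne (some c))).reverse ≠ [] := by
          simpa using this
        obtain ⟨a, l', h⟩ := List.exists_cons_of_ne_nil this
        simp [S, h]
      · have : MExp.ops (.shift (.reg .cnt) : MExp κ) = 7 := rfl
        rw [this, ← hu]
        nlinarith
  have e₁ := runs_assign_cnt (C := C) (ρ := ρ) (V := V) (x := x) (y := y) (z := z) .zero
  rw [MExp.eval_zero] at e₁
  have e₂ : Runs testCnt (matStacks (Mat.pt n 0) (l.iter ρ 0) V x y z) (S 0) u := runs_testCnt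
  have hS : S n = matStacks (Mat.pt n n) (l.iter ρ n) V x y z := by
    have : ((Mat.pt n n).enc (β := β)).filter (fun c => isOne (some c)) = [] :=
      (Mat.filter_enc_eq_nil _).2 fun x z h => absurd h.1 (by omega)
    simp only [S, this, List.reverse_nil, withTmp_matStacks]
  refine ((e₁.seq (e₂.seq (hloop n 0 (zero_add n)))).congr hS).mono ?_
  have : MExp.ops (.zero : MExp κ) = 35 := rfl
  rw [this, ← hu]
  have : 60 * (n + 1) ^ 4 = (n + 1) * u := by rw [hu]; ring
  rw [this]
  nlinarith

end

end HM

/-! ### Initialization of the matrices -/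

namespace HM

open Prog Name Cell

variable {κ β : Type} {n : ℕ}

/-! ### Construction of the constants -/

/-- Stacks without temporary contents. -/
def rawStacks {γ : Type} (g : Reg κ → List γ) (v x y z : List γ) : Name (Reg κ) → List γ
  | .reg k => g k
  | vals => v
  | inp => x
  | inp' => y
  | num => z
  | _ => []

theorem matStacks_eq_rawStacks (C : Mat n) (ρ : κ → Mat n) (V : List (Mat n))
    (x y z : List (Cell β)) : matStacks C ρ V x y z =
      withTmp (rawStacks (fun k => (regVal C ρ k).enc) (encMats V) x y z) [] [] [] [] [] [] [] := by
  funext k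
  cases k <;> rfl

section

variable {γ : Type} (g : Reg κ → List γ) (v x y z : List γ)

@[simp] theorem rawStacks_reg (k : Reg κ) : rawStacks g v x y z (.reg k) = g k := rfl
@[simp] theorem rawStacks_vals : rawStacks g v x y z vals = v := rfl
@[simp] theorem rawStacks_inp : rawStacks g v x y z inp = x := rfl
@[simp] theorem rawStacks_inp' : rawStacks g v x y z inp' = y := rfl
@[simp] theorem rawStacks_num : rawStacks g v x y z num = z := rfl

variable [DecidableEq κ] (a b c d e f w l : List γ)

@[simp] theorem update_reg_rawStacks (k : Reg κ) :
    Function.update (rawStacks g v x y z) (.reg k) l = rawStacks (Function.update g k l) v x y z := by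
  funext j
  cases j <;> simp [rawStacks, Function.update_apply]

@[simp] theorem update_vals_rawStacks :
    Function.update (rawStacks g v x y z) vals l = rawStacks g l x y z := by
  funext j
  cases j <;> simp [rawStacks]

@[simp] theorem update_inp :
    Function.update (withTmp (rawStacks g v x y z) a b c d e f w) inp l =
      withTmp (rawStacks g v l y z) a b c d e f w := by
  funext j
  cases j <;> simp

@[simp] theorem update_inp' :
    Function.update (withTmp (rawStacks g v x y z) a b c d e f w) inp' l =
      withTmp (rawStacks g v x l z) a b c d e f w := by
  funext j
  cases j <;> simp

@[simp] theorem update_num :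
    Function.update (withTmp (rawStacks g v x y z) a b c d e f w) num l =
      withTmp (rawStacks g v x y l) a b c d e f w := by
  funext j
  cases j <;> simp

end

/-- A number in unary. -/
def una (n : ℕ) : List (Cell β) := List.replicate n (bit false)

@[simp] theorem length_una : (una n : List (Cell β)).length = n := List.length_replicate

@[simp] theorem reverse_una : (una n : List (Cell β)).reverse = una n := List.reverse_replicate

theorem una_succ : (una (n + 1) : List (Cell β)) = bit false :: una n := rfl

theorem una_append (m : ℕ) : (una m ++ una n : List (Cell β)) = una (m + n) :=
  List.replicate_append_replicate

/-- The row with the only entry `true` at position `i`. -/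
def unitRow (n i : ℕ) : List Bool := List.replicate i false ++ true :: List.replicate (n - 1 - i) false

theorem getElem_unitRow {i j : ℕ} (h : j < (unitRow n i).length) :
    (unitRow n i)[j] = decide (i = j) := by
  simp only [unitRow, List.getElem_append, List.length_replicate, List.getElem_cons]
  split_ifs with h₁ h₂
  · simp; omega
  · simp; omega
  · simp; omega

theorem length_unitRow {i : ℕ} (h : i < n) : (unitRow n i).length = n := by
  simp [unitRow]
  omega

theorem Mat.getElem_rows (M : Mat n) {i j : ℕ} (h : i < M.rows.length)
    (h' : j < M.rows[i].length) : M.rows[i][j] = true ↔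
      M ⟨i, by simpa [rows] using h⟩ ⟨j, by simpa [rows] using h'⟩ := by
  simp [rows]

theorem rows_one : Mat.rows (fun x y : Fin n => x = y) = (List.range n).map (unitRow n) := by
  refine List.ext_getElem (by simp [Mat.rows]) fun i h₁ h₂ => ?_
  have hi : i < n := by simpa using h₂
  refine List.ext_getElem (by simp [Mat.rows, length_unitRow hi]) fun j h₃ h₄ => ?_
  simp [Mat.rows, getElem_unitRow]

/-- Row `i` is the unit row `i + 1`, except that the last point has no successor, which gives the
final zero row. -/
theorem rows_suc (hn : 0 < n) : Mat.rows (Mat.suc n) =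
    (List.range (n - 1)).map (fun i => unitRow n (i + 1)) ++ [List.replicate n false] := by
  refine List.ext_getElem (by simp [Mat.rows]; omega) fun i h₁ h₂ => ?_
  have hi : i < n := by simpa [Mat.rows] using h₁
  rw [List.getElem_append]
  split_ifs with h
  · have hi' : i + 1 < n := by simp at h; omega
    refine List.ext_getElem (by simp [Mat.rows, length_unitRow hi']) fun j h₃ h₄ => ?_
    rw [Bool.eq_iff_iff]
    simp only [Mat.getElem_rows, Mat.suc, List.getElem_map, List.getElem_range, getElem_unitRow,
      decide_eq_true_eq]
    exact eq_comm
  · refine List.ext_getElem (by simp [Mat.rows]) fun j h₃ h₄ => ?_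
    have h₅ : j < n := by simpa using h₄
    simp only [List.length_map, List.length_range] at h
    rw [Bool.eq_iff_iff]
    simp only [Mat.getElem_rows, Mat.suc, List.getElem_singleton, List.getElem_replicate,
      Bool.false_eq_true, iff_false]
    omega

section

variable [DecidableEq κ]

/-- Write a row of the unit matrix. -/
def emitRow (k : Reg κ) : Prog (Name (Reg κ)) (Cell β) :=
  seq (push (.reg k) eor) (seq (copy ta tw (.reg k))
    (seq (push (.reg k) (bit true)) (copy num tw (.reg k))))

variable {g : Reg κ → List (Cell β)} {v x y : List (Cell β)}

theorem runs_emitRow (k : Reg κ) (i j : ℕ) :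
    Runs (emitRow k) (withTmp (rawStacks g v x y (una i)) (una j) [] [] [] [] [] [])
      (withTmp (rawStacks (Function.update g k (encRows [unitRow (i + j + 1) i] ++ g k))
        v x y (una i)) (una j) [] [] [] [] [] []) (4 * (i + j) + 6) := by
  refine (((runs_push _ _ _).seq ((runs_copy (by simp) (by simp) (by simp) (by simp)).seq
    ((runs_push _ _ _).seq (runs_copy (by simp) (by simp) (by simp) (by simp))))).congr ?_).mono ?_
  · have : i + j + 1 - 1 - i = j := by omega
    simp [encRows, unitRow, una]
  · simp
    omega

/-- Write the rows of the unit matrix and of the matrix of the successor relation. -/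
def rowsProg : Prog (Name (Reg κ)) (Cell β) :=
  loop num Option.isSome (seq (mv num []) (seq (emitRow .one)
    (seq (ite num Option.isSome (emitRow .suc) skip) (push ta (bit false)))))

/-- Rows are written from the last to the first, since the stacks grow at the top. The numbers `i`
and `j` in `num` and `ta` give the zeros before and after the one in the next row. -/
theorem runs_rowsProg {i j : ℕ} (h : i + j = n) :
    Runs rowsProg (withTmp (rawStacks g v x y (una i)) (una j) [] [] [] [] [] [])
      (withTmp (rawStacks (Function.update (Function.update g .one
        (encRows ((List.range i).map (unitRow n)) ++ g .one))
        .suc (encRows ((List.range (i - 1)).map (fun i => unitRow n (i + 1))) ++ g .suc))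
        v x y []) (una n) [] [] [] [] [] []) (i * (8 * n + 16) + 1) := by
  induction i generalizing g j with
  | zero =>
    obtain rfl : j = n := by omega
    refine ((runs_loop_false _ rfl).congr ?_).mono (by simp)
    simp [encRows, una]
  | succ i ih =>
    have hn : i + j + 1 = n := by omega
    have e₁ := runs_mv (κ := Name (Reg κ)) num []
      (withTmp (rawStacks g v x y (una (i + 1))) (una j : List (Cell β)) [] [] [] [] [] [])
    simp only [move, withTmp_num, rawStacks_num, una_succ, update_num, pushAll] at e₁
    have e₂ := runs_emitRow (g := g) (v := v) (x := x) (y := y) .one i j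
    rw [hn] at e₂
    set g₁ := Function.update g .one (encRows [unitRow n i] ++ g .one) with hg₁
    -- Unit row `i` is row `i - 1` of the successor matrix, so nothing is written when `i = 0`.
    have e₃ : Runs (ite num Option.isSome (emitRow .suc) skip)
        (withTmp (rawStacks g₁ v x y (una i)) (una j) [] [] [] [] [] [])
        (withTmp (rawStacks (Function.update g₁ .suc
          (encRows (if i = 0 then [] else [unitRow n i]) ++ g .suc)) v x y (una i))
          (una j) [] [] [] [] [] []) (4 * n + 6 + 1) := by
      cases i with
      | zero =>
        refine ((Runs.ite_false rfl (runs_skip _)).congr ?_).mono (by omega)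
        rw [Function.update_eq_self_iff.2]
        simp [encRows, hg₁]
      | succ i =>
        refine ((Runs.ite_true rfl (runs_emitRow _ _ _)).congr ?_).mono (by omega)
        rw [hn]
        simp [hg₁]
    have e₄ := runs_push ta (bit false) (withTmp (rawStacks (Function.update g₁ .suc
      (encRows (if i = 0 then [] else [unitRow n i]) ++ g .suc)) v x y (una i))
      (una j : List (Cell β)) [] [] [] [] [] [])
    rw [update_ta, withTmp_ta, ← una_succ] at e₄
    refine ((Runs.loop_true rfl (e₁.seq (e₂.seq (e₃.seq e₄))) (ih (by omega))).congr ?_).mono ?_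
    · congr 2
      funext k
      cases k with
      | one => simp [hg₁, List.range_succ, encRows]
      | suc =>
        cases i with
        | zero => simp [encRows]
        | succ i => simp [List.range_succ, encRows]
      | cnt => simp [hg₁]
      | usr k => simp [hg₁]
    · nlinarith

/-- Write the unit matrix and the matrix of the successor relation. -/
def constProg : Prog (Name (Reg κ)) (Cell β) :=
  seq (push (.reg .suc) eor) (seq (copy num tw (.reg .suc)) (seq rowsProg (clear ta)))

theorem runs_constProg (hn : 0 < n) (h₁ : g .one = []) (h₂ : g .suc = []) :
    Runs constProg (withTmp (rawStacks g v x y (una n)) [] [] [] [] [] [] [])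
      (withTmp (rawStacks (Function.update (Function.update g .one
        (Mat.enc fun x y : Fin n => x = y)) .suc (Mat.suc n).enc) v x y []) [] [] [] [] [] [] [])
      (40 * (n + 1) ^ 2) := by
  have e₁ := runs_push (κ := Name (Reg κ)) (.reg .suc) eor
    (withTmp (rawStacks g v x y (una n)) ([] : List (Cell β)) [] [] [] [] [] [])
  have e₂ := runs_copy (k := num) (w := tw) (x := Name.reg .suc) (by simp) (by simp) (by simp)
    (s := withTmp (rawStacks (Function.update g .suc [eor]) v x y (una n))
      ([] : List (Cell β)) [] [] [] [] [] []) rfl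
  have e₃ := runs_rowsProg (g := Function.update g .suc (una n ++ [eor])) (v := v) (x := x)
    (y := y) (i := n) (j := 0) (add_zero n)
  have e₄ := runs_clear ta (withTmp (rawStacks (Function.update (Function.update g .one
    (Mat.enc fun x y : Fin n => x = y)) .suc (Mat.suc n).enc) v x y [])
    (una n : List (Cell β)) [] [] [] [] [] [])
  have hg : Function.update (Function.update (Function.update g .suc (una n ++ [eor])) .one
        (encRows ((List.range n).map (unitRow n)) ++
          Function.update g .suc (una n ++ [eor]) .one)) .suc
        (encRows ((List.range (n - 1)).map (fun i => unitRow n (i + 1))) ++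
          Function.update g .suc (una n ++ [eor]) .suc) =
      Function.update (Function.update g .one
        (Mat.enc fun x y : Fin n => x = y)) .suc (Mat.suc n).enc := by
    funext k
    cases k with
    | one => simp [h₁, Mat.enc, rows_one]
    | suc => simp [Mat.enc, rows_suc hn, encRows, una]
    | cnt => simp
    | usr k => simp
  rw [hg] at e₃
  simp only [update_reg, update_reg_rawStacks, withTmp_reg, rawStacks_reg, h₂, withTmp_num,
    rawStacks_num, Function.update_idem, Function.update_self, update_ta, withTmp_ta,
    length_una] at e₁ e₂ e₄
  refine (e₁.seq (e₂.seq (e₃.seq e₄))).mono ?_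
  nlinarith

/-- Copy the unit matrix to each of a list of registers. -/
def initRegs : List (Reg κ) → Prog (Name (Reg κ)) (Cell β)
  | [] => skip
  | k :: l => seq (copy (.reg .one) tw (.reg k)) (initRegs l)

theorem runs_initRegs (l : List (Reg κ)) (hl : l.Nodup) (h : ∀ k ∈ l, k ≠ .one ∧ g k = [])
    (z : List (Cell β)) :
    Runs (initRegs l) (withTmp (rawStacks g v x y z) [] [] [] [] [] [] [])
      (withTmp (rawStacks (fun k => if k ∈ l then g .one else g k) v x y z) [] [] [] [] [] [] [])
      (l.length * (4 * (g .one).length + 2) + 1) := by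
  induction l generalizing g with
  | nil => exact (runs_skip _).mono (by simp)
  | cons k l ih =>
    obtain ⟨hk, hgk⟩ := h k (by simp)
    rw [List.nodup_cons] at hl
    have e₁ := runs_copy (k := Name.reg .one) (w := tw) (x := Name.reg k) (by simp)
      (by simpa using hk.symm) (by simp)
      (s := withTmp (rawStacks g v x y z) ([] : List (Cell β)) [] [] [] [] [] []) rfl
    simp only [update_reg, update_reg_rawStacks, withTmp_reg, rawStacks_reg, hgk,
      List.append_nil] at e₁
    have e₂ := ih (g := Function.update g k (g .one)) hl.2 fun j hj => by
      have hjk : j ≠ k := fun h => hl.1 (h ▸ hj)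
      have := h j (by simp [hj])
      simpa [hjk] using this
    rw [Function.update_of_ne hk.symm] at e₂
    refine ((e₁.seq e₂).congr ?_).mono (by simp; nlinarith)
    congr 2
    funext j
    by_cases hj : j = k
    · subst hj
      simp
    · simp [hj]

variable [Fintype κ]

/-- Write all matrices. -/
noncomputable def initProg : Prog (Name (Reg κ)) (Cell β) :=
  seq constProg (initRegs (.cnt :: Finset.univ.toList.map .usr))

/-- The counter and the variables receive the unit matrix as a placeholder, so that every register
holds the code of a matrix from now on. -/
theorem runs_initProg (hn : 0 < n) :
    Runs initProg (withTmp (rawStacks (fun _ : Reg κ => []) [] x y (una n)) [] [] [] [] [] [] [])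
      (matStacks (fun a b : Fin n => a = b) (fun _ a b => a = b) [] x y [])
      ((Fintype.card κ + 11) * (4 * (n + 1) ^ 2)) := by
  have e₁ := runs_constProg (κ := κ) (g := fun _ => []) (v := []) (x := x) (y := y) hn rfl rfl
  have e₂ := runs_initRegs (g := (Function.update (Function.update (fun _ => []) .one
        (Mat.enc fun x y : Fin n => x = y)) .suc (Mat.suc n).enc)) (v := []) (x := x) (y := y)
    (.cnt :: (Finset.univ : Finset κ).toList.map .usr) (by
      rw [List.nodup_cons]
      refine ⟨by simp, (Finset.nodup_toList _).map fun a b h => by simpa using h⟩) (by simp) []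
  refine ((e₁.seq e₂).congr ?_).mono ?_
  · rw [matStacks_eq_rawStacks]
    congr 2
    funext k
    cases k <;> simp [regVal]
  · simp [Mat.length_enc]
    nlinarith [Nat.zero_le (Fintype.card κ), Nat.zero_le (Fintype.card κ * n)]

end

end HM

/-! ### Reading the formula in postfix order, and computing sizes -/

namespace HM

open Prog Name Cell

/-! ### Reading a formula -/

section

variable {κ Act : Type} [DecidableEq κ]

instance [Finite Act] : Finite (Symbol Act) := by
  let f : Symbol Act → Fin 5 ⊕ (Act ⊕ Act)
    | .tt => .inl 0
    | .ff => .inl 1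
    | .and => .inl 2
    | .or => .inl 3
    | .neg => .inl 4
    | .dia a => .inr (.inl a)
    | .box a => .inr (.inr a)
  refine Finite.of_injective f ?_
  intro x y h
  cases x <;> cases y <;> simp_all [f]

open Classical in
/-- Execute the program that belongs to the topmost symbol of the input. -/
noncomputable def dispatch {β : Type} (h : β → Prog (Name (Reg κ)) (Cell β)) :
    List β → Prog (Name (Reg κ)) (Cell β)
  | [] => skip
  | b :: l => ite inp (fun o => decide (o = some (sym b))) (h b) (dispatch h l)

theorem runs_dispatch {β : Type} {h : β → Prog (Name (Reg κ)) (Cell β)} {l : List β} {b : β}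
    (hb : b ∈ l) {s s' : Name (Reg κ) → List (Cell β)} {T : ℕ} (hs : (s inp).head? = some (sym b))
    (hr : Runs (h b) s s' T) : Runs (dispatch h l) s s' (T + l.length) := by
  induction l with
  | nil => simp at hb
  | cons a l ih =>
    by_cases hab : b = a
    · subst hab
      exact (Runs.ite_true (by simp [hs]) hr).mono (by simp)
    · refine (Runs.ite_false (by simpa [hs] using hab) (ih ?_)).mono (by simp [add_assoc])
      simpa [hab] using hb

/-- Read the input from the top, and execute the program that belongs to each symbol. -/
noncomputable def scan (h : Symbol Act → Prog (Name (Reg κ)) (Cell (Symbol Act)))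
    (l : List (Symbol Act)) : Prog (Name (Reg κ)) (Cell (Symbol Act)) :=
  loop inp Option.isSome (seq (dispatch h l) (mv inp [inp']))

/-- The conditions under which `h` computes the function `val` on formulae of modal depth at most
`d`, in postfix order. -/
structure Computes {A : Type} (h : Symbol Act → Prog (Name (Reg κ)) (Cell (Symbol Act)))
    (S : List A → List (Cell (Symbol Act)) → List (Cell (Symbol Act)) →
      Name (Reg κ) → List (Cell (Symbol Act)))
    (val : Formula Act → A) (d T : ℕ) : Prop where
  inp : ∀ V x y, S V x y inp = x
  move : ∀ V c x y, move Name.inp [inp'] (S V (c :: x) y) = S V x (c :: y)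
  tt : ∀ V x y, Runs (h .tt) (S V x y) (S (val .tt :: V) x y) T
  ff : ∀ V x y, Runs (h .ff) (S V x y) (S (val .ff :: V) x y) T
  and : ∀ φ ψ, φ.md ≤ d → ψ.md ≤ d → ∀ V x y,
    Runs (h .and) (S (val φ :: val ψ :: V) x y) (S (val (φ.and ψ) :: V) x y) T
  or : ∀ φ ψ, φ.md ≤ d → ψ.md ≤ d → ∀ V x y,
    Runs (h .or) (S (val φ :: val ψ :: V) x y) (S (val (φ.or ψ) :: V) x y) T
  dia : ∀ a φ, φ.md ≤ d → ∀ V x y,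
    Runs (h (.dia a)) (S (val φ :: V) x y) (S (val (φ.dia a) :: V) x y) T
  box : ∀ a φ, φ.md ≤ d → ∀ V x y,
    Runs (h (.box a)) (S (val φ :: V) x y) (S (val (φ.box a) :: V) x y) T
  neg : ∀ φ, φ.md ≤ d → ∀ V x y,
    Runs (h .neg) (S (val φ :: V) x y) (S (val φ.neg :: V) x y) T

variable {A : Type} {h : Symbol Act → Prog (Name (Reg κ)) (Cell (Symbol Act))}
  {S : List A → List (Cell (Symbol Act)) → List (Cell (Symbol Act)) →
    Name (Reg κ) → List (Cell (Symbol Act))} {val : Formula Act → A} {d T : ℕ}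
  {l : List (Symbol Act)}

/-- Besides the work for the symbol, the cost consists of the dispatch through `l`, the loop test
and the move of the symbol to `inp'`, where the word is kept for a second pass. -/
theorem Computes.runs_step (H : Computes h S val d T) (hl : ∀ b, b ∈ l) {b : Symbol Act}
    {V V' : List A} {x y : List (Cell (Symbol Act))}
    (hb : Runs (h b) (S V (sym b :: x) y) (S V' (sym b :: x) y) T)
    {s' : Name (Reg κ) → List (Cell (Symbol Act))} {T' : ℕ}
    (hr : Runs (scan h l) (S V' x (sym b :: y)) s' T') :
    Runs (scan h l) (S V (sym b :: x) y) s' (T + l.length + 2 + T') := by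
  have h₁ := runs_mv Name.inp [inp'] (S V' (sym b :: x) y)
  rw [H.move] at h₁
  exact Runs.loop_true (by rw [H.inp]; rfl)
    ((runs_dispatch (hl b) (by rw [H.inp]; rfl) hb).seq h₁) hr

/-- Prefix notation read backwards is postfix notation: both arguments are evaluated before their
connective, the second one first, so the value of the first one is on top. The rest of the run
enters as a hypothesis, which lets the induction pass through concatenated subformulae. -/
theorem Computes.runs_formula (H : Computes h S val d T) (hl : ∀ b, b ∈ l) {φ : Formula Act}
    (hφ : φ.md ≤ d) (V : List A) (x y : List (Cell (Symbol Act)))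
    {s' : Name (Reg κ) → List (Cell (Symbol Act))} {T' : ℕ}
    (hr : Runs (scan h l) (S (val φ :: V) x (φ.encode.map sym ++ y)) s' T') :
    Runs (scan h l) (S V ((φ.encode.map sym).reverse ++ x) y) s'
      (φ.size * (T + l.length + 2) + T') := by
  induction φ generalizing V x y T' with
  | tt => exact (H.runs_step hl (H.tt _ _ _) hr).mono (by simp [Formula.size])
  | ff => exact (H.runs_step hl (H.ff _ _ _) hr).mono (by simp [Formula.size])
  | and φ ψ ihφ ihψ =>
    rw [Formula.md, max_le_iff] at hφ
    simp only [Formula.encode, List.map_cons, List.map_append, List.reverse_cons,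
      List.reverse_append, List.append_assoc, List.cons_append] at hr ⊢
    exact (ihψ hφ.2 _ _ _ (ihφ hφ.1 _ _ _ (H.runs_step hl (H.and _ _ hφ.1 hφ.2 _ _ _) hr))).mono
      (by rw [Formula.size]; linarith)
  | or φ ψ ihφ ihψ =>
    rw [Formula.md, max_le_iff] at hφ
    simp only [Formula.encode, List.map_cons, List.map_append, List.reverse_cons,
      List.reverse_append, List.append_assoc, List.cons_append] at hr ⊢
    exact (ihψ hφ.2 _ _ _ (ihφ hφ.1 _ _ _ (H.runs_step hl (H.or _ _ hφ.1 hφ.2 _ _ _) hr))).mono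
      (by rw [Formula.size]; linarith)
  | dia a φ ihφ =>
    have hφ' : φ.md ≤ d := (Nat.le_succ _).trans hφ
    simp only [Formula.encode, List.map_cons, List.reverse_cons, List.append_assoc,
      List.cons_append] at hr ⊢
    exact (ihφ hφ' _ _ _ (H.runs_step hl (H.dia _ _ hφ' _ _ _) hr)).mono
      (by rw [Formula.size]; linarith)
  | box a φ ihφ =>
    have hφ' : φ.md ≤ d := (Nat.le_succ _).trans hφ
    simp only [Formula.encode, List.map_cons, List.reverse_cons, List.append_assoc,
      List.cons_append] at hr ⊢
    exact (ihφ hφ' _ _ _ (H.runs_step hl (H.box _ _ hφ' _ _ _) hr)).mono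
      (by rw [Formula.size]; linarith)
  | neg φ ihφ =>
    have hφ' : φ.md ≤ d := hφ
    simp only [Formula.encode, List.map_cons, List.reverse_cons, List.append_assoc,
      List.cons_append] at hr ⊢
    exact (ihφ hφ' _ _ _ (H.runs_step hl (H.neg _ hφ' _ _ _) hr)).mono
      (by rw [Formula.size]; linarith)

theorem Computes.runs_scan (H : Computes h S val d T) (hl : ∀ b, b ∈ l) {φ : Formula Act}
    (hφ : φ.md ≤ d) (V : List A) (y : List (Cell (Symbol Act))) :
    Runs (scan h l) (S V (φ.encode.map sym).reverse y) (S (val φ :: V) [] (φ.encode.map sym ++ y))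
      (φ.size * (T + l.length + 2) + 1) := by
  have := H.runs_formula hl hφ V [] y (runs_loop_false _ (by rw [H.inp]; rfl))
  rwa [List.append_nil] at this

end

/-! ### The modal depth and the number of states -/

section

variable {κ β : Type} [DecidableEq κ]

/-- The code of a list of numbers. -/
def encNats (V : List ℕ) : List (Cell β) := V.flatMap fun m => una m ++ [eor]

/-- Replace the two topmost numbers by their maximum. -/
def maxVals : Prog (Name (Reg κ)) (Cell β) :=
  seq (moveWhile vals isBit [ta]) (seq (mv vals []) (seq (loop vals isBit
    (seq (mv vals [tb]) (mv ta []))) (seq (moveAll ta [vals]) (moveAll tb [vals]))))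

variable {g : Reg κ → List (Cell β)} {x y z v : List (Cell β)}

/-- Removing a symbol from an empty stack does nothing, so `ta` ends with the truncated difference,
and `b + (a - b)` is the maximum. -/
theorem runs_maxLoop (a b c : ℕ) :
    Runs (loop vals isBit (seq (mv vals [tb]) (mv ta [])))
      (withTmp (rawStacks g (una b ++ eor :: v) x y z) (una a) (una c) [] [] [] [] [])
      (withTmp (rawStacks g (eor :: v) x y z) (una (a - b)) (una (b + c)) [] [] [] [] [])
      (3 * b + 1) := by
  induction b generalizing a c with
  | zero => exact (runs_loop_false _ rfl).congr (by simp [una])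
  | succ b ih =>
    have e₁ := runs_mv vals [tb] (withTmp (rawStacks g (una (b + 1) ++ eor :: v) x y z)
      (una a) (una c) [] [] [] [] [])
    have e₂ := runs_mv ta [] (withTmp (rawStacks g (una b ++ eor :: v) x y z)
      (una a : List (Cell β)) (una (c + 1)) [] [] [] [] [])
    have h : move ta [] (withTmp (rawStacks g (una b ++ eor :: v) x y z)
        (una a : List (Cell β)) (una (c + 1)) [] [] [] [] []) =
        withTmp (rawStacks g (una b ++ eor :: v) x y z) (una (a - 1)) (una (c + 1))
          [] [] [] [] [] := by
      cases a
      · simp [move, una]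
      · simp [move, una_succ, pushAll]
    rw [h] at e₂
    have e₃ := ih (a - 1) (c + 1)
    simp only [move, pushAll, withTmp_vals, rawStacks_vals, una_succ, List.cons_append,
      update_vals, update_vals_rawStacks, update_tb, withTmp_tb] at e₁ e₂ e₃
    have h₁ : a - 1 - b = a - (b + 1) := by omega
    have h₂ : b + (c + 1) = b + 1 + c := by omega
    rw [h₁, h₂] at e₃
    exact (Runs.loop_true rfl (e₁.seq e₂) e₃).mono (by omega)

theorem runs_maxVals (a b : ℕ) (V : List ℕ) :
    Runs maxVals (withTmp (rawStacks g (encNats (a :: b :: V)) x y z) [] [] [] [] [] [] [])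
      (withTmp (rawStacks g (encNats (max a b :: V)) x y z) [] [] [] [] [] [] [])
      (10 * max a b + 10) := by
  have e₁ := runs_moveWhile (k := vals) (f := isBit) (ks := [ta]) (by simp) (by simp)
    (l := una a) (rest := eor :: encNats (b :: V))
    (s := withTmp (rawStacks g (encNats (a :: b :: V)) x y z) [] [] [] [] [] [] [])
    (by simp [encNats]) (by
      intro c hc
      obtain rfl := List.eq_of_mem_replicate hc
      rfl) rfl
  have he₁ : (fun j => if j = vals then eor :: encNats (b :: V) else if j ∈ [ta] then
      (una a).reverse ++ withTmp (rawStacks g (encNats (a :: b :: V)) x y z)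
        ([] : List (Cell β)) [] [] [] [] [] [] j
      else withTmp (rawStacks g (encNats (a :: b :: V)) x y z) [] [] [] [] [] [] [] j) =
      withTmp (rawStacks g (eor :: encNats (b :: V)) x y z) (una a) [] [] [] [] [] [] := by
    funext j
    cases j <;> simp
  rw [he₁] at e₁
  have e₂ := runs_mv vals [] (withTmp (rawStacks g (eor :: encNats (b :: V)) x y z)
    (una a : List (Cell β)) [] [] [] [] [] [])
  have e₃ := runs_maxLoop (g := g) (x := x) (y := y) (z := z) (v := encNats V) a b 0
  have e₄ := runs_transfer (k := ta) (x := vals) (by simp)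
    (withTmp (rawStacks g (eor :: encNats V) x y z) (una (a - b) : List (Cell β)) (una (b + 0))
      [] [] [] [] [])
  have e₅ := runs_transfer (k := tb) (x := vals) (by simp)
    (withTmp (rawStacks g (una (a - b) ++ eor :: encNats V) x y z) ([] : List (Cell β)) (una b)
      [] [] [] [] [])
  simp only [move, pushAll, withTmp_vals, rawStacks_vals, update_vals, update_vals_rawStacks,
    update_ta, update_tb, withTmp_ta, withTmp_tb, reverse_una, length_una] at e₂ e₄ e₅
  have hb : (encNats (b :: V) : List (Cell β)) = una b ++ eor :: encNats V := by simp [encNats]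
  rw [hb] at e₁ e₂
  refine ((e₁.seq (e₂.seq (e₃.seq (e₄.seq e₅)))).congr ?_).mono ?_
  · rw [← List.append_assoc, una_append]
    have : b + (a - b) = max a b := by omega
    simp [encNats, this]
  · rw [length_una]
    omega

end

end HM

namespace HM

open Prog Name Cell

section

variable {κ β : Type} [DecidableEq κ]

/-- Execute a program a fixed number of times. -/
def times (p : Prog (Name (Reg κ)) (Cell β)) : ℕ → Prog (Name (Reg κ)) (Cell β)
  | 0 => skip
  | m + 1 => seq p (times p m)

theorem runs_times {p : Prog (Name (Reg κ)) (Cell β)} {S : ℕ → Name (Reg κ) → List (Cell β)}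
    {T : ℕ} (m : ℕ) (h : ∀ i < m, Runs p (S i) (S (i + 1)) T) :
    Runs (times p m) (S 0) (S m) (m * T + 1) := by
  induction m generalizing S with
  | zero => exact (runs_skip _).mono (by simp)
  | succ m ih =>
    refine ((h 0 (by omega)).seq (ih (S := fun i => S (i + 1)) fun i hi => h (i + 1)
      (by omega))).mono (by linarith)

/-- Replace the number `m` by `2 ^ (k * m)`. -/
def powProg (k : ℕ) : Prog (Name (Reg κ)) (Cell β) :=
  seq (times (copy num tw tb) k) (seq (clear num) (seq (push num (bit false))
    (loop tb Option.isSome (seq (mv tb []) (seq (moveAll num [tc, td])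
      (seq (moveAll tc [num]) (moveAll td [num])))))))

variable {g : Reg κ → List (Cell β)} {x y v : List (Cell β)}

/-- In each round `num` is copied to two stacks and both are moved back to it. The cost is dominated
by the final size. -/
theorem runs_doubleLoop (a : List (Cell β)) (m i : ℕ) :
    Runs (loop tb Option.isSome (seq (mv tb []) (seq (moveAll num [tc, td])
      (seq (moveAll tc [num]) (moveAll td [num])))))
      (withTmp (rawStacks g v x y (una i)) a (una m) [] [] [] [] [])
      (withTmp (rawStacks g v x y (una (2 ^ m * i))) a [] [] [] [] [] [])
      (m * (6 * (2 ^ m * i) + 5) + 1) := by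
  induction m generalizing i with
  | zero => exact ((runs_loop_false _ rfl).congr (by simp [una])).mono (by simp)
  | succ m ih =>
    have e₁ := runs_mv tb [] (withTmp (rawStacks g v x y (una i)) a (una (m + 1)) [] [] [] [] [])
    have e₂ := runs_moveAll (k := num) (ks := [tc, td]) (by simp) (by simp)
      (withTmp (rawStacks g v x y (una i)) a (una m) [] [] [] [] [])
    have he₂ : (fun j => if j = num then [] else if j ∈ [tc, td] then
        ((withTmp (rawStacks g v x y (una i)) a (una m) [] [] [] [] []) num).reverse ++
          withTmp (rawStacks g v x y (una i)) a (una m) [] [] [] [] [] j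
        else withTmp (rawStacks g v x y (una i)) a (una m) [] [] [] [] [] j) =
        withTmp (rawStacks g v x y []) a (una m) (una i) (una i) [] [] [] := by
      funext j
      cases j <;> simp
    rw [he₂] at e₂
    have e₃ := runs_transfer (k := tc) (x := num) (by simp)
      (withTmp (rawStacks g v x y []) a (una m) (una i) (una i) [] [] [])
    have e₄ := runs_transfer (k := td) (x := num) (by simp)
      (withTmp (rawStacks g v x y (una i)) a (una m) [] (una i) [] [] [])
    have e₅ := ih (2 * i)
    simp only [move, pushAll, update_tb, update_tc, update_td, update_num, withTmp_tb, withTmp_tc,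
      withTmp_td, withTmp_num, rawStacks_num, una_succ, reverse_una, length_una, List.append_nil,
      una_append] at e₁ e₂ e₃ e₄
    rw [← two_mul] at e₄
    have h : 2 ^ m * (2 * i) = 2 ^ (m + 1) * i := by ring
    rw [h] at e₅
    refine (Runs.loop_true rfl (e₁.seq (e₂.seq (e₃.seq e₄))) e₅).mono ?_
    have : i ≤ 2 ^ (m + 1) * i := Nat.le_mul_of_pos_left _ (by positivity)
    nlinarith

theorem runs_powProg (k n : ℕ) (a : List (Cell β)) :
    Runs (powProg k) (withTmp (rawStacks g v x y (una n)) a [] [] [] [] [] [])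
      (withTmp (rawStacks g v x y (una (2 ^ (k * n)))) a [] [] [] [] [] [])
      (20 * (2 ^ (k * n) + k + n) ^ 2 + 10) := by
  have e₁ := runs_times (p := copy num tw tb)
    (S := fun i => withTmp (rawStacks g v x y (una n)) a (una (i * n)) [] [] [] [] [])
    (T := 4 * n + 2) k fun i _ => by
      refine ((runs_copy (by simp) (by simp) (by simp) rfl).congr ?_).mono (by simp)
      simp [una_append, Nat.succ_mul, Nat.add_comm]
  have e₂ := runs_clear num (withTmp (rawStacks g v x y (una n)) a (una (k * n)) [] [] [] [] [])
  have e₃ := runs_push num (bit false)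
    (withTmp (rawStacks g v x y []) a (una (k * n)) [] [] [] [] [])
  have e₄ := runs_doubleLoop (g := g) (v := v) (x := x) (y := y) a (k * n) 1
  have h : (una 0 : List (Cell β)) = [] := rfl
  simp only [zero_mul, h, update_num, withTmp_num, rawStacks_num, length_una, mul_one] at e₁ e₂ e₃ e₄
  refine (e₁.seq (e₂.seq (e₃.seq e₄))).mono ?_
  have h₁ : k * n < 2 ^ (k * n) := Nat.lt_two_pow_self
  generalize 2 ^ (k * n) = p at *
  nlinarith [Nat.zero_le (p * k), Nat.zero_le (p * n), Nat.zero_le (k * n)]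

/-- Push `b` symbols onto the stack for numbers. -/
def addProg (b : ℕ) : Prog (Name (Reg κ)) (Cell β) := times (push num (bit false)) b

theorem runs_addProg (b n : ℕ) (a : List (Cell β)) :
    Runs (addProg b) (withTmp (rawStacks g v x y (una n)) a [] [] [] [] [] [])
      (withTmp (rawStacks g v x y (una (b + n))) a [] [] [] [] [] []) (b + 1) := by
  have := runs_times (p := push num (bit false))
    (S := fun i => withTmp (rawStacks g v x y (una (i + n))) a [] [] [] [] [] [])
    (T := 1) b fun i _ => (runs_push _ _ _).congr (by
      rw [update_num, withTmp_num, rawStacks_num, ← una_succ, Nat.add_right_comm])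
  rw [zero_add, mul_one] at this
  exact this

variable {Act : Type} [Fintype Act] [Nonempty Act] (B : Base Act)

/-- Compute the number of states. -/
noncomputable def sizeProg : Prog (Name (Reg κ)) (Cell β) :=
  seq (times (mv num []) B.j) (seq (moveAll num [ta]) (seq (addProg B.b)
    (loop ta Option.isSome (seq (mv ta []) (seq (powProg (Fintype.card Act)) (addProg B.b))))))

/-- Each round follows the recursion of `s`. All intermediate values are bounded by the last one,
hence the uniform bound per round. -/
theorem runs_sizeLoop (i m r : ℕ) (h : i + m = r) :
    Runs (loop ta Option.isSome (seq (mv ta []) (seq (powProg (Fintype.card Act)) (addProg B.b))))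
      (withTmp (rawStacks g v x y (una (B.s i))) (una m) [] [] [] [] [] [])
      (withTmp (rawStacks g v x y (una (B.s r))) [] [] [] [] [] [] [])
      (m * (20 * (2 * B.s r + Fintype.card Act) ^ 2 + B.s r + 13) + 1) := by
  induction m generalizing i with
  | zero =>
    obtain rfl : i = r := by omega
    exact (runs_loop_false _ rfl).mono (by simp)
  | succ m ih =>
    have e₁ := runs_mv ta [] (withTmp (rawStacks g v x y (una (B.s i))) (una (m + 1) : List (Cell β))
      [] [] [] [] [] [])
    have e₂ := runs_powProg (g := g) (v := v) (x := x) (y := y) (Fintype.card Act) (B.s i) (una m)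
    have e₃ := runs_addProg (g := g) (v := v) (x := x) (y := y) B.b
      (2 ^ (Fintype.card Act * B.s i)) (una m)
    have e₄ := ih (i + 1) (by omega)
    simp only [move, pushAll, withTmp_ta, una_succ, update_ta] at e₁
    refine (Runs.loop_true rfl (e₁.seq (e₂.seq e₃)) e₄).mono ?_
    have hs : B.s (i + 1) = B.b + 2 ^ (Fintype.card Act * B.s i) := rfl
    have hm : Monotone B.s := monotone_nat_of_le_succ fun n => (B.s_lt_succ n).le
    have h₁ : B.s (i + 1) ≤ B.s r := hm (by omega)
    have h₂ : B.s i ≤ B.s r := hm (by omega)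
    have h₃ : (2 ^ (Fintype.card Act * B.s i) + Fintype.card Act + B.s i) ^ 2 ≤
        (2 * B.s r + Fintype.card Act) ^ 2 := Nat.pow_le_pow_left (by omega) 2
    generalize (2 * B.s r + Fintype.card Act) ^ 2 = q at *
    generalize (2 ^ (Fintype.card Act * B.s i) + Fintype.card Act + B.s i) ^ 2 = q' at *
    have h₄ : B.b ≤ B.s r := B.b_le_s r
    nlinarith

theorem runs_sizeProg (d : ℕ) :
    Runs (sizeProg B) (withTmp (rawStacks g v x y (una d)) [] [] [] [] [] [] [])
      (withTmp (rawStacks g v x y (una (B.s (d - B.j)))) [] [] [] [] [] [] [])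
      ((d + B.j + 1) * (20 * (2 * B.s (d - B.j) + Fintype.card Act) ^ 2 + B.s (d - B.j) + 20)) := by
  -- The fixed number `B.j` of removals computes the truncated difference `d - B.j`, the rank that
  -- is needed for depth `d`.
  have e₁ := runs_times (p := mv num [])
    (S := fun i => withTmp (rawStacks g v x y (una (d - i))) ([] : List (Cell β))
      [] [] [] [] [] [])
    (T := 1) B.j fun i _ => (runs_mv _ _ _).congr (by
      rw [show d - (i + 1) = d - i - 1 by omega]
      cases d - i
      · simp [move, una]
      · simp [move, una_succ, pushAll])
  have e₂ := runs_transfer (k := num) (x := ta) (by simp)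
    (withTmp (rawStacks g v x y (una (d - B.j))) ([] : List (Cell β)) [] [] [] [] [] [])
  have e₃ := runs_addProg (g := g) (v := v) (x := x) (y := y) B.b 0 (una (d - B.j))
  have e₄ := runs_sizeLoop (κ := κ) (g := g) (v := v) (x := x) (y := y) B 0 (d - B.j) (d - B.j)
    (zero_add _)
  have h : (una 0 : List (Cell β)) = [] := rfl
  simp only [Nat.sub_zero, update_num, withTmp_num, withTmp_ta, rawStacks_num, length_una,
    update_ta, reverse_una, List.append_nil, h, add_zero] at e₁ e₂ e₃
  have hs : B.s 0 = B.b := rfl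
  rw [hs] at e₄
  refine (e₁.seq (e₂.seq (e₃.seq e₄))).mono ?_
  have h₄ : B.b ≤ B.s (d - B.j) := B.b_le_s _
  have h₅ : d - B.j ≤ d := Nat.sub_le _ _
  generalize d - B.j = r at *
  generalize (2 * B.s r + Fintype.card Act) ^ 2 = q at *
  nlinarith [Nat.zero_le (B.j * q), Nat.zero_le (B.j * B.s r), Nat.mul_le_mul_right (20 * q + B.s r + 13) h₅]

end

/-! ### The modal depth -/

section

variable {κ Act : Type} [DecidableEq κ]

/-- The computation of the modal depth in postfix order. -/
def mdStep : Symbol Act → Prog (Name (Reg κ)) (Cell (Symbol Act))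
  | .tt => push vals eor
  | .ff => push vals eor
  | .and => maxVals
  | .or => maxVals
  | .dia _ => push vals (bit false)
  | .box _ => push vals (bit false)
  | .neg => skip

variable {g : Reg κ → List (Cell (Symbol Act))} {z : List (Cell (Symbol Act))}

/-- A modality adds one to the topmost number by a single push; only the binary connectives cost
time that grows with `d`. -/
theorem computes_md (d : ℕ) : Computes mdStep
    (fun (V : List ℕ) x y => withTmp (rawStacks g (encNats V) x y z) [] [] [] [] [] [] [])
    (Formula.md : Formula Act → ℕ) d (10 * d + 10) where
  inp _ _ _ := rfl
  move V c x y := by simp [move, pushAll]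
  tt V x y := ((runs_push _ _ _).congr (by simp [encNats, una, Formula.md])).mono (by omega)
  ff V x y := ((runs_push _ _ _).congr (by simp [encNats, una, Formula.md])).mono (by omega)
  and φ ψ hφ hψ V x y := (runs_maxVals _ _ _).mono (by
    have := max_le hφ hψ
    omega)
  or φ ψ hφ hψ V x y := (runs_maxVals _ _ _).mono (by
    have := max_le hφ hψ
    omega)
  dia a φ hφ V x y := ((runs_push _ _ _).congr
    (by simp [encNats, una_succ, Formula.md])).mono (by omega)
  box a φ hφ V x y := ((runs_push _ _ _).congr
    (by simp [encNats, una_succ, Formula.md])).mono (by omega)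
  neg φ hφ V x y := (runs_skip _).mono (by omega)

/-- Write the modal depth of the input. -/
noncomputable def mdProg (l : List (Symbol Act)) : Prog (Name (Reg κ)) (Cell (Symbol Act)) :=
  seq (scan mdStep l) (seq (moveAll inp' [inp]) (seq (moveWhile vals isBit [num]) (mv vals [])))

theorem runs_mdProg {l : List (Symbol Act)} (hl : ∀ b, b ∈ l) (φ : Formula Act) :
    Runs (mdProg l) (withTmp (rawStacks g [] (φ.encode.map sym).reverse [] []) [] [] [] [] [] [] [])
      (withTmp (rawStacks g [] (φ.encode.map sym).reverse [] (una φ.md)) [] [] [] [] [] [] [])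
      ((φ.size + 1) * (12 * φ.md + l.length + 20)) := by
  have e₁ := (computes_md (g := g) (z := []) φ.md).runs_scan hl le_rfl [] []
  have e₂ := runs_transfer (k := inp') (x := inp) (by simp)
    (withTmp (rawStacks g (encNats [φ.md]) [] (φ.encode.map sym) []) [] [] [] [] [] [] [])
  have e₃ := runs_moveWhile (k := vals) (f := isBit) (ks := [num]) (by simp) (by simp)
    (l := una φ.md) (rest := [eor])
    (s := withTmp (rawStacks g (encNats [φ.md]) (φ.encode.map sym).reverse [] [])
      [] [] [] [] [] [] [])
    (by simp [encNats]) (by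
      intro c hc
      obtain rfl := List.eq_of_mem_replicate hc
      rfl) rfl
  have e₄ := runs_mv vals [] (withTmp (rawStacks g [eor] (φ.encode.map sym).reverse [] (una φ.md))
      [] [] [] [] [] [] [])
  have he₃ : (fun j => if j = vals then [eor] else if j ∈ [num] then
      (una φ.md).reverse ++ withTmp (rawStacks g (encNats [φ.md]) (φ.encode.map sym).reverse [] [])
        [] [] [] [] [] [] [] j
      else withTmp (rawStacks g (encNats [φ.md]) (φ.encode.map sym).reverse [] [])
        [] [] [] [] [] [] [] j) =
      withTmp (rawStacks g [eor] (φ.encode.map sym).reverse [] (una φ.md))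
        [] [] [] [] [] [] [] := by
    funext j
    cases j <;> simp
  rw [he₃] at e₃
  have h₀ : (encNats [] : List (Cell (Symbol Act))) = [] := rfl
  simp only [h₀, List.append_nil, move, pushAll, update_inp, update_inp', withTmp_inp',
    rawStacks_inp', withTmp_inp, rawStacks_inp, withTmp_vals, rawStacks_vals, update_vals,
    update_vals_rawStacks, List.length_map, Formula.length_encode, length_una] at e₁ e₂ e₃ e₄
  refine (e₁.seq (e₂.seq (e₃.seq e₄))).mono ?_
  nlinarith [Nat.zero_le (φ.size * φ.md), Nat.zero_le (φ.size * l.length)]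

end

end HM

/-! ### Computing the transitions from the state numbers -/

namespace HM

open Prog Name Cell

/-! ### Programs of commands -/

section

variable {κ β : Type} [DecidableEq κ] {n : ℕ}

namespace Com

/-- The program of a command. -/
def prog : Com κ → Prog (Name (Reg κ)) (Cell β)
  | blk l => l.prog
  | rep l => l.repProg
  | seq c d => .seq c.prog d.prog

/-- The number of operations of a command. -/
def ops : Com κ → ℕ
  | blk l => l.ops
  | rep l => l.ops + 40
  | seq c d => c.ops + d.ops

theorem runs_prog (c : Com κ) (σ : Mat n × (κ → Mat n)) (V : List (Mat n)) (x y z : List (Cell β)) :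
    Runs c.prog (matStacks σ.1 σ.2 V x y z) (matStacks (c.den σ).1 (c.den σ).2 V x y z)
      (c.ops * (60 * (n + 1) ^ 4)) := by
  induction c generalizing σ with
  | blk l =>
    refine (l.runs_prog _).mono (Nat.mul_le_mul_left _ (Nat.mul_le_mul_left _ ?_))
    exact Nat.pow_le_pow_right (by omega) (by omega)
  | rep l => exact l.runs_repProg _
  | seq c d ihc ihd => exact ((ihc σ).seq (ihd _)).mono (by rw [ops, add_mul])

end Com

namespace Blk

theorem den_append (C : Mat n) (l l' : Blk κ) (ρ : κ → Mat n) :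
    Blk.den C (l ++ l') ρ = Blk.den C l' (Blk.den C l ρ) := by
  induction l generalizing ρ with
  | nil => rfl
  | cons a l ih => exact ih _

theorem iter_induct {l : Blk κ} {ρ : κ → Mat n} (I : ℕ → (κ → Mat n) → Prop) (h₀ : I 0 ρ)
    (h : ∀ i < n, ∀ ρ, I i ρ → I (i + 1) (l.den (Mat.pt n i) ρ)) : I n (l.iter ρ n) := by
  have : ∀ m ≤ n, I m (l.iter ρ m) := by
    intro m
    induction m with
    | zero => exact fun _ => h₀
    | succ m ih => exact fun hm => h m hm _ (ih (Nat.le_of_succ_le hm))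
  exact this n le_rfl

end Blk

end

section

variable {κ : Type} {n : ℕ}

namespace MExp

variable (C : Mat n) (ρ : κ → Mat n)

/-- The union of a list of matrices. -/
def anyOf (l : List (MExp κ)) : MExp κ := l.foldr disj (not top)

@[simp] theorem eval_anyOf (l : List (MExp κ)) (x y : Fin n) :
    (anyOf l).eval C ρ x y ↔ ∃ e ∈ l, e.eval C ρ x y := by
  induction l with
  | nil => simp [anyOf]
  | cons e l ih =>
    rw [anyOf, List.foldr_cons, eval_disj, ← anyOf, ih]
    simp

/-- The rows of a matrix, shifted downwards several times. -/
def shifts (m : ℕ) (e : MExp κ) : MExp κ := shift^[m] e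

@[simp] theorem eval_shifts (m : ℕ) (e : MExp κ) (x y : Fin n) :
    (shifts m e).eval C ρ x y ↔ ∃ z : Fin n, (x : ℕ) = z + m ∧ e.eval C ρ z y := by
  induction m generalizing x with
  | zero =>
    constructor
    · exact fun h => ⟨x, rfl, h⟩
    · rintro ⟨z, hz, h⟩
      obtain rfl : x = z := Fin.ext hz
      exact h
  | succ m ih =>
    rw [shifts, Function.iterate_succ_apply', eval_shift]
    constructor
    · rintro ⟨z, hz, h⟩
      obtain ⟨w, hw, h⟩ := (ih z).1 h
      exact ⟨w, by omega, h⟩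
    · rintro ⟨z, hz, h⟩
      exact ⟨⟨z + m, by omega⟩, by simp; omega, (ih _).2 ⟨z, rfl, h⟩⟩

/-- The matrix whose only entry is `(p, q)`. -/
def point (p q : ℕ) : MExp κ := shifts p (tr (shifts q (tr zero)))

@[simp] theorem eval_point (p q : ℕ) (x y : Fin n) :
    (point p q : MExp κ).eval C ρ x y ↔ (x : ℕ) = p ∧ (y : ℕ) = q := by
  simp only [point, eval_shifts, eval_tr, eval_zero, Mat.pt]
  constructor
  · rintro ⟨z, h₁, w, h₂, h₃, h₄⟩
    omega
  · rintro ⟨h₁, h₂⟩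
    exact ⟨⟨0, x.pos⟩, by simpa using h₁, ⟨0, x.pos⟩, by simpa using h₂, rfl, rfl⟩

variable {Act : Type} [Fintype Act]

/-- The union of a family of matrices. -/
noncomputable def anyAct (e : Act → MExp κ) : MExp κ := anyOf (Finset.univ.toList.map e)

@[simp] theorem eval_anyAct (e : Act → MExp κ) (x y : Fin n) :
    (anyAct e).eval C ρ x y ↔ ∃ a, (e a).eval C ρ x y := by
  simp [anyAct]

/-- The intersection of a family of matrices. -/
noncomputable def allAct (e : Act → MExp κ) : MExp κ := not (anyAct fun a => not (e a))

@[simp] theorem eval_allAct (e : Act → MExp κ) (x y : Fin n) :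
    (allAct e).eval C ρ x y ↔ ∀ a, (e a).eval C ρ x y := by
  simp [allAct]

/-- `∀ z, e x z → f z y`. -/
def box (e f : MExp κ) : MExp κ := not (comp e (not f))

@[simp] theorem eval_box (e f : MExp κ) (x y : Fin n) :
    (box e f).eval C ρ x y ↔ ∀ z, e.eval C ρ x z → f.eval C ρ z y := by
  simp [box]

end MExp

end

/-! ### The computation of the transitions -/

/-- The variables of the decision procedure. -/
inductive Var (Act : Type) : Type
  | tr : Act → Var Act
  | dbl : Var Act
  | aux : Var Act
  | path : Var Act
  | eqv : Var Act
  | sim : Var Act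
  | arg : Var Act
  | arg' : Var Act
  deriving DecidableEq, Fintype

open MExp

variable {Act : Type} [DecidableEq Act] {n : ℕ}

namespace Com

/-- Compute the relation `x = 2 * y`. -/
def double : Com (Var Act) :=
  seq (blk [(.dbl, not top), (.aux, .zero)])
    (rep [(.dbl, disj (var .dbl) (var .aux)),
      (.aux, comp (shifts 2 (var .aux)) (reg .suc))])

theorem den_double (σ : Mat n × (Var Act → Mat n)) (x y : Fin n) :
    ((double : Com (Var Act)).den σ).2 .dbl x y ↔ (x : ℕ) = 2 * y := by
  have := Blk.iter_induct (n := n) (l := [(Var.dbl, disj (var .dbl) (var .aux)),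
      (.aux, comp (shifts 2 (var .aux)) (reg .suc))])
    (ρ := Blk.den σ.1 [((.dbl : Var Act), not top), (.aux, .zero)] σ.2)
    -- The matrix `aux` contains only the point `(2 * i, i)`, which is added to `dbl` and then moved
    -- by two rows and one column. It disappears once it leaves the matrix.
    (fun i ρ => (∀ x y, ρ .dbl x y ↔ (x : ℕ) = 2 * y ∧ (y : ℕ) < i) ∧
      ∀ x y, ρ .aux x y ↔ (x : ℕ) = 2 * i ∧ (y : ℕ) = i) ?_ ?_
  · have h := this.1 x y
    rw [and_iff_left y.2] at h
    exact h
  · simp [Blk.den, eval_zero, Mat.pt]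
  · rintro i hi ρ ⟨h₁, h₂⟩
    refine ⟨fun x y => ?_, fun x y => ?_⟩
    · simp only [Blk.den, ne_eq, reduceCtorEq, not_false_eq_true, Function.update_of_ne,
        Function.update_self, eval_disj, eval_var, h₁, h₂]
      omega
    · simp only [Blk.den, ne_eq, reduceCtorEq, not_false_eq_true, Function.update_of_ne,
        Function.update_self, eval_comp, eval_shifts, eval_var, h₂, eval_reg, regVal, Mat.suc]
      constructor
      · rintro ⟨z, ⟨w, h₃, h₄, h₅⟩, h₆⟩
        omega
      · rintro ⟨h₃, h₄⟩
        exact ⟨⟨i, hi⟩, ⟨⟨2 * i, by omega⟩, by simp; omega, rfl, rfl⟩, h₄⟩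

end Com

end HM

namespace HM

open MExp Proc

section

variable {Act : Type} {n : ℕ}

/-- The relation `y = x / 2`, if `dbl` contains the relation `x = 2 * y`. -/
def half : MExp (Var Act) := disj (var .dbl) (shift (var .dbl))

/-- The odd numbers, if `dbl` contains the relation `x = 2 * y`. -/
def odd : MExp (Var Act) := comp (shift (var .dbl)) top

theorem eval_half {C : Mat n} {ρ : Var Act → Mat n} (h : ∀ x y, ρ .dbl x y ↔ (x : ℕ) = 2 * y)
    (x y : Fin n) : half.eval C ρ x y ↔ (y : ℕ) = x / 2 := by
  simp only [half, eval_disj, eval_var, eval_shift, h]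
  constructor
  · rintro (h | ⟨z, h₁, h₂⟩) <;> omega
  · intro h₁
    by_cases h₂ : (x : ℕ) % 2 = 0
    · exact .inl (by omega)
    · exact .inr ⟨⟨2 * y, by omega⟩, by simp; omega, rfl⟩

theorem eval_odd {C : Mat n} {ρ : Var Act → Mat n} (h : ∀ x y, ρ .dbl x y ↔ (x : ℕ) = 2 * y)
    (x y : Fin n) : odd.eval C ρ x y ↔ (x : ℕ) % 2 = 1 := by
  simp only [odd, eval_comp, eval_top, and_true, eval_var, eval_shift, h]
  constructor
  · rintro ⟨w, z, h₁, h₂⟩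
    omega
  · intro h₁
    exact ⟨⟨x / 2, by omega⟩, ⟨2 * (x / 2), by omega⟩, by simp; omega, rfl⟩

section

variable (B : Base Act)

open Classical in
/-- The transitions between the base states. -/
noncomputable def baseExp (a : Act) : MExp (Var Act) :=
  anyOf (((List.range B.b ×ˢ List.range B.b).filter fun p =>
    decide (Trans (B.proc p.1) a (B.proc p.2))).map fun p => point p.1 p.2)

theorem eval_baseExp {C : Mat n} {ρ : Var Act → Mat n} (a : Act) (x y : Fin n) :
    (baseExp B a).eval C ρ x y ↔
      (x : ℕ) < B.b ∧ (y : ℕ) < B.b ∧ Trans (B.proc x) a (B.proc y) := by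
  simp only [baseExp, eval_anyOf, List.mem_map, List.mem_filter, decide_eq_true_eq, Prod.exists,
    List.mem_product, List.mem_range]
  constructor
  · rintro ⟨e, ⟨p, q, ⟨⟨h₁, h₂⟩, h₃⟩, rfl⟩, h⟩
    obtain ⟨rfl, rfl⟩ := (eval_point _ _ _ _ _ _).1 h
    exact ⟨h₁, h₂, h₃⟩
  · rintro ⟨h₁, h₂, h₃⟩
    exact ⟨_, ⟨x, y, ⟨⟨h₁, h₂⟩, h₃⟩, rfl⟩, (eval_point _ _ _ _ _ _).2 ⟨rfl, rfl⟩⟩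

variable [DecidableEq Act]

/-- Compute the transitions between the base states. -/
noncomputable def baseBlk (l : List Act) : Blk (Var Act) := l.map fun a => (.tr a, baseExp B a)

theorem den_baseBlk (C : Mat n) (l : List Act) (ρ : Var Act → Mat n) :
    (∀ a ∈ l, Blk.den C (baseBlk B l) ρ (.tr a) = (baseExp B a).eval C ρ) ∧
    (∀ k, (∀ a ∈ l, k ≠ .tr a) → Blk.den C (baseBlk B l) ρ k = ρ k) := by
  induction l generalizing ρ with
  | nil => exact ⟨by simp, fun _ _ => rfl⟩
  | cons a l ih =>
    obtain ⟨h₁, h₂⟩ := ih (Function.update ρ (.tr a) ((baseExp B a).eval C ρ))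
    refine ⟨fun b hb => ?_, fun k hk => ?_⟩
    · by_cases hbl : b ∈ l
      · refine (h₁ b hbl).trans ?_
        -- The value of `baseExp` does not depend on the registers, so the assignments do not
        -- interfere.
        funext x y
        rw [eval_baseExp, eval_baseExp]
      · obtain rfl : b = a := by simpa [hbl] using hb
        refine (h₂ (.tr b) fun c hc h => ?_).trans (by simp)
        obtain rfl : b = c := by simpa using h
        exact hbl hc
    · exact (h₂ k fun c hc => hk c (by simp [hc])).trans
        (Function.update_of_ne (hk a (by simp)) _ _)

end

variable [Fintype Act]

/-- The actions in the order of their numbers. -/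
noncomputable def actList (Act : Type) [Fintype Act] : List Act :=
  List.ofFn (Fintype.equivFin Act).symm

theorem mem_actList (a : Act) : a ∈ actList Act :=
  List.mem_ofFn.2 ⟨Fintype.equivFin Act a, by simp⟩

variable [DecidableEq Act] (B : Base Act)

/-- Read the bit in position 0 of the numbers `z` with `aux x z` for an action, and halve `z`. -/
def bitStep (a : Act) : Blk (Var Act) :=
  [(.tr a, disj (var (.tr a)) (conj (comp (var .aux) odd) (meet top (reg .cnt)))),
    (.aux, comp (var .aux) half)]

/-- The relation `aux` sends `x` to its code shifted right by the number of bits read so far. Each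
action reads the lowest bit, which tells whether there is a transition to the point `i` of the
counter, and halves the code. The assumption on `l` says that the actions come in the order in which
their bits are stored. -/
theorem den_bitSteps {l : List Act} {m i : ℕ} (hl : l.map actIdx = List.range' m l.length)
    {ρ : Var Act → Mat n} (h : ∀ x y, ρ .dbl x y ↔ (x : ℕ) = 2 * y) {e : ℕ}
    (hd : ∀ x z, ρ .aux x z ↔ B.b ≤ x ∧ (z : ℕ) = (x - B.b) / 2 ^ (e + m)) :
    (∀ x y, Blk.den (Mat.pt n i) (l.flatMap bitStep) ρ .dbl x y ↔ (x : ℕ) = 2 * y) ∧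
    (∀ x z, Blk.den (Mat.pt n i) (l.flatMap bitStep) ρ .aux x z ↔
      B.b ≤ x ∧ (z : ℕ) = (x - B.b) / 2 ^ (e + (m + l.length))) ∧
    ∀ a x y, Blk.den (Mat.pt n i) (l.flatMap bitStep) ρ (.tr a) x y ↔ ρ (.tr a) x y ∨
      (a ∈ l ∧ (y : ℕ) = i ∧ B.b ≤ x ∧ ((x : ℕ) - B.b).testBit (e + actIdx a) = true) := by
  induction l generalizing m ρ with
  | nil => exact ⟨h, hd, by simp [Blk.den]⟩
  | cons a l ih =>
    simp only [List.map_cons, List.length_cons, List.range'_succ, List.cons.injEq] at hl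
    set ρ' := Blk.den (Mat.pt n i) (bitStep a) ρ with hρ'
    have h₁ : ∀ x y, ρ' .dbl x y ↔ (x : ℕ) = 2 * y := fun x y => by
      simp [hρ', bitStep, Blk.den, h]
    have h₂ : ∀ x z, ρ' .aux x z ↔ B.b ≤ x ∧ (z : ℕ) = (x - B.b) / 2 ^ (e + (m + 1)) := by
      intro x z
      have he : (Function.update ρ (.tr a) ((disj (var (.tr a)) (conj (comp (var .aux) odd)
        (meet top (reg .cnt)))).eval (Mat.pt n i) ρ)) .dbl = ρ .dbl := by simp
      simp only [hρ', bitStep, Blk.den, Function.update_self, eval_comp, eval_var,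
        ne_eq, reduceCtorEq, not_false_eq_true, Function.update_of_ne, hd]
      rw [← add_assoc, pow_succ, ← Nat.div_div_eq_div_mul]
      constructor
      · rintro ⟨w, ⟨h₃, h₄⟩, h₅⟩
        rw [eval_half (by rwa [he]), h₄] at h₅
        exact ⟨h₃, h₅⟩
      · rintro ⟨h₃, h₄⟩
        have h₅ : ((x : ℕ) - B.b) / 2 ^ (e + m) ≤ x := (Nat.div_le_self _ _).trans (Nat.sub_le _ _)
        refine ⟨⟨((x : ℕ) - B.b) / 2 ^ (e + m), by omega⟩, ⟨h₃, rfl⟩, ?_⟩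
        rw [eval_half (by rwa [he])]
        exact h₄
    have h₃ : ∀ b x y, ρ' (.tr b) x y ↔ ρ (.tr b) x y ∨ (b = a ∧ (y : ℕ) = i ∧ B.b ≤ x ∧
        ((x : ℕ) - B.b).testBit (e + actIdx a) = true) := by
      intro b x y
      by_cases hb : b = a
      · subst hb
        simp only [hρ', bitStep, Blk.den, ne_eq, reduceCtorEq, not_false_eq_true,
          Function.update_of_ne, Function.update_self, eval_disj, eval_var, eval_conj, eval_comp,
          hd, eval_odd h, eval_meet, eval_top, eval_reg, regVal, Mat.pt, true_and,
          Nat.testBit_eq_decide_div_mod_eq, decide_eq_true_eq, hl.1]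
        refine or_congr_right ?_
        constructor
        · rintro ⟨⟨z, ⟨h₄, h₅⟩, h₆⟩, w, h₇, h₈⟩
          rw [h₅] at h₆
          exact ⟨h₇, h₄, h₆⟩
        · rintro ⟨h₄, h₅, h₆⟩
          have h₇ : ((x : ℕ) - B.b) / 2 ^ (e + m) ≤ x :=
            (Nat.div_le_self _ _).trans (Nat.sub_le _ _)
          exact ⟨⟨⟨((x : ℕ) - B.b) / 2 ^ (e + m), by omega⟩, ⟨h₅, rfl⟩, h₆⟩, ⟨0, x.pos⟩, h₄, rfl⟩
      · simp [hρ', bitStep, Blk.den, hb]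
    obtain ⟨h₄, h₅, h₆⟩ := ih hl.2 h₁ h₂
    rw [List.flatMap_cons, Blk.den_append, ← hρ']
    refine ⟨h₄, fun x z => ?_, fun b x y => ?_⟩
    · rw [h₅, List.length_cons, add_assoc m, add_comm 1]
    · rw [h₆, h₃, List.mem_cons]
      constructor
      · rintro ((h | ⟨rfl, h⟩) | h)
        · exact .inl h
        · exact .inr ⟨.inl rfl, h⟩
        · exact .inr ⟨.inr h.1, h.2⟩
      · rintro (h | ⟨rfl | h, h'⟩)
        · exact .inl (.inl h)
        · exact .inl (.inr ⟨rfl, h'⟩)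
        · exact .inr ⟨h, h'⟩

namespace Com

/-- Compute the transitions. -/
noncomputable def trans : Com (Var Act) :=
  seq double (seq (blk ((.aux, shifts B.b (reg .one)) :: baseBlk B (actList Act)))
    (rep ((actList Act).flatMap bitStep)))

theorem den_trans (σ : Mat n × (Var Act → Mat n)) (a : Act) (x y : Fin n) :
    ((trans B).den σ).2 (.tr a) x y ↔ B.Tr x a y := by
  have hlist : (actList Act).map actIdx = List.range' 0 (actList Act).length := by
    refine List.ext_getElem (by simp) fun i h₁ h₂ => ?_
    simp [actList, actIdx]
  have hlen : (actList Act).length = Fintype.card Act := by simp [actList]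
  set τ := (double : Com (Var Act)).den σ with hτ
  set ρ := Blk.den τ.1 ((.aux, shifts B.b (reg .one)) :: baseBlk B (actList Act)) τ.2 with hρ
  have h₁ : ∀ x y, ρ .dbl x y ↔ (x : ℕ) = 2 * y := by
    intro x y
    rw [hρ, Blk.den, (den_baseBlk B _ _ _).2 _ (by simp),
      Function.update_of_ne (by simp), hτ, den_double]
  have h₂ : ∀ x z, ρ .aux x z ↔ B.b ≤ x ∧ (z : ℕ) = (x - B.b) / 2 ^ (0 : ℕ) := by
    intro x z
    rw [hρ, Blk.den, (den_baseBlk B _ _ _).2 _ (by simp), Function.update_self, eval_shifts]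
    simp only [eval_reg, regVal, exists_eq_right, pow_zero, Nat.div_one]
    omega
  have h₃ : ∀ a x y, ρ (.tr a) x y ↔
      (x : ℕ) < B.b ∧ (y : ℕ) < B.b ∧ Trans (B.proc x) a (B.proc y) := by
    intro a x y
    rw [hρ, Blk.den, (den_baseBlk B _ _ _).1 _ (mem_actList a), eval_baseExp]
  -- Round `i` reads the block of `card Act` bits that belongs to the target `i`. After all rounds
  -- every target below `n` has been treated.
  have := Blk.iter_induct (n := n) (l := (actList Act).flatMap bitStep) (ρ := ρ)
    (fun i ρ => (∀ x y, ρ .dbl x y ↔ (x : ℕ) = 2 * y) ∧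
      (∀ x z, ρ .aux x z ↔ B.b ≤ x ∧ (z : ℕ) = (x - B.b) / 2 ^ (Fintype.card Act * i)) ∧
      ∀ a x y, ρ (.tr a) x y ↔
        ((x : ℕ) < B.b ∧ (y : ℕ) < B.b ∧ Trans (B.proc x) a (B.proc y)) ∨
        ((y : ℕ) < i ∧ B.b ≤ x ∧
          ((x : ℕ) - B.b).testBit (Fintype.card Act * y + actIdx a) = true)) ?_ ?_
  · have h := this.2.2 a x y
    refine Iff.trans h ?_
    rw [Base.Tr]
    have := y.2
    split_ifs with hx
    · simp [hx]
    · simp [hx, not_lt.1 hx]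
  · exact ⟨h₁, by simpa using h₂, by simpa using h₃⟩
  · rintro i _ ρ ⟨h₁, h₂, h₃⟩
    obtain ⟨h₄, h₅, h₆⟩ := den_bitSteps B hlist h₁ (e := Fintype.card Act * i) h₂
    refine ⟨h₄, fun x z => ?_, fun a x y => ?_⟩
    · rw [h₅, zero_add, hlen, Nat.mul_succ]
    · rw [h₆, h₃, or_assoc]
      refine or_congr_right ?_
      simp only [mem_actList, true_and]
      constructor
      · rintro (⟨h, h'⟩ | ⟨rfl, h'⟩)
        · exact ⟨by omega, h'⟩
        · exact ⟨by omega, h'⟩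
      · rintro ⟨h, h'⟩
        rcases Nat.lt_succ_iff_lt_or_eq.1 h with h | h
        · exact .inl ⟨h, h'⟩
        · exact .inr ⟨h, by rwa [h] at h'⟩

end Com

end

end HM

/-! ### Computing trace inclusion and the preorder -/

namespace HM

namespace Proc

variable {Act : Type}

/-- `t` leads from `p` to a deadlock. -/
def Completed (p : Proc Act) (t : List Act) : Prop :=
  ∃ q, Steps p t q ∧ ∀ a r, ¬Trans q a r

theorem completed_nil {p : Proc Act} : Completed p [] ↔ ∀ a r, ¬Trans p a r := by
  constructor
  · rintro ⟨_, rfl, h⟩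
    exact h
  · exact fun h => ⟨p, rfl, h⟩

theorem completed_cons {p : Proc Act} {a : Act} {t : List Act} :
    Completed p (a :: t) ↔ ∃ r, Trans p a r ∧ Completed r t := by
  constructor
  · rintro ⟨q, ⟨r, hr, hq⟩, h⟩
    exact ⟨r, hr, q, hq, h⟩
  · rintro ⟨r, hr, q, hq, h⟩
    exact ⟨q, ⟨r, hr, hq⟩, h⟩

theorem Completed.length_le {p : Proc Act} {t : List Act} (h : Completed p t) :
    t.length ≤ depth p :=
  let ⟨_, hq, _⟩ := h
  length_le_depth ⟨_, hq⟩

/-- A line can be used as a name of a single word. A shared complete path with a line therefore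
tests whether this one word is a trace. -/
theorem IsLine.completed_iff {p : Proc Act} {t : List Act} (h : IsLine p t) {u : List Act} :
    Completed p u ↔ u = t := by
  induction t generalizing p u with
  | nil =>
    cases u with
    | nil => exact completed_nil.trans (iff_of_true h rfl)
    | cons a u =>
      simp only [completed_cons, reduceCtorEq, iff_false]
      rintro ⟨r, hr, _⟩
      exact h a r hr
  | cons a t ih =>
    obtain ⟨⟨q, hq⟩, h⟩ := h
    cases u with
    | nil =>
      simp only [completed_nil, List.nil_eq, reduceCtorEq, iff_false]
      exact fun h => h a q hq
    | cons b u =>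
      rw [completed_cons]
      constructor
      · rintro ⟨r, hr, hu⟩
        obtain ⟨rfl, hl⟩ := h b r hr
        rw [(ih hl).1 hu]
      · rintro h'
        obtain ⟨rfl, rfl⟩ := List.cons.inj h'
        exact ⟨q, hq, (ih (h b q hq).2).2 rfl⟩

end Proc

open MExp Proc

section

variable {Act : Type} [DecidableEq Act] [Fintype Act] [Nonempty Act] (B : Base Act) {r : ℕ}

namespace Com

/-- Compute whether some path from a state to a deadlock is a path from another state. -/
noncomputable def paths : Com (Var Act) :=
  seq (blk [(.path, allAct fun a => not (comp (var (.tr a)) top))])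
    (rep [(.path, disj (allAct fun a => not (comp (var (.tr a)) top))
      (anyAct fun a => comp (comp (var (.tr a)) (var .path)) (MExp.tr (var (.tr a)))))])

/-- Round `i` covers the words of length at most `i`. A word either is empty and the first state is
a deadlock, or its first letter is a step of both states. Complete paths are no longer than the
depth, which is less than the number of rounds. -/
theorem den_paths {σ : Mat (B.s r) × (Var Act → Mat (B.s r))}
    (h : ∀ a x y, σ.2 (.tr a) x y ↔ B.Tr x a y) :
    (∀ a x y, (paths.den σ).2 (.tr a) x y ↔ B.Tr x a y) ∧
    ∀ x y, (paths.den σ).2 .path x y ↔ ∃ t, Completed (B.st x) t ∧ t ∈ traces (B.st y) := by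
  have hnil : ∀ (C : Mat (B.s r)) (ρ : Var Act → Mat (B.s r)),
      (∀ a x y, ρ (.tr a) x y ↔ B.Tr x a y) → ∀ x y,
      (allAct fun a : Act => not (comp (var (.tr a)) top)).eval C ρ x y ↔
        Completed (B.st x) [] := by
    intro C ρ h x y
    simp only [eval_allAct, eval_not, eval_comp, eval_var, h, eval_top, and_true, completed_nil]
    constructor
    · rintro h' a p hp
      obtain ⟨z, hz, rfl⟩ := B.trans_st.1 hp
      exact h' a ⟨⟨z, B.lt_s_of_tr x.2 hz⟩, hz⟩
    · rintro h' a ⟨z, hz⟩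
      exact h' a _ (B.trans_st.2 ⟨z, hz, rfl⟩)
  have := Blk.iter_induct (n := B.s r)
    (l := [(.path, disj (allAct fun a : Act => not (comp (var (.tr a)) top))
      (anyAct fun a => comp (comp (var (.tr a)) (var .path)) (MExp.tr (var (.tr a)))))])
    (ρ := Blk.den σ.1 [(.path, allAct fun a : Act => not (comp (var (.tr a)) top))] σ.2)
    (fun i ρ => (∀ a x y, ρ (.tr a) x y ↔ B.Tr x a y) ∧
      ∀ x y, ρ .path x y ↔
        ∃ t, t.length ≤ i ∧ Completed (B.st x) t ∧ t ∈ traces (B.st y)) ?_ ?_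
  · refine ⟨this.1, fun x y => (this.2 x y).trans ?_⟩
    refine exists_congr fun t => and_iff_right_of_imp fun ⟨ht, _⟩ => ?_
    exact ht.length_le.trans (B.depth_st_lt x.2).le
  · refine ⟨by simpa [Blk.den] using h, fun x y => ?_⟩
    simp only [Blk.den, Function.update_self, hnil _ _ h]
    constructor
    · exact fun h => ⟨[], le_rfl, h, nil_mem_traces _⟩
    · rintro ⟨t, ht, h, _⟩
      obtain rfl := List.length_eq_zero_iff.1 (Nat.le_zero.1 ht)
      exact h
  · rintro i _ ρ ⟨h₁, h₂⟩
    refine ⟨by simpa [Blk.den] using h₁, fun x y => ?_⟩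
    simp only [Blk.den, Function.update_self, eval_disj, hnil _ _ h₁, eval_anyAct, eval_comp,
      eval_var, eval_tr, h₁, h₂]
    constructor
    · rintro (h | ⟨a, z, ⟨w, h₃, t, h₄, h₅, h₆⟩, h₇⟩)
      · exact ⟨[], Nat.zero_le _, h, nil_mem_traces _⟩
      · exact ⟨a :: t, Nat.succ_le_succ h₄, completed_cons.2 ⟨_, B.trans_st.2 ⟨w, h₃, rfl⟩, h₅⟩,
          cons_mem_traces.2 ⟨_, B.trans_st.2 ⟨z, h₇, rfl⟩, h₆⟩⟩
    · rintro ⟨_ | ⟨a, t⟩, h₃, h₄, h₅⟩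
      · exact .inl h₄
      · obtain ⟨_, h₆, h₄⟩ := completed_cons.1 h₄
        obtain ⟨w, hw, rfl⟩ := B.trans_st.1 h₆
        obtain ⟨_, h₇, h₅⟩ := cons_mem_traces.1 h₅
        obtain ⟨z, hz, rfl⟩ := B.trans_st.1 h₇
        exact .inr ⟨a, ⟨z, B.lt_s_of_tr y.2 hz⟩, ⟨⟨w, B.lt_s_of_tr x.2 hw⟩, hw, t,
          Nat.le_of_succ_le_succ h₃, h₄, h₅⟩, hz⟩

/-- Compute the trace simulation preorder. -/
noncomputable def sims : Com (Var Act) :=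
  seq (blk [(.aux, box (MExp.tr (var .path)) (var .path)),
      (.eqv, conj (var .aux) (MExp.tr (var .aux))), (.sim, top)])
    (rep [(.sim, conj (var .eqv)
      (allAct fun a => box (var (.tr a)) (meet (var .sim) (var (.tr a)))))])

theorem den_sims {σ : Mat (B.s r) × (Var Act → Mat (B.s r))}
    (h : ∀ a x y, σ.2 (.tr a) x y ↔ B.Tr x a y)
    (hp : ∀ x y, σ.2 .path x y ↔ ∃ t, Completed (B.st x) t ∧ t ∈ traces (B.st y)) :
    (∀ a x y, (sims.den σ).2 (.tr a) x y ↔ B.Tr x a y) ∧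
    ∀ x y, (sims.den σ).2 .sim x y ↔ TSLe (B.st x) (B.st y) := by
  set ρ₀ := Blk.den σ.1 [((.aux : Var Act), box (MExp.tr (var .path)) (var .path)),
      (.eqv, conj (var .aux) (MExp.tr (var .aux))), (.sim, top)] σ.2 with hρ₀
  have haux : ∀ x y : Fin (B.s r),
      (box (MExp.tr (var .path)) (var .path) : MExp (Var Act)).eval σ.1 σ.2 x y ↔
      traces (B.st x) ⊆ traces (B.st y) := by
    intro x y
    simp only [eval_box, eval_tr, eval_var, hp]
    constructor
    · intro h' t ht
      -- The trace `t` is short enough to be the word of a line among the states. This line shares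
      -- its complete path with `x`, hence with `y`, so `t` is a trace of `y`.
      obtain ⟨c, hc, hl⟩ := B.exists_st_line (r := r) (t := t)
        ((length_le_depth ht).trans (B.depth_st_le x.2))
      obtain ⟨u, hu, hut⟩ := h' ⟨c, hc⟩ ⟨t, hl.completed_iff.2 rfl, ht⟩
      rwa [← hl.completed_iff.1 hu]
    · rintro h' c ⟨t, hc, ht⟩
      exact ⟨t, hc, h' ht⟩
  have heqv : ∀ x y, ρ₀ .eqv x y ↔ traces (B.st x) = traces (B.st y) := by
    intro x y
    rw [Set.Subset.antisymm_iff, ← haux, ← haux]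
    simp [hρ₀, Blk.den]
  -- The iteration descends from the full relation. It always contains the preorder, and after `i`
  -- rounds it is correct for all left arguments of depth less than `i`.
  have := Blk.iter_induct (n := B.s r)
    (l := [(.sim, conj (var .eqv)
      (allAct fun a : Act => box (var (.tr a)) (meet (var .sim) (var (.tr a)))))])
    (ρ := ρ₀) (fun i ρ => ((∀ a x y, ρ (.tr a) x y ↔ B.Tr x a y) ∧
      ∀ x y, ρ .eqv x y ↔ traces (B.st x) = traces (B.st y)) ∧
      (∀ x y : Fin (B.s r), TSLe (B.st x) (B.st y) → ρ .sim x y) ∧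
      ∀ x y : Fin (B.s r), depth (B.st x) < i → ρ .sim x y → TSLe (B.st x) (B.st y)) ?_ ?_
  · exact ⟨this.1.1, fun x y => ⟨this.2.2 x y (B.depth_st_lt x.2), this.2.1 x y⟩⟩
  · refine ⟨⟨?_, heqv⟩, ?_, fun _ _ h => absurd h (by omega)⟩
    · simpa [hρ₀, Blk.den] using h
    · intro x y _
      simp only [hρ₀, Blk.den, Function.update_self, eval_top]
  · rintro i _ ρ ⟨⟨h₁, h₂⟩, h₃, h₄⟩
    refine ⟨⟨by simpa [Blk.den] using h₁, by simpa [Blk.den] using h₂⟩, fun x y hxy => ?_,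
      fun x y hx hxy => ?_⟩
    · simp only [Blk.den, Function.update_self, eval_conj, eval_var, eval_allAct, eval_box,
        eval_meet, h₁, h₂]
      refine ⟨hxy.traces_eq, fun a z hz => ?_⟩
      obtain ⟨_, hq, hs⟩ := hxy.sim (B.trans_st.2 ⟨z, hz, rfl⟩)
      obtain ⟨w, hw, rfl⟩ := B.trans_st.1 hq
      exact ⟨⟨w, B.lt_s_of_tr y.2 hw⟩, h₃ _ _ hs, hw⟩
    · simp only [Blk.den, Function.update_self, eval_conj, eval_var, eval_allAct, eval_box,
        eval_meet, h₁, h₂] at hxy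
      refine (tsLe_iff _ _).2 ⟨fun a p hp => ?_, hxy.1⟩
      have hd := depth_trans hp
      obtain ⟨z, hz, rfl⟩ := B.trans_st.1 hp
      obtain ⟨w, hs, hw⟩ := hxy.2 a ⟨z, B.lt_s_of_tr x.2 hz⟩ hz
      exact ⟨_, B.trans_st.2 ⟨w, hw, rfl⟩, h₄ _ _ (show depth (B.st z) < i by omega) hs⟩

/-- Compute the transitions and the trace simulation preorder. -/
noncomputable def prepare : Com (Var Act) :=
  seq (trans B) (seq paths (seq sims (blk [(.arg, reg .one), (.arg', reg .one)])))

theorem den_prepare (σ : Mat (B.s r) × (Var Act → Mat (B.s r))) :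
    (∀ a x y, ((prepare B).den σ).2 (.tr a) x y ↔ B.Tr x a y) ∧
    (∀ x y, ((prepare B).den σ).2 .sim x y ↔ TSLe (B.st x) (B.st y)) ∧
    (((prepare B).den σ).2 .arg = fun x y => x = y) ∧
    ((prepare B).den σ).2 .arg' = fun x y => x = y := by
  have h₁ := den_trans B σ
  obtain ⟨h₂, h₃⟩ := den_paths B h₁
  obtain ⟨h₄, h₅⟩ := den_sims B h₂ h₃
  refine ⟨?_, ?_, ?_, ?_⟩
  · simpa [prepare, den, Blk.den] using h₄
  · simpa [prepare, den, Blk.den] using h₅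
  · simp only [prepare, den, Blk.den, ne_eq, reduceCtorEq, not_false_eq_true,
      Function.update_of_ne, Function.update_self]
    rfl
  · simp only [prepare, den, Blk.den, Function.update_self]
    rfl

end Com

end

end HM

/-! ### Evaluating the formula and deciding primality -/

namespace HM

open Prog Name Cell MExp Formula

/-! ### The evaluation of a formula -/

section

variable {κ β : Type} [DecidableEq κ] {n : ℕ}

/-- Move the topmost matrix to a variable. -/
def popVar (k : κ) : Prog (Name (Reg κ)) (Cell β) :=
  seq (clear (.reg (.usr k))) (popTo (.reg (.usr k)))

variable {C : Mat n} {ρ : κ → Mat n} {V : List (Mat n)} {x y z : List (Cell β)}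

theorem runs_popVar (k : κ) (M : Mat n) :
    Runs (popVar k) (matStacks C ρ (M :: V) x y z)
      (matStacks C (Function.update ρ k M) V x y z) (60 * (n + 1) ^ 3) :=
  (runs_popReg (.usr k) M).congr (update_usr_matStacks _ _)

/-- Apply a function, given by an expression in the variable `k`, to the topmost matrix. -/
def unary (k : κ) (e : MExp κ) : Prog (Name (Reg κ)) (Cell β) :=
  seq (popVar k) (seq e.prog (assign (.usr k) (reg .one)))

/-- The argument register is reset to the unit matrix afterwards, so the registers are the same
before each symbol. This is what the scheme `Computes` requires. -/
theorem runs_unary {k : κ} (hk : ρ k = fun x y => x = y) (e : MExp κ) (M : Mat n) :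
    Runs (unary k e) (matStacks C ρ (M :: V) x y z)
      (matStacks C ρ (e.eval C (Function.update ρ k M) :: V) x y z)
      ((e.ops + 3) * (60 * (n + 1) ^ 3)) := by
  refine (((runs_popVar k M).seq ((e.runs_prog V).seq (runs_assign_usr k (reg .one)))).congr
    ?_).mono (le_of_eq (by simp only [MExp.ops]; ring))
  rw [Function.update_idem, Function.update_eq_self_iff.2]
  exact hk.symm

/-- Apply a function, given by an expression in the variables `k` and `l`, to the topmost
matrices. -/
def binary (k l : κ) (e : MExp κ) : Prog (Name (Reg κ)) (Cell β) :=
  seq (popVar k) (seq (popVar l) (seq e.prog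
    (seq (assign (.usr l) (reg .one)) (assign (.usr k) (reg .one)))))

theorem runs_binary {k l : κ} (hkl : k ≠ l) (hk : ρ k = fun x y => x = y)
    (hl : ρ l = fun x y => x = y) (e : MExp κ) (M N : Mat n) :
    Runs (binary k l e) (matStacks C ρ (M :: N :: V) x y z)
      (matStacks C ρ (e.eval C (Function.update (Function.update ρ k M) l N) :: V) x y z)
      ((e.ops + 6) * (60 * (n + 1) ^ 3)) := by
  refine (((runs_popVar k M).seq ((runs_popVar l N).seq ((e.runs_prog V).seq
    ((runs_assign_usr l (reg .one)).seq (runs_assign_usr k (reg .one)))))).congr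
    ?_).mono (le_of_eq (by simp only [MExp.ops]; ring))
  congr 1
  funext j
  by_cases h₁ : j = k
  · subst h₁
    rw [Function.update_self]
    exact hk.symm
  · by_cases h₂ : j = l
    · subst h₂
      rw [Function.update_of_ne h₁, Function.update_self]
      exact hl.symm
    · simp [h₁, h₂]

end

variable {Act : Type} [DecidableEq Act]

/-- The evaluation of a formula in postfix order. -/
def evalStep : Symbol Act → Prog (Name (Reg (Var Act))) (Cell (Symbol Act))
  | .tt => top.prog
  | .ff => (not top).prog
  | .and => binary .arg .arg' (conj (var .arg) (var .arg'))
  | .or => binary .arg .arg' (disj (var .arg) (var .arg'))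
  | .dia a => unary .arg (comp (var (.tr a)) (var .arg))
  | .box a => unary .arg (MExp.box (var (.tr a)) (var .arg))
  | .neg => unary .arg (not (var .arg))

variable [Fintype Act] [Nonempty Act] (B : Base Act) {r : ℕ}

/-- A set of states is represented by a matrix with constant rows. Successors of a state are again
states of the system, so modalities become products with the transition matrices. -/
theorem computes_sat {C : Mat (B.s r)} {ρ : Var Act → Mat (B.s r)}
    (htr : ∀ a x y, ρ (.tr a) x y ↔ B.Tr x a y)
    (ha : ρ .arg = fun x y => x = y) (ha' : ρ .arg' = fun x y => x = y) (d : ℕ) :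
    Computes evalStep (fun V x y => matStacks C ρ V x y [])
      (fun φ x _ => Sat (B.st x) φ) d (40 * (60 * (B.s r + 1) ^ 3)) where
  inp _ _ _ := rfl
  move V c x y := by
    simp [matStacks_eq_rawStacks, move, pushAll]
  tt V x y := by
    refine ((runs_prog top V).congr ?_).mono (Nat.mul_le_mul_right _ (by simp [MExp.ops, top]))
    congr 2
    funext x y
    simp [Sat]
  ff V x y := by
    refine ((runs_prog (not top) V).congr ?_).mono (Nat.mul_le_mul_right _ (by simp [MExp.ops, top, MExp.not]))
    congr 2
    funext x y
    simp [Sat]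
  and φ ψ _ _ V x y := by
    refine ((runs_binary (by simp) ha ha' _ _ _).congr ?_).mono
      (Nat.mul_le_mul_right _ (by simp [MExp.ops, conj, var, MExp.not]))
    congr 2
    funext x y
    simp [Sat]
  or φ ψ _ _ V x y := by
    refine ((runs_binary (by simp) ha ha' _ _ _).congr ?_).mono
      (Nat.mul_le_mul_right _ (by simp [MExp.ops, disj, var, MExp.not]))
    congr 2
    funext x y
    simp [Sat]
  dia a φ _ V x y := by
    refine ((runs_unary ha _ _).congr ?_).mono
      (Nat.mul_le_mul_right _ (by simp [MExp.ops, comp, MExp.tr, var]))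
    congr 2
    funext x y
    simp only [eval_comp, eval_var, ne_eq, reduceCtorEq, not_false_eq_true,
      Function.update_of_ne, Function.update_self, htr, Sat, B.trans_st, eq_iff_iff]
    constructor
    · rintro ⟨z, h₁, h₂⟩
      exact ⟨_, ⟨z, h₁, rfl⟩, h₂⟩
    · rintro ⟨_, ⟨z, h₁, rfl⟩, h₂⟩
      exact ⟨⟨z, B.lt_s_of_tr x.2 h₁⟩, h₁, h₂⟩
  box a φ _ V x y := by
    refine ((runs_unary ha _ _).congr ?_).mono
      (Nat.mul_le_mul_right _ (by simp [MExp.ops, MExp.box, MExp.not, comp, MExp.tr, var]))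
    congr 2
    funext x y
    simp only [eval_box, eval_var, ne_eq, reduceCtorEq, not_false_eq_true,
      Function.update_of_ne, Function.update_self, htr, Sat, B.trans_st, eq_iff_iff]
    constructor
    · rintro h _ ⟨z, h₁, rfl⟩
      exact h ⟨z, B.lt_s_of_tr x.2 h₁⟩ h₁
    · rintro h z h₁
      exact h _ ⟨z, h₁, rfl⟩
  neg φ _ V x y := by
    refine ((runs_unary ha _ _).congr ?_).mono
      (Nat.mul_le_mul_right _ (by simp [MExp.ops, MExp.not, var]))
    congr 2
    funext x y
    simp [Sat]

/-! ### The decision procedure -/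

/-- The least elements of a set of states, given by its argument, or all states, if the set is
empty. -/
def leastExp : MExp (Var Act) :=
  disj (not (comp top (var .arg)))
    (conj (var .arg) (not (comp (not (var .sim)) (var .arg))))

/-- Decide whether the set of states has a least element or is empty, and remove everything except
the answer. -/
noncomputable def answerProg : Prog (Name (Reg (Var Act))) (Cell (Symbol Act)) :=
  seq (popVar .arg) (seq (assign .cnt leastExp) (seq testCnt
    (seq (ite tf Option.isSome (push ta (bit true)) (push ta (bit false)))
      (clearAll (Finset.univ.erase ta).toList))))

theorem runs_clearAll_le {κ α : Type} [DecidableEq κ] (ks : List κ) (s : κ → List α) {L : ℕ}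
    (h : ∀ k, (s k).length ≤ L) :
    Runs (clearAll ks) s (fun j => if j ∈ ks then [] else s j) (1 + ks.length * (2 * L + 1)) := by
  refine (runs_clearAll ks s).mono (Nat.add_le_add_left ?_ 1)
  refine (List.sum_le_card_nsmul _ (2 * L + 1) fun x hx => ?_).trans_eq (by simp)
  obtain ⟨k, _, rfl⟩ := List.mem_map.1 hx
  have := h k
  omega

open Classical in
-- By `Base.prime_iff`, primality means that the matrix of least elements has some entry `true`.
-- This is tested with the counter register, and then every stack but the one with the answer is
-- cleared, as the machine requires.
theorem runs_answerProg {C : Mat (B.s r)} {ρ : Var Act → Mat (B.s r)}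
    (hsim : ∀ x y, ρ .sim x y ↔ Proc.TSLe (B.st x) (B.st y)) {φ : Formula Act}
    (hφ : IsTS φ) (hr : φ.md ≤ B.j + r) (y : List (Cell (Symbol Act))) :
    Runs answerProg (matStacks C ρ [fun x _ => Sat (B.st x) φ] [] y [])
      (Function.update (fun _ => []) ta [bit (decide (PrimeIn (LTS Act) φ))])
      ((110 + 3 * Fintype.card (Name (Reg (Var Act)))) * (60 * (B.s r + 1) ^ 3 + y.length)) := by
  have hn2 : 2 ≤ B.s r := B.two_le_s r
  set ρ' := Function.update ρ .arg fun (x y : Fin (B.s r)) => Sat (B.st x) φ with hρ'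
  set M := (leastExp : MExp (Var Act)).eval C ρ' with hM
  have hprime : PrimeIn (LTS Act) φ ↔ ∃ x z, M x z := by
    rw [B.prime_iff hφ hr]
    simp only [hM, leastExp, eval_disj, eval_conj, eval_not, eval_comp, eval_top, true_and, eval_var,
      hρ', Function.update_self, ne_eq, reduceCtorEq, not_false_eq_true, Function.update_of_ne,
      hsim, not_exists, not_and, exists_const_iff]
    constructor
    · rintro (h | ⟨x, hx, h₁, h₂⟩)
      -- If no state is a model, every entry is `true`; the entry at `(0, 0)` exists because there
      -- are states.
      · exact ⟨⟨0, by omega⟩, ⟨0, by omega⟩, .inl fun x => h x x.2⟩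
      · exact ⟨⟨x, hx⟩, ⟨0, by omega⟩, .inr ⟨h₁, fun y h₃ h₄ => h₃ (h₂ y y.2 h₄)⟩⟩
    · rintro ⟨x, -, h | ⟨h₁, h₂⟩⟩
      · exact .inl fun x hx => h ⟨x, hx⟩
      · exact .inr ⟨x, x.2, h₁, fun y hy h₃ => by_contra fun h₄ => h₂ ⟨y, hy⟩ h₄ h₃⟩
  have e₁ := runs_popVar (C := C) (ρ := ρ) (V := []) (x := []) (y := y) (z := []) .arg
    fun (x y : Fin (B.s r)) => Sat (B.st x) φ
  have e₂ := runs_assign_cnt (C := C) (ρ := ρ') (V := []) (x := []) (y := y) (z := []) leastExp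
  rw [← hM] at e₂
  have e₃ := runs_testCnt (C := M) (ρ := ρ') (V := []) (x := []) (y := y) (z := [])
  set f := ((M.enc (β := Symbol Act)).filter fun c => isOne (some c)).reverse with hf
  have hfl : f.length ≤ B.s r * (B.s r + 1) := by
    rw [hf, List.length_reverse]
    exact (List.length_filter_le _ _).trans_eq (Mat.length_enc _)
  have hf₀ : f = [] ↔ ¬PrimeIn (LTS Act) φ := by
    rw [hf, List.reverse_eq_nil_iff, Mat.filter_enc_eq_nil, hprime]
    simp
  have e₄ : Runs (ite tf Option.isSome (push ta (bit true)) (push ta (bit false)))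
      (withTmp (matStacks M ρ' [] [] y []) [] [] [] [] [] f [])
      (withTmp (matStacks M ρ' [] [] y []) [bit (decide (PrimeIn (LTS Act) φ))] [] [] [] [] f [])
      2 := by
    by_cases h : PrimeIn (LTS Act) φ
    · obtain ⟨c, l, hc⟩ := List.exists_cons_of_ne_nil (mt hf₀.1 (not_not.2 h))
      rw [hc]
      exact .ite_true rfl ((runs_push _ _ _).congr (by simp [h]))
    · rw [hf₀.2 h]
      exact .ite_false rfl ((runs_push _ _ _).congr (by simp [h]))
  have e₅ := runs_clearAll_le (Finset.univ.erase (ta : Name (Reg (Var Act)))).toList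
    (withTmp (matStacks M ρ' [] [] y []) [bit (decide (PrimeIn (LTS Act) φ))] [] [] [] [] f [])
    (L := B.s r * (B.s r + 1) + y.length + 1) (by
      intro k
      cases k <;> simp [matStacks, Mat.length_enc, encMats] <;> omega)
  refine ((e₁.seq (e₂.seq (e₃.seq (e₄.seq e₅)))).congr ?_).mono ?_
  · funext k
    by_cases hk : k = ta
    · subst hk
      simp
    · simp [hk]
  · have h₁ : (leastExp : MExp (Var Act)).ops = 103 := by
      simp [MExp.ops, leastExp, disj, conj, MExp.not, comp, top, var, MExp.tr]
    have h₂ : (Finset.univ.erase (ta : Name (Reg (Var Act)))).toList.length ≤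
        Fintype.card (Name (Reg (Var Act))) := by
      rw [Finset.length_toList]
      exact Finset.card_le_univ _
    have h₃ : 2 * (B.s r * (B.s r + 1) + y.length + 1) + 1 ≤ 3 * (60 * (B.s r + 1) ^ 3 + y.length) := by
      nlinarith [Nat.zero_le (B.s r ^ 2), Nat.zero_le (B.s r ^ 3)]
    have h₄ : 1 ≤ (B.s r + 1) ^ 3 := Nat.one_le_pow _ _ (by omega)
    have h₅ := Nat.mul_le_mul h₂ h₃
    rw [h₁]
    generalize (Finset.univ.erase (ta : Name (Reg (Var Act)))).toList.length = m at *
    generalize (B.s r + 1) ^ 3 = q at *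
    linarith [Nat.zero_le y.length]

end HM

/-! ### The running time of the whole procedure -/

namespace HM

open Prog Name Cell Formula

theorem primrec_tow (k : ℕ) : Primrec (tow k) := by
  have hpow : Primrec₂ fun m n : ℕ => m ^ n :=
    Primrec₂.unpaired'.1 Nat.Primrec.pow
  have h : Primrec₂ fun (_ : ℕ) (m : ℕ) => k * 2 ^ m :=
    (Primrec.nat_mul.comp (.const k) (hpow.comp (.const 2) .snd))
  refine (Primrec.nat_rec₁ 1 h).of_eq fun d => ?_
  induction d with
  | zero => rfl
  | succ d ih => simp only [tow, ← ih]

variable {Act : Type} [Fintype Act] [Nonempty Act]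

section

variable [DecidableEq Act] (B : Base Act)

/-- The program of the decision procedure. -/
noncomputable def primeProg (l : List (Symbol Act)) :
    Prog (Name (Reg (Var Act))) (Cell (Symbol Act)) :=
  seq (mdProg l) (seq (sizeProg B) (seq initProg (seq (Com.prepare B).prog
    (seq (scan evalStep l) answerProg))))

/-- With `n` states, the preparation takes time of order `n ^ 4` and each symbol of the formula at
most order `n ^ 3`. The modal depth is at most `n`, so computing it and the number of states stays
within the bound as well. -/
theorem runs_primeProg {l : List (Symbol Act)} (hl : ∀ b, b ∈ l) :
    open Classical in
    ∃ K, ∀ φ : Formula Act, IsTS φ →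
      Runs (primeProg B l) (Function.update (fun _ => []) inp (φ.encode.map sym).reverse)
        (Function.update (fun _ => []) ta [bit (decide (PrimeIn (LTS Act) φ))])
        (K * ((B.s (φ.md - B.j) + 1) ^ 4 * φ.size)) := by
  classical
  refine ⟨(64 + 2 * l.length) + 2 * (20 * (2 + Fintype.card Act) ^ 2 + 21) +
    (Fintype.card (Var Act) + 11) * 4 + (Com.prepare B).ops * 60 + (2403 + l.length) +
    (110 + 3 * Fintype.card (Name (Reg (Var Act)))) * 61, fun φ hφ => ?_⟩
  set d := φ.md with hd
  obtain ⟨n, hn⟩ : ∃ n, n = B.s (d - B.j) := ⟨_, rfl⟩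
  have hlt : B.j + 1 + (d - B.j) < n := hn ▸ B.lt_s (d - B.j)
  have hsize : 1 ≤ φ.size := by cases φ <;> simp [Formula.size]
  have hs : Function.update (fun _ => []) inp (φ.encode.map sym).reverse =
      withTmp (rawStacks (fun _ : Reg (Var Act) => []) [] (φ.encode.map sym).reverse [] [])
        [] [] [] [] [] [] [] := by
    funext k
    cases k <;> simp
  have e₁ := runs_mdProg (κ := Var Act) (g := fun _ => []) hl φ
  have e₂ := runs_sizeProg (κ := Var Act) (β := Symbol Act) (g := fun _ => []) (v := [])
    (x := (φ.encode.map sym).reverse) (y := []) B d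
  have e₃ := runs_initProg (κ := Var Act) (β := Symbol Act)
    (x := (φ.encode.map sym).reverse) (y := []) (n := B.s (d - B.j)) (by omega)
  have e₄ := (Com.prepare B).runs_prog (β := Symbol Act) (n := B.s (d - B.j))
    (fun a b => a = b, fun _ a b => a = b) [] (φ.encode.map sym).reverse [] []
  obtain ⟨h₁, h₂, h₃, h₄⟩ := Com.den_prepare B (r := d - B.j)
    (fun a b => a = b, fun _ a b => a = b)
  have e₅ := (computes_sat B (C := ((Com.prepare B).den
    (fun a b => a = b, fun _ a b => a = b)).1) h₁ h₃ h₄ d).runs_scan hl hd.ge [] []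
  rw [List.append_nil] at e₅
  have e₆ := runs_answerProg B (C := ((Com.prepare B).den
    (fun a b => a = b, fun _ a b => a = b)).1) h₂ hφ (by omega) (φ.encode.map sym)
  rw [hs]
  refine (e₁.seq (e₂.seq (e₃.seq (e₄.seq (e₅.seq e₆))))).mono ?_
  rw [← hn, List.length_map, length_encode]
  generalize φ.size = m at *
  generalize l.length = L at *
  generalize Fintype.card Act = k at *
  generalize Fintype.card (Var Act) = v at *
  generalize Fintype.card (Name (Reg (Var Act))) = c at *
  generalize (Com.prepare B).ops = p at *
  have hq : ∀ i ≤ 4, (n + 1) ^ i ≤ (n + 1) ^ 4 * m := fun i hi =>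
    (Nat.pow_le_pow_right (by omega) hi).trans (Nat.le_mul_of_pos_right _ hsize)
  have hd' : d ≤ n + 1 := by omega
  have b₁ : (m + 1) * (12 * d + L + 20) ≤ (64 + 2 * L) * ((n + 1) ^ 4 * m) := by
    have : (12 * d + L + 20) ≤ (32 + L) * (n + 1) ^ 4 := by
      have : n + 1 ≤ (n + 1) ^ 4 := Nat.le_self_pow (by norm_num) _
      nlinarith [Nat.zero_le L]
    calc (m + 1) * (12 * d + L + 20) ≤ (2 * m) * ((32 + L) * (n + 1) ^ 4) :=
          Nat.mul_le_mul (by omega) this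
      _ = _ := by ring
  have b₂ : (d + B.j + 1) * (20 * (2 * n + k) ^ 2 + n + 20) ≤
      2 * (20 * (2 + k) ^ 2 + 21) * ((n + 1) ^ 4 * m) := by
    have h₁ : (2 * n + k) ^ 2 ≤ ((2 + k) * (n + 1)) ^ 2 := Nat.pow_le_pow_left (by nlinarith) 2
    have h₂ : 20 * (2 * n + k) ^ 2 + n + 20 ≤ (20 * (2 + k) ^ 2 + 21) * (n + 1) ^ 2 := by
      rw [mul_pow] at h₁
      nlinarith
    calc (d + B.j + 1) * (20 * (2 * n + k) ^ 2 + n + 20) ≤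
          (2 * (n + 1)) * ((20 * (2 + k) ^ 2 + 21) * (n + 1) ^ 2) :=
          Nat.mul_le_mul (by omega) h₂
      _ = 2 * (20 * (2 + k) ^ 2 + 21) * (n + 1) ^ 3 := by ring
      _ ≤ _ := Nat.mul_le_mul_left _ (hq 3 (by norm_num))
  have b₃ : (v + 11) * (4 * (n + 1) ^ 2) ≤ (v + 11) * 4 * ((n + 1) ^ 4 * m) := by
    rw [← mul_assoc]
    exact Nat.mul_le_mul_left _ (hq 2 (by norm_num))
  have b₄ : p * (60 * (n + 1) ^ 4) ≤ p * 60 * ((n + 1) ^ 4 * m) := by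
    rw [← mul_assoc]
    exact Nat.mul_le_mul_left _ (hq 4 le_rfl)
  have b₅ : m * (40 * (60 * (n + 1) ^ 3) + L + 2) + 1 ≤ (2403 + L) * ((n + 1) ^ 4 * m) := by
    have h₁ : (n + 1) ^ 3 ≤ (n + 1) ^ 4 := Nat.pow_le_pow_right (by omega) (by norm_num)
    have h₂ : 1 ≤ (n + 1) ^ 4 := Nat.one_le_pow _ _ (by omega)
    have h₃ : 40 * (60 * (n + 1) ^ 3) + L + 2 ≤ (2402 + L) * (n + 1) ^ 4 := by
      nlinarith [Nat.mul_le_mul_left L h₂]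
    calc m * (40 * (60 * (n + 1) ^ 3) + L + 2) + 1
        ≤ m * ((2402 + L) * (n + 1) ^ 4) + (n + 1) ^ 4 * m :=
          Nat.add_le_add (Nat.mul_le_mul_left _ h₃) (Nat.mul_pos h₂ hsize)
      _ = _ := by ring
  have b₆ : (110 + 3 * c) * (60 * (n + 1) ^ 3 + m) ≤
      (110 + 3 * c) * 61 * ((n + 1) ^ 4 * m) := by
    have h₁ := hq 3 (by norm_num)
    have h₂ : m ≤ (n + 1) ^ 4 * m := Nat.le_mul_of_pos_left _ (by positivity)
    rw [mul_assoc]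
    exact Nat.mul_le_mul_left _ (by linarith)
  linarith

end

/-- The fourth power of the number of states is absorbed by a constant multiple of a single tower
value, by `Base.exists_pow_s_le` with exponent `4`. -/
theorem decidableInTime_prime : ∃ K : ℕ, DecidableInTime
    (fun φ : LTS Act => φ.1.encode) (fun φ => PrimeIn (LTS Act) φ.1)
    (fun φ => K * (tow (Fintype.card Act) φ.1.md * φ.1.size)) := by
  classical
  obtain ⟨B, hB⟩ := Base.exists_small (Act := Act)
  obtain ⟨C, hC⟩ := B.exists_pow_s_le hB 4
  have : Fintype (Symbol Act) := Fintype.ofFinite _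
  obtain ⟨K, hK⟩ := runs_primeProg B (l := Finset.univ.toList) (fun b => by simp)
  -- The factor `16` comes from `n + 1 ≤ 2 * n` in the fourth power; the `3` covers reading the
  -- input and the two additional steps of the machine.
  refine ⟨K * (16 * C) + 3, machine (primeProg B Finset.univ.toList) sym isOne inp ta, fun φ => ?_⟩
  obtain ⟨t, ht, h⟩ := hK φ.1 φ.2
  obtain ⟨o⟩ := h.outputsInTime sym isOne (w := φ.1.encode)
  have hc : isOne (some (bit (decide (PrimeIn (LTS Act) φ.1)) : Cell (Symbol Act))) =
      decide (PrimeIn (LTS Act) φ.1) := by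
    cases decide (PrimeIn (LTS Act) φ.1) <;> rfl
  rw [hc] at o
  refine ⟨⟨o.1, o.2.trans ?_⟩⟩
  have hsize : 1 ≤ φ.1.size := by cases φ.1 <;> simp [Formula.size]
  have ht₀ : 1 ≤ tow (Fintype.card Act) φ.1.md := tow_pos Fintype.card_pos _
  have hs : (B.s (φ.1.md - B.j) + 1) ^ 4 ≤ 16 * C * tow (Fintype.card Act) φ.1.md := by
    have h₁ := B.two_le_s (φ.1.md - B.j)
    calc (B.s (φ.1.md - B.j) + 1) ^ 4 ≤ (2 * B.s (φ.1.md - B.j)) ^ 4 :=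
          Nat.pow_le_pow_left (by omega) 4
      _ = 16 * B.s (φ.1.md - B.j) ^ 4 := by ring
      _ ≤ _ := by rw [mul_assoc]; exact Nat.mul_le_mul_left _ (hC _)
  have h₂ : K * ((B.s (φ.1.md - B.j) + 1) ^ 4 * φ.1.size) ≤
      K * (16 * C) * (tow (Fintype.card Act) φ.1.md * φ.1.size) := by
    calc _ ≤ K * (16 * C * tow (Fintype.card Act) φ.1.md * φ.1.size) :=
          Nat.mul_le_mul_left _ (Nat.mul_le_mul_right _ hs)
      _ = _ := by ring
  have h₃ : φ.1.size ≤ tow (Fintype.card Act) φ.1.md * φ.1.size :=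
    Nat.le_mul_of_pos_left _ ht₀
  rw [length_encode]
  beta_reduce
  generalize tow (Fintype.card Act) φ.1.md * φ.1.size = q at *
  rw [add_mul]
  omega

theorem DecidableInTime.mono {ι Γ : Type} {enc : ι → List Γ} {P : ι → Prop} {T T' : ι → ℕ}
    (h : DecidableInTime enc P T) (hT : ∀ x, T x ≤ T' x) : DecidableInTime enc P T' := by
  obtain ⟨M, hM⟩ := h
  refine ⟨M, fun x => ?_⟩
  obtain ⟨o⟩ := hM x
  exact ⟨⟨o.1, o.2.trans (hT x)⟩⟩

end HM

theorem mainTheorem8 (Act : Type) [Fintype Act] [Nonempty Act] :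
    (∃ C : ℕ, HM.DecidableInTime
        (fun φ : HM.Formula.LTS Act => φ.1.encode)
        (fun φ => HM.Formula.PrimeIn (HM.Formula.LTS Act) φ.1)
        (fun φ => C * (HM.tow (Fintype.card Act) φ.1.md ^ 3 * φ.1.size))) ∧
    HM.IsFPT
        (fun φ : HM.Formula.LTS Act => φ.1.encode)
        (fun φ => HM.Formula.PrimeIn (HM.Formula.LTS Act) φ.1)
        (fun φ => φ.1.md) ∧
    ∀ φ ∈ HM.Formula.LTS Act,
      (φ.Satisfiable ∧ HM.Formula.PrimeIn (HM.Formula.LTS Act) φ) ↔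
        ∃ p : HM.Proc Act, p.depth ≤ φ.md ∧ φ.Sat p ∧
          ∀ q : HM.Proc Act, q.depth ≤ φ.md + 1 → φ.Sat q → p.TSLe q := by
  obtain ⟨K, hK⟩ := HM.decidableInTime_prime (Act := Act)
  refine ⟨⟨K, hK.mono fun φ => ?_⟩, ⟨fun d => K * HM.tow (Fintype.card Act) d, ?_, 1,
    hK.mono fun φ => ?_⟩, fun φ hφ => HM.Formula.satisfiable_and_prime_iff hφ⟩
  -- The bound that was proved is linear in the tower value, so the cube is a weakening.
  · exact Nat.mul_le_mul_left _ (Nat.mul_le_mul_right _ (Nat.le_self_pow (by norm_num) _))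
  · exact (Primrec.nat_mul.comp (.const K) (HM.primrec_tow _)).to_comp
  · rw [pow_one, HM.Formula.length_encode, mul_assoc]
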